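/- **Setting.** Let $\mathcal X_1,\mathcal X_2,\mathcal Y_1,\mathcal Y_2$ be finite sets, $q(x_1,x_2)$ a pmf on $\mathcal X_1\times\mathcal X_2$, $q(y_1,y_2|x_1,x_2)$ a channel, and $r\ge 1$ an integer. All entropies and mutual informations are in bits. *Codes.* Terminals 1 and 2 observe $X_1^n$ and $X_2^n$ respectively, where $(X_{1,t},X_{2,t})_{t=1}^n$ are i.i.d. with law $q(x_1,x_2)$; there is no common randomness. A code of block length $n$ with $r$ rounds consists of finite message alphabets for $C_1,\dots,C_r$, randomized encoders $\tilde p(c_i|c_1,\dots,c_{i-1},x_1^n)$ for odd $i$ and $\tilde p(c_i|c_1,\dots,c_{i-1},x_2^n)$ for even $i$, and randomized decoders $\tilde p(y_1^n|c_1,\dots,c_r,x_1^n)$ and $\tilde p(y_2^n|c_1,\dots,c_r,x_2^n)$. The induced pmf $\tilde p$ of $(X_1^n,X_2^n,C_1,\dots,C_r,Y_1^n,Y_2^n)$ is the product of $\prod_{t} q(x_{1,t},x_{2,t})$ and these conditional pmfs. The code has rates $(R_{12},R_{21})$ if $$\frac1n\sum_{i\ \mathrm{odd}}H(C_i)\le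 R_{12},\qquad \frac1n\sum_{i\ \mathrm{even}}H(C_i)\le R_{21}.$$ *Region.* A pair $(R_{12},R_{21})$ is achievable for empirical coordination if there is a sequence of codes, one for each block length $n\ge1$, with rates $(R_{12},R_{21})$ such that for every $\epsilon>0$ $$\lim_{n\to\infty}\tilde p\Big(\big\|\hat p_{X_1^nX_2^nY_1^nY_2^n}-q_{X_1X_2Y_1Y_2}\big\|_{TV}>\epsilon\Big)=0,$$ where $\hat p$ is the empirical distribution (type) of the sequence $(X_{1,t},X_{2,t},Y_{1,t},Y_{2,t})_{t=1}^n$ and $q_{X_1X_2Y_1Y_2}=q(x_1,x_2)q(y_1,y_2|x_1,x_2)$. The empirical coordination rate region with $r$ rounds is the closure of the set of achievable pairs. *The set $T(r)$.* $T(r)$ is the set of pmfs $p(f_1,\dots,f_r,x_1,x_2,y_1,y_2)$, with $F_i$ taking values in a finite set $\mathcal F_i$, such that - $(X_1,X_2,Y_1,Y_2)$ has pmf $q(x_1,x_2)q(y_1,y_2|x_1,x_2)$; - $F_i - (F_1,\dots,F_{i-1},X_1) - X_2$ is a Markov chain for every odd $i$, and $F_i - (F_1,\dots,F_{i-1},X_2)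 - X_1$ for every even $i$; - $Y_1 - (F_1,\dots,F_r,X_1) - (X_2,Y_2)$ and $Y_2 - (F_1,\dots,F_r,X_2) - (X_1,Y_1)$ are Markov chains; - $|\mathcal F_1|\le|\mathcal X_1||\mathcal X_2||\mathcal Y_1||\mathcal Y_2|+3$, and $|\mathcal F_i|\le|\mathcal X_1||\mathcal X_2||\mathcal Y_1||\mathcal Y_2|\prod_{j=1}^{i-1}|\mathcal F_j|+2$ for $2\le i\le r$. **Theorem.** The empirical coordination rate region with $r$ rounds is the set of all pairs $(R_{12},R_{21})$ with $R_{12},R_{21}\ge0$ for which there is a pmf in $T(r)$ such that $$R_{12}\ge I(X_1;F_1,\dots,F_r|X_2),\qquad R_{21}\ge I(X_2;F_1,\dots,F_r|X_1).$$ -/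

import Mathlib

open Filter Topology

noncomputable section

namespace Coordination

/-! ### Finite probability: laws, Markov chains, entropy (in bits)

A probability mass function on a finite set `Ω` is an element of `stdSimplex ℝ Ω`, and a random
variable on it is a function defined on `Ω`. -/

open Classical in
/-- The law of the random variable `A` under the mass function `p`. -/
def lawOf {Ω α : Type*} [Fintype Ω] (p : Ω → ℝ) (A : Ω → α) (a : α) : ℝ :=
  ∑ ω, if A ω = a then p ω else 0

open Classical in
/-- The probability of the event `E` under the mass function `p`. -/
def prob {Ω : Type*} [Fintype Ω] (p : Ω → ℝ) (E : Set Ω) : ℝ :=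
  ∑ ω, if ω ∈ E then p ω else 0

/-- The Markov chain `A - B - C` under `p`: `p(a,b,c) p(b) = p(a,b) p(b,c)`. -/
def MarkovChain {Ω α β γ : Type*} [Fintype Ω] (p : Ω → ℝ)
    (A : Ω → α) (B : Ω → β) (C : Ω → γ) : Prop :=
  ∀ a b c, lawOf p (fun ω => (A ω, B ω, C ω)) (a, b, c) * lawOf p B b =
    lawOf p (fun ω => (A ω, B ω)) (a, b) * lawOf p (fun ω => (B ω, C ω)) (b, c)

/-- Shannon entropy `H(A)` in bits. -/
def entropy {Ω α : Type*} [Fintype Ω] [Fintype α] (p : Ω → ℝ) (A : Ω → α) : ℝ :=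
  (∑ a, Real.negMulLog (lawOf p A a)) / Real.log 2

/-- Conditional entropy `H(A | B) = H(A, B) - H(B)`. -/
def condEntropy {Ω α β : Type*} [Fintype Ω] [Fintype α] [Fintype β] (p : Ω → ℝ)
    (A : Ω → α) (B : Ω → β) : ℝ :=
  entropy p (fun ω => (A ω, B ω)) - entropy p B

/-- Conditional mutual information `I(A ; B | C) = H(A | C) - H(A | B, C)`. -/
def condMutualInfo {Ω α β γ : Type*} [Fintype Ω] [Fintype α] [Fintype β] [Fintype γ] (p : Ω → ℝ)
    (A : Ω → α) (B : Ω → β) (C : Ω → γ) : ℝ :=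
  condEntropy p A C - condEntropy p A (fun ω => (B ω, C ω))

/-- Total variation distance of two mass functions. -/
def tvDist {α : Type*} [Fintype α] (p q : α → ℝ) : ℝ := (1 / 2) * ∑ a, |p a - q a|

open Classical in
/-- The empirical distribution of a sequence of length `n`. -/
def empirical {α : Type*} {n : ℕ} (z : Fin n → α) (a : α) : ℝ :=
  ((Finset.univ.filter fun t => z t = a).card : ℝ) / n

/-- The target mass function `q(x₁,x₂) q(y₁,y₂ | x₁,x₂)`. -/
def target {X₁ X₂ Y₁ Y₂ : Type*} (q : X₁ × X₂ → ℝ) (W : X₁ × X₂ → Y₁ × Y₂ → ℝ) :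
    X₁ × X₂ × Y₁ × Y₂ → ℝ :=
  fun z => q (z.1, z.2.1) * W (z.1, z.2.1) (z.2.2.1, z.2.2.2)

/-! ### Codes

Rounds are indexed by `i : Fin r`; the `i`-th index is round number `i + 1`, so that terminal 1
speaks when `i + 1` is odd and terminal 2 when it is even. -/

/-- The values of a sequence indexed by rounds at the rounds before `i`. -/
def past {r : ℕ} {k : Fin r → ℕ} (c : ∀ i, Fin (k i)) (i : Fin r) :
    (j : Set.Iio i) → Fin (k j) :=
  fun j => c j

/-- A code of block length `n` with `r` rounds and no common randomness. The message of round `i`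
takes `msg i` values. Only the encoders of the terminal whose turn it is enter the induced law:
`enc₁` on odd rounds, `enc₂` on even rounds. -/
structure Code (X₁ X₂ Y₁ Y₂ : Type*) [Fintype Y₁] [Fintype Y₂] (r n : ℕ) where
  /-- the sizes of the message alphabets -/
  msg : Fin r → ℕ
  /-- `p(cᵢ | c₁,…,cᵢ₋₁, x₁ⁿ)` -/
  enc₁ : (i : Fin r) → ((j : Set.Iio i) → Fin (msg j)) → (Fin n → X₁) → Fin (msg i) → ℝ
  /-- `p(cᵢ | c₁,…,cᵢ₋₁, x₂ⁿ)` -/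
  enc₂ : (i : Fin r) → ((j : Set.Iio i) → Fin (msg j)) → (Fin n → X₂) → Fin (msg i) → ℝ
  /-- `p(y₁ⁿ | c₁,…,cᵣ, x₁ⁿ)` -/
  dec₁ : ((i : Fin r) → Fin (msg i)) → (Fin n → X₁) → (Fin n → Y₁) → ℝ
  /-- `p(y₂ⁿ | c₁,…,cᵣ, x₂ⁿ)` -/
  dec₂ : ((i : Fin r) → Fin (msg i)) → (Fin n → X₂) → (Fin n → Y₂) → ℝ
  enc₁_mem : ∀ i h x, Odd (i.val + 1) → enc₁ i h x ∈ stdSimplex ℝ (Fin (msg i))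
  enc₂_mem : ∀ i h x, Even (i.val + 1) → enc₂ i h x ∈ stdSimplex ℝ (Fin (msg i))
  dec₁_mem : ∀ c x, dec₁ c x ∈ stdSimplex ℝ (Fin n → Y₁)
  dec₂_mem : ∀ c x, dec₂ c x ∈ stdSimplex ℝ (Fin n → Y₂)

section Code

variable {X₁ X₂ Y₁ Y₂ : Type*} [Fintype X₁] [Fintype X₂] [Fintype Y₁] [Fintype Y₂] {r n : ℕ}

/-- The sample space of a code: `(x₁ⁿ, x₂ⁿ, (c₁,…,cᵣ), y₁ⁿ, y₂ⁿ)`. -/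
abbrev Code.Outcome (κ : Code X₁ X₂ Y₁ Y₂ r n) : Type _ :=
  (Fin n → X₁) × (Fin n → X₂) × (∀ i, Fin (κ.msg i)) × (Fin n → Y₁) × (Fin n → Y₂)

/-- The joint mass function induced by a code when the sources are i.i.d. with law `q`. -/
def Code.law (κ : Code X₁ X₂ Y₁ Y₂ r n) (q : X₁ × X₂ → ℝ) : κ.Outcome → ℝ :=
  fun (x₁, x₂, c, y₁, y₂) =>
    (∏ t, q (x₁ t, x₂ t)) *
    (∏ i : Fin r, if Odd (i.val + 1) then κ.enc₁ i (past c i) x₁ (c i)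
      else κ.enc₂ i (past c i) x₂ (c i)) *
    κ.dec₁ c x₁ y₁ * κ.dec₂ c x₂ y₂

/-- `H(Cᵢ)`, the entropy of the message of round `i`. -/
def Code.msgEntropy (κ : Code X₁ X₂ Y₁ Y₂ r n) (q : X₁ × X₂ → ℝ) (i : Fin r) : ℝ :=
  entropy (κ.law q) (fun ω => ω.2.2.1 i)

/-- The code has rates at most `(R₁₂, R₂₁)`. -/
def Code.HasRate (κ : Code X₁ X₂ Y₁ Y₂ r n) (q : X₁ × X₂ → ℝ) (R₁₂ R₂₁ : ℝ) : Prop :=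
  (1 / (n : ℝ)) * (∑ i with Odd (i.val + 1), κ.msgEntropy q i) ≤ R₁₂ ∧
  (1 / (n : ℝ)) * (∑ i with Even (i.val + 1), κ.msgEntropy q i) ≤ R₂₁

/-- The event that the empirical distribution of `(x₁ⁿ, x₂ⁿ, y₁ⁿ, y₂ⁿ)` is farther than `ε` from
the target in total variation. -/
def Code.badEvent (κ : Code X₁ X₂ Y₁ Y₂ r n) (q : X₁ × X₂ → ℝ) (W : X₁ × X₂ → Y₁ × Y₂ → ℝ)
    (ε : ℝ) : Set κ.Outcome :=
  {ω | ε < tvDist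
    (empirical fun t => (ω.1 t, ω.2.1 t, ω.2.2.2.1 t, ω.2.2.2.2 t)) (target q W)}

end Code

/-- `(R₁₂, R₂₁)` is achievable for empirical coordination with `r` rounds. -/
def Achievable {X₁ X₂ Y₁ Y₂ : Type*} [Fintype X₁] [Fintype X₂] [Fintype Y₁] [Fintype Y₂]
    (r : ℕ) (q : X₁ × X₂ → ℝ) (W : X₁ × X₂ → Y₁ × Y₂ → ℝ) (R₁₂ R₂₁ : ℝ) : Prop :=
  ∃ κ : ∀ n : ℕ, Code X₁ X₂ Y₁ Y₂ r n,
    (∀ n, 1 ≤ n → (κ n).HasRate q R₁₂ R₂₁) ∧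
    ∀ ε : ℝ, 0 < ε →
      Tendsto (fun n => prob ((κ n).law q) ((κ n).badEvent q W ε)) atTop (𝓝 0)

/-- The empirical coordination rate region: the closure of the set of achievable rate pairs. -/
def rateRegion {X₁ X₂ Y₁ Y₂ : Type*} [Fintype X₁] [Fintype X₂] [Fintype Y₁] [Fintype Y₂]
    (r : ℕ) (q : X₁ × X₂ → ℝ) (W : X₁ × X₂ → Y₁ × Y₂ → ℝ) : Set (ℝ × ℝ) :=
  closure {R | Achievable r q W R.1 R.2}

/-! ### Auxiliary distributions -/

section Aux

variable {X₁ X₂ Y₁ Y₂ : Type*} {r : ℕ}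

/-- Values of `((F₁,…,Fᵣ), X₁, X₂, Y₁, Y₂)`, the alphabet of `Fᵢ` having `k i` elements. -/
abbrev AuxOutcome (X₁ X₂ Y₁ Y₂ : Type*) {r : ℕ} (k : Fin r → ℕ) : Type _ :=
  (∀ i, Fin (k i)) × X₁ × X₂ × Y₁ × Y₂

variable {k : Fin r → ℕ}

/-- The random variable `F = (F₁,…,Fᵣ)`. -/
def rvF (ω : AuxOutcome X₁ X₂ Y₁ Y₂ k) : ∀ i, Fin (k i) := ω.1
/-- The random variable `X₁`. -/
def rvX₁ (ω : AuxOutcome X₁ X₂ Y₁ Y₂ k) : X₁ := ω.2.1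
/-- The random variable `X₂`. -/
def rvX₂ (ω : AuxOutcome X₁ X₂ Y₁ Y₂ k) : X₂ := ω.2.2.1
/-- The random variable `Y₁`. -/
def rvY₁ (ω : AuxOutcome X₁ X₂ Y₁ Y₂ k) : Y₁ := ω.2.2.2.1
/-- The random variable `Y₂`. -/
def rvY₂ (ω : AuxOutcome X₁ X₂ Y₁ Y₂ k) : Y₂ := ω.2.2.2.2

/-- `p` is a mass function of `(F₁,…,Fᵣ, X₁, X₂, Y₁, Y₂)` that belongs to `T(r)`. -/
structure MemT [Fintype X₁] [Fintype X₂] [Fintype Y₁] [Fintype Y₂]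
    (q : X₁ × X₂ → ℝ) (W : X₁ × X₂ → Y₁ × Y₂ → ℝ)
    (p : AuxOutcome X₁ X₂ Y₁ Y₂ k → ℝ) : Prop where
  pmf : p ∈ stdSimplex ℝ (AuxOutcome X₁ X₂ Y₁ Y₂ k)
  law_XY : lawOf p (fun ω => (rvX₁ ω, rvX₂ ω, rvY₁ ω, rvY₂ ω)) = target q W
  markov_odd : ∀ i : Fin r, Odd (i.val + 1) →
    MarkovChain p (fun ω => rvF ω i) (fun ω => (past (rvF ω) i, rvX₁ ω)) rvX₂
  markov_even : ∀ i : Fin r, Even (i.val + 1) →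
    MarkovChain p (fun ω => rvF ω i) (fun ω => (past (rvF ω) i, rvX₂ ω)) rvX₁
  markov_Y₁ : MarkovChain p rvY₁ (fun ω => (rvF ω, rvX₁ ω)) (fun ω => (rvX₂ ω, rvY₂ ω))
  markov_Y₂ : MarkovChain p rvY₂ (fun ω => (rvF ω, rvX₂ ω)) (fun ω => (rvX₁ ω, rvY₁ ω))
  card_first : ∀ i : Fin r, i.val + 1 = 1 →
    k i ≤ Fintype.card X₁ * Fintype.card X₂ * Fintype.card Y₁ * Fintype.card Y₂ + 3
  card_later : ∀ i : Fin r, 1 < i.val + 1 →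
    k i ≤ Fintype.card X₁ * Fintype.card X₂ * Fintype.card Y₁ * Fintype.card Y₂ *
      (∏ j ∈ Finset.Iio i, k j) + 2

end Aux

end Coordination

end

open Filter Topology

noncomputable section

namespace Coordination

/-! ### Laws of random variables -/

section Laws

open scoped Classical

variable {Ω α β γ : Type*} [Fintype Ω] {p : Ω → ℝ}

/-! Both inclusions use the same factorization: given the past messages, a message depends only on
the source of the terminal that speaks.

Converse. Let `T` be a uniform time in a block of length `n`. Take `F_i = C_i`, and attach to `F_1`
also `T`, the letters of `X_1` before `T` and the letters of `X_2` after `T`. Together with the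
current letter of either source this reveals, at every time, one of the two sources. Exchanging the
other source between two outcomes with the same transcript then preserves the product of their
probabilities, and this is conditional independence (`markovChain_of_splice`, `Code.isAux`). The
chain rule, run forward in time for `X_1` and backward for `X_2`, gives with the same `F` the bounds
`n I(X_1;F|X_2) ≤ I(X_1^n;C|X_2^n) ≤ ∑ H(C_i)` over odd `i`, and their mirror image over even `i`.
The law of the random letter is the mean of the empirical distribution, hence near the target
(`Code.abs_lawOf_letter_sub_target_le`). A Carathéodory argument, one round after another, shrinks
the alphabets (`IsAux.exists_card_le`). Only finitely many alphabet sizes remain, so compactness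
turns these approximations into an element of `T(r)` and absorbs the closure as well
(`exists_memT_of_approx`).

Achievability. In place of random binning, independent copies of an element of `T(r)` are simulated
with shared seeds. In round `i` the speaker draws `F_i^n` from its own kernel together with a
uniform message among `M_i`; the listener uses the same seed to draw from its own kernel and the
point mass at the received message. Sampling by exponential races (`exists_coupling`) makes the
draws agree up to a fraction `τ` wherever the speaker's probability is at most `τ M_i` times the
listener's. The mean logarithm of that ratio, per letter, is the information of the round, and its
sum over odd rounds is `I(X_1;F|X_2)` (`MemT.natsInfo_fst`). By the weak law of large numbers it is
therefore enough that `log M_i` exceeds `n` times this information by a small multiple of `n`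
(`MemT.sum_iid_cost_le`).

The quality of a code is a single number, the mean total variation distance to the target. Some
fixed value of the seeds is thus at least as good as the average, and no common randomness is needed
(`exists_protocol`). The decoders draw the outputs with private randomness. -/

lemma lawOf_nonneg (hp : ∀ ω, 0 ≤ p ω) (A : Ω → α) (a : α) : 0 ≤ lawOf p A a :=
  Finset.sum_nonneg fun ω _ => by split_ifs <;> simp [hp ω]

lemma le_lawOf (hp : ∀ ω, 0 ≤ p ω) (A : Ω → α) (ω : Ω) : p ω ≤ lawOf p A (A ω) := by
  have h := Finset.single_le_sum (f := fun ω' => if A ω' = A ω then p ω' else 0)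
    (fun ω' _ => by split_ifs <;> simp [hp ω']) (Finset.mem_univ ω)
  simpa [lawOf] using h

lemma lawOf_pos (hp : ∀ ω, 0 ≤ p ω) (A : Ω → α) {ω : Ω} (hω : p ω ≠ 0) : 0 < lawOf p A (A ω) :=
  lt_of_lt_of_le (lt_of_le_of_ne (hp ω) (Ne.symm hω)) (le_lawOf hp A ω)

lemma exists_of_lawOf_ne_zero {A : Ω → α} {a : α} (h : lawOf p A a ≠ 0) :
    ∃ ω, p ω ≠ 0 ∧ A ω = a := by
  obtain ⟨ω, -, hω⟩ := Finset.exists_ne_zero_of_sum_ne_zero h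
  by_cases hA : A ω = a
  · exact ⟨ω, by simpa [hA] using hω, hA⟩
  · simp [hA] at hω

/-- Laws only depend on the events they measure, up to null outcomes. -/
lemma lawOf_congr {A : Ω → α} {B : Ω → β} {a : α} {b : β}
    (h : ∀ ω, p ω ≠ 0 → (A ω = a ↔ B ω = b)) : lawOf p A a = lawOf p B b := by
  refine Finset.sum_congr rfl fun ω _ => ?_
  by_cases hω : p ω = 0
  · simp [hω]
  · simp [h ω hω]

lemma sum_lawOf_mul [Fintype α] (p : Ω → ℝ) (A : Ω → α) (φ : α → ℝ) :
    ∑ a, lawOf p A a * φ a = ∑ ω, p ω * φ (A ω) := by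
  simp only [lawOf, Finset.sum_mul]
  rw [Finset.sum_comm]
  refine Finset.sum_congr rfl fun ω _ => ?_
  simp [ite_mul]

lemma sum_lawOf [Fintype α] (p : Ω → ℝ) (A : Ω → α) : ∑ a, lawOf p A a = ∑ ω, p ω := by
  simpa using sum_lawOf_mul p A fun _ => 1

lemma lawOf_lawOf [Fintype α] (p : Ω → ℝ) (A : Ω → α) (B : α → β) :
    lawOf (lawOf p A) B = lawOf p fun ω => B (A ω) := by
  funext b
  have := sum_lawOf_mul p A fun a => if B a = b then 1 else 0
  simpa [lawOf] using this

lemma lawOf_mem_stdSimplex [Fintype α] (hp : p ∈ stdSimplex ℝ Ω) (A : Ω → α) :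
    lawOf p A ∈ stdSimplex ℝ α :=
  ⟨fun a => lawOf_nonneg hp.1 A a, by rw [sum_lawOf, hp.2]⟩

lemma sum_lawOf_fst [Fintype α] (p : Ω → ℝ) (A : Ω → α) (B : Ω → β) (b : β) :
    ∑ a, lawOf p (fun ω => (A ω, B ω)) (a, b) = lawOf p B b := by
  simp only [lawOf]
  rw [Finset.sum_comm]
  refine Finset.sum_congr rfl fun ω _ => ?_
  by_cases h : B ω = b <;> simp [Prod.ext_iff, h]

lemma sum_lawOf_snd [Fintype β] (p : Ω → ℝ) (A : Ω → α) (B : Ω → β) (a : α) :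
    ∑ b, lawOf p (fun ω => (A ω, B ω)) (a, b) = lawOf p A a := by
  simp only [lawOf]
  rw [Finset.sum_comm]
  refine Finset.sum_congr rfl fun ω _ => ?_
  by_cases h : A ω = a <;> simp [Prod.ext_iff, h]

lemma lawOf_reweight (p : Ω → ℝ) (B : Ω → β) (w : Ω → ℝ) (μ : β → ℝ) (hw : ∀ ω, w ω = μ (B ω))
    (b : β) : lawOf (fun ω => w ω * p ω) B b = μ b * lawOf p B b := by
  simp only [lawOf, Finset.mul_sum]
  refine Finset.sum_congr rfl fun ω _ => ?_
  by_cases h : B ω = b <;> simp [h, hw]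

lemma lawOf_le_one (hp : p ∈ stdSimplex ℝ Ω) (A : Ω → α) (a : α) : lawOf p A a ≤ 1 := by
  rw [← hp.2]
  exact Finset.sum_le_sum fun ω _ => by split_ifs <;> simp [hp.1 ω]

/-- The Markov property only has to be tested on values that are attained. -/
lemma markovChain_iff {A : Ω → α} {B : Ω → β} {C : Ω → γ} :
    MarkovChain p A B C ↔ ∀ ω₁ ω₂, p ω₁ ≠ 0 → p ω₂ ≠ 0 → B ω₁ = B ω₂ →
      lawOf p (fun ω => (A ω, B ω, C ω)) (A ω₁, B ω₁, C ω₂) * lawOf p B (B ω₁) =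
      lawOf p (fun ω => (A ω, B ω)) (A ω₁, B ω₁) * lawOf p (fun ω => (B ω, C ω)) (B ω₁, C ω₂) := by
  refine ⟨fun h ω₁ ω₂ _ _ _ => h _ _ _, fun h a b c => ?_⟩
  by_cases hAB : ∃ ω, p ω ≠ 0 ∧ A ω = a ∧ B ω = b
  · by_cases hBC : ∃ ω, p ω ≠ 0 ∧ B ω = b ∧ C ω = c
    · obtain ⟨ω₁, h₁, rfl, rfl⟩ := hAB
      obtain ⟨ω₂, h₂, hB, rfl⟩ := hBC
      exact h ω₁ ω₂ h₁ h₂ hB.symm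
    · have e₁ : lawOf p (fun ω => (A ω, B ω, C ω)) (a, b, c) = 0 := by
        by_contra hne
        obtain ⟨ω, hω, e⟩ := exists_of_lawOf_ne_zero hne
        exact hBC ⟨ω, hω, by simpa using congrArg (·.2.1) e, by simpa using congrArg (·.2.2) e⟩
      have e₂ : lawOf p (fun ω => (B ω, C ω)) (b, c) = 0 := by
        by_contra hne
        obtain ⟨ω, hω, e⟩ := exists_of_lawOf_ne_zero hne
        exact hBC ⟨ω, hω, by simpa using congrArg (·.1) e, by simpa using congrArg (·.2) e⟩
      rw [e₁, e₂]; ring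
  · have e₁ : lawOf p (fun ω => (A ω, B ω, C ω)) (a, b, c) = 0 := by
      by_contra hne
      obtain ⟨ω, hω, e⟩ := exists_of_lawOf_ne_zero hne
      exact hAB ⟨ω, hω, by simpa using congrArg (·.1) e, by simpa using congrArg (·.2.1) e⟩
    have e₂ : lawOf p (fun ω => (A ω, B ω)) (a, b) = 0 := by
      by_contra hne
      obtain ⟨ω, hω, e⟩ := exists_of_lawOf_ne_zero hne
      exact hAB ⟨ω, hω, by simpa using congrArg (·.1) e, by simpa using congrArg (·.2) e⟩
    rw [e₁, e₂]; ring

/-- The Markov property only depends on the partitions of the support that are generated by the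
three random variables. -/
lemma MarkovChain.congr {α' β' γ' : Type*} {A : Ω → α} {B : Ω → β} {C : Ω → γ}
    {A' : Ω → α'} {B' : Ω → β'} {C' : Ω → γ'} (h : MarkovChain p A B C)
    (hA : ∀ ω ω', p ω ≠ 0 → p ω' ≠ 0 → (A ω = A ω' ↔ A' ω = A' ω'))
    (hB : ∀ ω ω', p ω ≠ 0 → p ω' ≠ 0 → (B ω = B ω' ↔ B' ω = B' ω'))
    (hC : ∀ ω ω', p ω ≠ 0 → p ω' ≠ 0 → (C ω = C ω' ↔ C' ω = C' ω')) :
    MarkovChain p A' B' C' := by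
  rw [markovChain_iff] at h ⊢
  intro ω₁ ω₂ h₁ h₂ hB'
  have := h ω₁ ω₂ h₁ h₂ ((hB _ _ h₁ h₂).2 hB')
  convert this using 2 <;> refine lawOf_congr fun ω hω => ?_ <;>
    simp [Prod.ext_iff, hA ω ω₁ hω h₁, hB ω ω₁ hω h₁, hC ω ω₂ hω h₂]

lemma markovChain_lawOf {δ : Type*} [Fintype δ] (Z : Ω → δ) {A : δ → α} {B : δ → β} {C : δ → γ} :
    MarkovChain (lawOf p Z) A B C ↔
      MarkovChain p (fun ω => A (Z ω)) (fun ω => B (Z ω)) (fun ω => C (Z ω)) := by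
  simp only [MarkovChain, lawOf_lawOf]

/-- A Markov chain `A - B - C` obtained from an exchange of the coordinates that determine `C`
between two outcomes with the same value of `B`. -/
lemma markovChain_of_splice {A : Ω → α} {B : Ω → β} {C : Ω → γ} (σ : Ω → Ω → Ω)
    (hA : ∀ ω ω', B ω = B ω' → A (σ ω ω') = A ω)
    (hB : ∀ ω ω', B ω = B ω' → B (σ ω ω') = B ω)
    (hC : ∀ ω ω', B ω = B ω' → C (σ ω ω') = C ω')
    (hσ : ∀ ω ω', B ω = B ω' → σ (σ ω ω') (σ ω' ω) = ω)
    (hp : ∀ ω ω', B ω = B ω' → p (σ ω ω') * p (σ ω' ω) = p ω * p ω') :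
    MarkovChain p A B C := by
  intro a b c
  simp only [lawOf, Finset.sum_mul_sum, ← Finset.sum_product', Finset.univ_product_univ]
  -- Both sides are sums over pairs of outcomes. The exchange, applied to pairs with equal `B`, is
  -- an involution that carries one sum to the other: it moves the condition on `C` from the first
  -- outcome to the second.
  let τ : Ω × Ω → Ω × Ω := fun z => if B z.1 = B z.2 then (σ z.1 z.2, σ z.2 z.1) else z
  have hτ : Function.Involutive τ := by
    intro z
    by_cases hz : B z.1 = B z.2
    · have : B (σ z.1 z.2) = B (σ z.2 z.1) := by rw [hB _ _ hz, hB _ _ hz.symm, hz]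
      simp [τ, hz, this, hσ _ _ hz, hσ _ _ hz.symm]
    · simp [τ, hz]
  refine Fintype.sum_equiv hτ.toPerm _ _ fun z => ?_
  simp only [Function.Involutive.coe_toPerm, τ, Prod.ext_iff]
  by_cases hz : B z.1 = B z.2
  · simp only [hz, if_true, hA _ _ hz, hB _ _ hz, hC _ _ hz.symm, hB _ _ hz.symm]
    have := hp _ _ hz
    by_cases h₁ : A z.1 = a <;> by_cases h₂ : B z.2 = b <;> by_cases h₃ : C z.1 = c <;>
      simp_all
  · by_cases h₁ : B z.1 = b <;> by_cases h₂ : B z.2 = b <;> simp_all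

end Laws

/-! ### Entropy inequalities -/

section Entropy

open scoped Classical

variable {Ω α β γ : Type*} [Fintype Ω] {p : Ω → ℝ}

/-- `E[log p(A)]`, the negative of the entropy of `A` in nats. -/
def logLaw (p : Ω → ℝ) (A : Ω → α) : ℝ := ∑ ω, p ω * Real.log (lawOf p A (A ω))

lemma entropy_eq [Fintype α] (p : Ω → ℝ) (A : Ω → α) :
    entropy p A = -logLaw p A / Real.log 2 := by
  unfold entropy logLaw
  rw [← sum_lawOf_mul p A fun a => Real.log (lawOf p A a), ← Finset.sum_neg_distrib]
  simp [Real.negMulLog]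

lemma condMutualInfo_eq [Fintype α] [Fintype β] [Fintype γ] (p : Ω → ℝ) (A : Ω → α) (B : Ω → β)
    (C : Ω → γ) :
    condMutualInfo p A B C = (logLaw p (fun ω => (A ω, B ω, C ω)) + logLaw p C
      - logLaw p (fun ω => (A ω, C ω)) - logLaw p (fun ω => (B ω, C ω))) / Real.log 2 := by
  simp only [condMutualInfo, condEntropy, entropy_eq]
  ring

/-- Entropy sees only the partition that a variable generates on the support. This is what allows
tuples to be reordered, regrouped and freed of redundant entries below. -/
lemma logLaw_congr {A : Ω → α} {B : Ω → β}
    (h : ∀ ω ω', p ω ≠ 0 → p ω' ≠ 0 → (A ω = A ω' ↔ B ω = B ω')) : logLaw p A = logLaw p B := by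
  refine Finset.sum_congr rfl fun ω _ => ?_
  by_cases hω : p ω = 0
  · simp [hω]
  · rw [lawOf_congr fun ω' hω' => h ω' ω hω' hω]

lemma logLaw_lawOf {δ : Type*} [Fintype δ] (Z : Ω → δ) (A : δ → α) :
    logLaw (lawOf p Z) A = logLaw p fun ω => A (Z ω) := by
  unfold logLaw
  rw [sum_lawOf_mul p Z fun z => Real.log (lawOf (lawOf p Z) A (A z)), lawOf_lawOf]

lemma logLaw_nonpos (hp : p ∈ stdSimplex ℝ Ω) (A : Ω → α) : logLaw p A ≤ 0 :=
  Finset.sum_nonpos fun ω _ => mul_nonpos_of_nonneg_of_nonpos (hp.1 ω)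
    (Real.log_nonpos (lawOf_nonneg hp.1 _ _) (lawOf_le_one hp _ _))

/-- Gibbs' inequality. -/
lemma sum_mul_log_le_logLaw [Fintype α] (hp : p ∈ stdSimplex ℝ Ω) (A : Ω → α) (g : α → ℝ)
    (hg : ∀ a, 0 ≤ g a) (hg1 : ∑ a, g a ≤ 1) (hpos : ∀ ω, p ω ≠ 0 → 0 < g (A ω)) :
    ∑ ω, p ω * Real.log (g (A ω)) ≤ logLaw p A := by
  have key : ∀ ω, p ω * Real.log (g (A ω)) - p ω * Real.log (lawOf p A (A ω)) ≤
      p ω * (g (A ω) / lawOf p A (A ω)) - p ω := by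
    intro ω
    by_cases hω : p ω = 0
    · simp [hω]
    have h1 := hpos ω hω
    have h2 := lawOf_pos hp.1 A hω
    rw [← mul_sub, ← Real.log_div h1.ne' h2.ne']
    nlinarith [Real.log_le_sub_one_of_pos (div_pos h1 h2), hp.1 ω]
  have h := Finset.sum_le_sum fun ω (_ : ω ∈ Finset.univ) => key ω
  simp only [Finset.sum_sub_distrib] at h
  rw [hp.2, ← sum_lawOf_mul p A fun a => g a / lawOf p A a] at h
  have h3 : ∑ a, lawOf p A a * (g a / lawOf p A a) ≤ ∑ a, g a := by
    refine Finset.sum_le_sum fun a _ => ?_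
    by_cases ha : lawOf p A a = 0
    · simp [ha, hg a]
    · rw [mul_div_cancel₀ _ ha]
  unfold logLaw
  linarith

/-- Submodularity of entropy: `H(A,B) + H(B,C) ≥ H(A,B,C) + H(B)`. -/
lemma logLaw_submodular [Fintype α] [Fintype β] [Fintype γ] (hp : p ∈ stdSimplex ℝ Ω)
    (A : Ω → α) (B : Ω → β) (C : Ω → γ) :
    logLaw p (fun ω => (A ω, B ω)) + logLaw p (fun ω => (B ω, C ω)) ≤
      logLaw p (fun ω => (A ω, B ω, C ω)) + logLaw p B := by
  -- Gibbs' inequality is applied to the law `p(a,b) p(b,c) / p(b)`, which has the same pair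
  -- marginals but makes `A - B - C` a Markov chain.
  let g : α × β × γ → ℝ := fun z => lawOf p (fun ω => (A ω, B ω)) (z.1, z.2.1) *
    lawOf p (fun ω => (B ω, C ω)) (z.2.1, z.2.2) / lawOf p B z.2.1
  have hg : ∀ z, 0 ≤ g z := fun z => div_nonneg (mul_nonneg (lawOf_nonneg hp.1 _ _)
    (lawOf_nonneg hp.1 _ _)) (lawOf_nonneg hp.1 _ _)
  have hg1 : ∑ z, g z ≤ 1 := by
    rw [← hp.2, ← sum_lawOf p B, Fintype.sum_prod_type, Finset.sum_comm,
      Fintype.sum_prod_type]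
    refine Finset.sum_le_sum fun b _ => le_of_eq ?_
    simp only [g, mul_div_assoc, ← Finset.sum_mul, sum_lawOf_fst]
    rw [← Finset.mul_sum, ← Finset.sum_div, sum_lawOf_snd]
    by_cases hb : lawOf p B b = 0
    · simp [hb]
    · rw [div_self hb, mul_one]
  have hpos : ∀ ω, p ω ≠ 0 → 0 < g (A ω, B ω, C ω) := fun ω hω =>
    div_pos (mul_pos (lawOf_pos hp.1 (fun ω => (A ω, B ω)) hω)
      (lawOf_pos hp.1 (fun ω => (B ω, C ω)) hω)) (lawOf_pos hp.1 B hω)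
  have h := sum_mul_log_le_logLaw hp (fun ω => (A ω, B ω, C ω)) g hg hg1 hpos
  have e : ∑ ω, p ω * Real.log (g (A ω, B ω, C ω)) = logLaw p (fun ω => (A ω, B ω)) +
      logLaw p (fun ω => (B ω, C ω)) - logLaw p B := by
    simp only [logLaw, ← Finset.sum_add_distrib, ← Finset.sum_sub_distrib]
    refine Finset.sum_congr rfl fun ω _ => ?_
    by_cases hω : p ω = 0
    · simp [hω]
    have h1 := (lawOf_pos hp.1 (fun ω => (A ω, B ω)) hω).ne'
    have h2 := (lawOf_pos hp.1 (fun ω => (B ω, C ω)) hω).ne'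
    have h3 := (lawOf_pos hp.1 B hω).ne'
    simp only [g]
    rw [Real.log_div (mul_ne_zero h1 h2) h3, Real.log_mul h1 h2]
    ring
  linarith

/-- The equality case of submodularity; it already holds term by term for the logarithms. -/
lemma MarkovChain.logLaw_eq (hp : p ∈ stdSimplex ℝ Ω) {A : Ω → α} {B : Ω → β} {C : Ω → γ}
    (h : MarkovChain p A B C) :
    logLaw p (fun ω => (A ω, B ω)) + logLaw p (fun ω => (B ω, C ω)) =
      logLaw p (fun ω => (A ω, B ω, C ω)) + logLaw p B := by
  simp only [logLaw, ← Finset.sum_add_distrib, ← mul_add]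
  refine Finset.sum_congr rfl fun ω _ => ?_
  by_cases hω : p ω = 0
  · simp [hω]
  have h1 := (lawOf_pos hp.1 (fun ω => (A ω, B ω)) hω).ne'
  have h2 := (lawOf_pos hp.1 (fun ω => (B ω, C ω)) hω).ne'
  have h3 := (lawOf_pos hp.1 B hω).ne'
  have h4 := (lawOf_pos hp.1 (fun ω => (A ω, B ω, C ω)) hω).ne'
  rw [← Real.log_mul h1 h2, ← Real.log_mul h4 h3, h]

/-- `H(A) ≥ 0` and `H(A) ≤ H(A, B)`. -/
lemma logLaw_pair_le (hp : p ∈ stdSimplex ℝ Ω) (A : Ω → α) (B : Ω → β) :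
    logLaw p (fun ω => (A ω, B ω)) ≤ logLaw p A := by
  refine Finset.sum_le_sum fun ω _ => ?_
  by_cases hω : p ω = 0
  · simp [hω]
  refine mul_le_mul_of_nonneg_left (Real.log_le_log (lawOf_pos hp.1 (fun ω => (A ω, B ω)) hω) ?_)
    (hp.1 ω)
  refine Finset.sum_le_sum fun ω' _ => ?_
  by_cases h : A ω' = A ω <;> simp [h]
  · split_ifs <;> simp [hp.1 ω']

lemma neg_log_card_le_logLaw [Fintype α] [Nonempty α] (hp : p ∈ stdSimplex ℝ Ω) (A : Ω → α) :
    -Real.log (Fintype.card α) ≤ logLaw p A := by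
  have h := sum_mul_log_le_logLaw hp A (fun _ => (Fintype.card α : ℝ)⁻¹) (fun _ => by positivity)
    (by simp) (fun _ _ => by positivity)
  rwa [← Finset.sum_mul, hp.2, one_mul, Real.log_inv] at h

end Entropy

/-! ### Cardinality of the auxiliary alphabets -/

/-- A nonnegative combination of vectors in `J → ℝ` can be supported on `|J|` of them. -/
lemma exists_weights_card_support_le {ι J : Type*} [Fintype ι] [Fintype J] (v : ι → J → ℝ) :
    ∃ w : ι → ℝ, (∀ i, 0 ≤ w i) ∧ (∀ j, ∑ i, w i * v i j = ∑ i, v i j) ∧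
      ∃ S : Finset ι, S.card ≤ Fintype.card J ∧ ∀ i, w i ≠ 0 → i ∈ S := by
  classical
  -- Conic Carathéodory by minimality: among the admissible weights, those with the fewest nonzero
  -- entries are chosen. If more than `|J|` entries are nonzero, the corresponding vectors are
  -- linearly dependent.
  let good : ℕ → Prop := fun n => ∃ w : ι → ℝ, (∀ i, 0 ≤ w i) ∧
    (∀ j, ∑ i, w i * v i j = ∑ i, v i j) ∧ (Finset.univ.filter fun i => w i ≠ 0).card = n
  have hex : ∃ n, good n := ⟨_, fun _ => 1, by simp, by simp, rfl⟩
  obtain ⟨w, hw, hv, hn⟩ := Nat.find_spec hex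
  refine ⟨w, hw, hv, Finset.univ.filter fun i => w i ≠ 0, ?_, by simp⟩
  by_contra! hlt
  set s := Finset.univ.filter fun i => w i ≠ 0 with hs
  have hdep : ¬ LinearIndependent ℝ fun i : s => v i := by
    intro hli
    have := hli.fintype_card_le_finrank
    simp at this
    omega
  obtain ⟨g, hg, i₀, hi₀⟩ := Fintype.not_linearIndependent_iff.1 hdep
  -- The sign of the dependence is chosen so that some coefficient is positive; otherwise
  -- subtracting a multiple of it would never make a weight vanish.
  have hpos : ∃ c : ι → ℝ, (∀ i, w i = 0 → c i = 0) ∧ (∀ j, ∑ i, c i * v i j = 0) ∧ ∃ i, 0 < c i := by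
    have hext : ∀ g' : s → ℝ, ∑ i, g' i • v i = 0 → (∃ i, 0 < g' i) →
        ∃ c : ι → ℝ, (∀ i, w i = 0 → c i = 0) ∧ (∀ j, ∑ i, c i * v i j = 0) ∧ ∃ i, 0 < c i := by
      intro g' hg' ⟨i, hi⟩
      refine ⟨fun i => if h : i ∈ s then g' ⟨i, h⟩ else 0, fun i hi => ?_, fun j => ?_, i, ?_⟩
      · have : i ∉ s := by simp [hs, hi]
        simp [this]
      · have h1 := congrFun hg' j
        simp only [Finset.sum_apply, Pi.smul_apply, smul_eq_mul, Pi.zero_apply] at h1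
        refine Eq.trans ?_ h1
        rw [← Finset.sum_subset (Finset.subset_univ s) (fun i _ hi => by simp [hi]),
          ← Finset.sum_coe_sort s]
        exact Finset.sum_congr rfl fun i _ => by simp
      · simpa using hi
    rcases lt_or_gt_of_ne hi₀ with h | h
    · exact hext (fun i => -g i) (by simpa using hg) ⟨i₀, by simpa using h⟩
    · exact hext g hg ⟨i₀, h⟩
  obtain ⟨c, hc0, hcv, i₁, hi₁⟩ := hpos
  -- The index of least ratio reaches zero before any other weight becomes negative.
  obtain ⟨m, hm, hmin⟩ := Finset.exists_min_image (Finset.univ.filter fun i => 0 < c i)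
    (fun i => w i / c i) ⟨i₁, by simpa using hi₁⟩
  simp only [Finset.mem_filter, Finset.mem_univ, true_and] at hm hmin
  have hw' : ∀ i, 0 ≤ w i - w m / c m * c i := by
    intro i
    rcases lt_or_ge 0 (c i) with h | h
    · have := hmin i h
      rw [le_div_iff₀ h] at this
      linarith
    · have := mul_nonneg_of_nonpos_of_nonpos (neg_nonpos.2 (div_nonneg (hw m) hm.le)) h
      linarith [hw i]
  refine Nat.find_min hex (m := (Finset.univ.filter fun i => w i - w m / c m * c i ≠ 0).card) ?_
    ⟨_, hw', fun j => ?_, rfl⟩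
  · rw [← hn]
    refine Finset.card_lt_card ⟨fun i => ?_, fun h => ?_⟩
    · simp only [Finset.mem_filter, Finset.mem_univ, true_and, hs]
      exact fun h h' => h (by simp [h', hc0 i h'])
    · have hms : m ∈ s := by
        simp only [hs, Finset.mem_filter, Finset.mem_univ, true_and]
        exact fun h => hm.ne' (hc0 m h)
      have := h hms
      simp [hm.ne'] at this
  · simp only [sub_mul, Finset.sum_sub_distrib, mul_assoc, ← Finset.mul_sum, hcv, hv]
    simp

section Aux

variable {Ω X₁ X₂ Y₁ Y₂ : Type*} [Fintype Ω] {r : ℕ} {α : Fin r → Type*}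

/-- Random variables on a finite probability space that satisfy the Markov chains of `T(r)`. -/
structure IsAux (P : Ω → ℝ) (F : ∀ i, Ω → α i) (A₁ : Ω → X₁) (A₂ : Ω → X₂) (B₁ : Ω → Y₁)
    (B₂ : Ω → Y₂) : Prop where
  pmf : P ∈ stdSimplex ℝ Ω
  markov_odd : ∀ i : Fin r, Odd (i.val + 1) →
    MarkovChain P (F i) (fun ω => (fun j : Set.Iio i => F j ω, A₁ ω)) A₂
  markov_even : ∀ i : Fin r, Even (i.val + 1) →
    MarkovChain P (F i) (fun ω => (fun j : Set.Iio i => F j ω, A₂ ω)) A₁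
  markov_Y₁ : MarkovChain P B₁ (fun ω => (fun i => F i ω, A₁ ω)) (fun ω => (A₂ ω, B₂ ω))
  markov_Y₂ : MarkovChain P B₂ (fun ω => (fun i => F i ω, A₂ ω)) (fun ω => (A₁ ω, B₁ ω))

/-- Conditional mutual information `I(A ; B | C)` in nats. -/
def natsInfo {α β γ : Type*} (P : Ω → ℝ) (A : Ω → α) (B : Ω → β) (C : Ω → γ) : ℝ :=
  logLaw P (fun ω => (A ω, B ω, C ω)) + logLaw P C
      - logLaw P (fun ω => (A ω, C ω)) - logLaw P (fun ω => (B ω, C ω))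

lemma condMutualInfo_eq_natsInfo {α β γ : Type*} [Fintype α] [Fintype β] [Fintype γ]
    (P : Ω → ℝ) (A : Ω → α) (B : Ω → β) (C : Ω → γ) :
    condMutualInfo P A B C = natsInfo P A B C / Real.log 2 :=
  condMutualInfo_eq P A B C

/-- A weight that is a function of `B` only changes the law of `B` and leaves the conditional laws
given `B` alone. It serves the rounds after `i₀` and the outputs, where the reweighted variable is
part of the conditioning. -/
lemma MarkovChain.reweight_mid {α β γ : Type*} {P : Ω → ℝ} {A : Ω → α} {B : Ω → β} {C : Ω → γ}
    (h : MarkovChain P A B C) (w : Ω → ℝ) (μ : β → ℝ) (hw : ∀ ω, w ω = μ (B ω)) :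
    MarkovChain (fun ω => w ω * P ω) A B C := by
  intro a b c
  rw [lawOf_reweight P (fun ω => (A ω, B ω, C ω)) w (fun z => μ z.2.1) hw,
    lawOf_reweight P B w μ hw, lawOf_reweight P (fun ω => (A ω, B ω)) w (fun z => μ z.2) hw,
    lawOf_reweight P (fun ω => (B ω, C ω)) w (fun z => μ z.1) hw]
  linear_combination μ b * μ b * h a b c

/-- It serves round `i₀` itself: the weight factors out of `p(a,b,c)` and `p(a,b)` alike, and the
other two laws in the identity are unchanged by assumption. -/
lemma MarkovChain.reweight_left {α β γ : Type*} {P : Ω → ℝ} {A : Ω → α} {B : Ω → β} {C : Ω → γ}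
    (h : MarkovChain P A B C) (w : Ω → ℝ) (μ : α → ℝ) (hw : ∀ ω, w ω = μ (A ω))
    (hlaw : lawOf (fun ω => w ω * P ω) (fun ω => (B ω, C ω)) = lawOf P (fun ω => (B ω, C ω)))
    (hlaw' : lawOf (fun ω => w ω * P ω) B = lawOf P B) :
    MarkovChain (fun ω => w ω * P ω) A B C := by
  intro a b c
  rw [lawOf_reweight P (fun ω => (A ω, B ω, C ω)) w (fun z => μ z.1) hw,
    lawOf_reweight P (fun ω => (A ω, B ω)) w (fun z => μ z.1) hw, hlaw, hlaw']
  linear_combination μ a * h a b c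

lemma MarkovChain.of_law_eq {α β γ δ : Type*} [Fintype δ] {P P' : Ω → ℝ} (Z : Ω → δ)
    (hZ : lawOf P' Z = lawOf P Z) {A : δ → α} {B : δ → β} {C : δ → γ}
    (h : MarkovChain P (fun ω => A (Z ω)) (fun ω => B (Z ω)) (fun ω => C (Z ω))) :
    MarkovChain P' (fun ω => A (Z ω)) (fun ω => B (Z ω)) (fun ω => C (Z ω)) := by
  rw [← markovChain_lawOf] at h ⊢
  rwa [hZ]

lemma lawOf_comp_eq {β δ : Type*} [Fintype δ] {P P' : Ω → ℝ} (Z : Ω → δ)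
    (hZ : lawOf P' Z = lawOf P Z) (B : δ → β) :
    lawOf P' (fun ω => B (Z ω)) = lawOf P (fun ω => B (Z ω)) := by
  rw [← lawOf_lawOf P' Z, ← lawOf_lawOf P Z, hZ]

lemma logLaw_comp_eq {β δ : Type*} [Fintype δ] {P P' : Ω → ℝ} (Z : Ω → δ)
    (hZ : lawOf P' Z = lawOf P Z) (B : δ → β) :
    logLaw P' (fun ω => B (Z ω)) = logLaw P (fun ω => B (Z ω)) := by
  rw [← logLaw_lawOf (p := P') Z, ← logLaw_lawOf (p := P) Z, hZ]

open scoped Classical in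
lemma sum_reweight_eq {β : Type*} [Fintype β] (P : Ω → ℝ) (B : Ω → β) (w : β → ℝ) (d : Ω → ℝ) :
    ∑ ω, w (B ω) * P ω * d ω = ∑ b, w b * ∑ ω, if B ω = b then P ω * d ω else 0 := by
  simp only [Finset.mul_sum]
  rw [Finset.sum_comm]
  exact Finset.sum_congr rfl fun ω _ => by simp [mul_assoc]

/-- The difference of conditional log-likelihoods is unaffected by a reweighting that both laws
see. -/
lemma logLaw_sub_reweight {β γ : Type*} {P : Ω → ℝ} (hP : ∀ ω, 0 ≤ P ω) (A : Ω → β) (B : Ω → γ)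
    (w : Ω → ℝ) (μ : β → ℝ) (ν : γ → ℝ) (hμ : ∀ ω, w ω = μ (A ω)) (hν : ∀ ω, w ω = ν (B ω)) :
    logLaw (fun ω => w ω * P ω) A - logLaw (fun ω => w ω * P ω) B =
      ∑ ω, w ω * P ω * (Real.log (lawOf P A (A ω)) - Real.log (lawOf P B (B ω))) := by
  simp only [logLaw, ← Finset.sum_sub_distrib]
  refine Finset.sum_congr rfl fun ω _ => ?_
  rw [lawOf_reweight P A w μ hμ, lawOf_reweight P B w ν hν, ← hμ, ← hν]
  by_cases hw : w ω = 0
  · simp [hw]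
  by_cases hω : P ω = 0
  · simp [hω]
  rw [Real.log_mul hw (lawOf_pos hP A hω).ne', Real.log_mul hw (lawOf_pos hP B hω).ne']
  ring

variable [Fintype X₁] [Fintype X₂] [Fintype Y₁] [Fintype Y₂]

/-- The auxiliary variable `F i₀` can be reweighted to have a small support without affecting the
Markov chains, the law of the other variables up to `i₀`, and the two mutual informations. -/
lemma IsAux.exists_reweight [∀ i, Fintype (α i)] {P : Ω → ℝ} {F : ∀ i, Ω → α i} {A₁ : Ω → X₁}
    {A₂ : Ω → X₂} {B₁ : Ω → Y₁} {B₂ : Ω → Y₂} (h : IsAux P F A₁ A₂ B₁ B₂) (i₀ : Fin r)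
    (S : ∀ i, Finset (α i)) (hS : ∀ ω, P ω ≠ 0 → ∀ j < i₀, F j ω ∈ S j) :
    ∃ (P' : Ω → ℝ) (T : Finset (α i₀)), IsAux P' F A₁ A₂ B₁ B₂ ∧
      (∀ ω, P' ω ≠ 0 → P ω ≠ 0 ∧ F i₀ ω ∈ T) ∧
      T.card ≤ Fintype.card X₁ * Fintype.card X₂ * Fintype.card Y₁ * Fintype.card Y₂ *
        (∏ j ∈ Finset.Iio i₀, (S j).card) + 2 ∧
      lawOf P' (fun ω => (A₁ ω, A₂ ω, B₁ ω, B₂ ω)) = lawOf P (fun ω => (A₁ ω, A₂ ω, B₁ ω, B₂ ω)) ∧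
      natsInfo P' A₁ (fun ω i => F i ω) A₂ = natsInfo P A₁ (fun ω i => F i ω) A₂ ∧
      natsInfo P' A₂ (fun ω i => F i ω) A₁ = natsInfo P A₂ (fun ω i => F i ω) A₁ := by
  classical
  let Past := ∀ j : Set.Iio i₀, α j
  let Z : Ω → Past × X₁ × X₂ × Y₁ × Y₂ := fun ω => (fun j => F j ω, A₁ ω, A₂ ω, B₁ ω, B₂ ω)
  -- The linear constraints to be kept: the mass of each value of the past (within `S`), the sources
  -- and the outputs, and two further numbers for the two mutual informations. Total mass needs no
  -- constraint of its own.
  let J := ((∀ j : Set.Iio i₀, S j) × X₁ × X₂ × Y₁ × Y₂) ⊕ Fin 2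
  -- `d₁` is `log p(x₁ | f, x₂)`. Since the weight is a function of `f`, this conditional
  -- probability survives the reweighting wherever the weight is nonzero, so that `H(X₁ | F, X₂)`
  -- becomes linear in the weights; `H(X₁ | X₂)` is fixed by the law of `Z`.
  let d₁ : Ω → ℝ := fun ω =>
    Real.log (lawOf P (fun ω => (A₁ ω, (fun i => F i ω), A₂ ω)) (A₁ ω, (fun i => F i ω), A₂ ω)) -
    Real.log (lawOf P (fun ω => ((fun i => F i ω), A₂ ω)) ((fun i => F i ω), A₂ ω))
  let d₂ : Ω → ℝ := fun ω =>
    Real.log (lawOf P (fun ω => (A₂ ω, (fun i => F i ω), A₁ ω)) (A₂ ω, (fun i => F i ω), A₁ ω)) -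
    Real.log (lawOf P (fun ω => ((fun i => F i ω), A₁ ω)) ((fun i => F i ω), A₁ ω))
  let v : α i₀ → J → ℝ := fun f => Sum.elim
    (fun z => ∑ ω, if F i₀ ω = f then
      P ω * (if Z ω = (fun j : Set.Iio i₀ => (z.1 j : α j), z.2) then 1 else 0) else 0)
    (fun b => ∑ ω, if F i₀ ω = f then P ω * (if b = 0 then d₁ ω else d₂ ω) else 0)
  obtain ⟨w, hw0, hwv, T, hT, hTw⟩ := exists_weights_card_support_le v
  let P' : Ω → ℝ := fun ω => w (F i₀ ω) * P ω
  -- The constraints only cover pasts with values in `S`; other pasts have mass zero under both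
  -- laws.
  have hZ : lawOf P' Z = lawOf P Z := by
    funext z
    by_cases hz : ∀ j : Set.Iio i₀, z.1 j ∈ S j
    · have h1 := hwv (Sum.inl (fun j => ⟨z.1 j, hz j⟩, z.2))
      simp only [v, Sum.elim_inl] at h1
      rw [← sum_reweight_eq P (F i₀) w] at h1
      have h2 := sum_reweight_eq P (F i₀) (fun _ => 1) fun ω => if Z ω = z then (1 : ℝ) else 0
      simp only [one_mul] at h2
      rw [← h2] at h1
      simp only [mul_ite, mul_one, mul_zero] at h1
      simp only [lawOf, P']
      convert h1
    · push Not at hz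
      obtain ⟨j, hj⟩ := hz
      have key : ∀ ω, Z ω = z → P ω = 0 := by
        intro ω e
        by_contra hne
        exact hj (by rw [← e]; exact hS ω hne j j.2)
      have e₁ : lawOf P Z z = 0 := by
        by_contra hne
        obtain ⟨ω, hω, e⟩ := exists_of_lawOf_ne_zero hne
        exact hω (key ω e)
      have e₂ : lawOf P' Z z = 0 := by
        by_contra hne
        obtain ⟨ω, hω, e⟩ := exists_of_lawOf_ne_zero hne
        exact hω (by simp [P', key ω e])
      rw [e₁, e₂]
  have hd : ∀ b : Fin 2, ∑ ω, P' ω * (if b = 0 then d₁ ω else d₂ ω) =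
      ∑ ω, P ω * (if b = 0 then d₁ ω else d₂ ω) := by
    intro b
    have h1 := hwv (Sum.inr b)
    simp only [v, Sum.elim_inr] at h1
    rw [← sum_reweight_eq P (F i₀) w] at h1
    have h2 := sum_reweight_eq P (F i₀) (fun _ => 1) fun ω => if b = 0 then d₁ ω else d₂ ω
    simp only [one_mul] at h2
    rw [← h2] at h1
    exact h1
  have hP'0 : ∀ ω, 0 ≤ P' ω := fun ω => mul_nonneg (hw0 _) (h.pmf.1 ω)
  refine ⟨P', T, ⟨⟨hP'0, ?_⟩, fun i hi => ?_, fun i hi => ?_, ?_, ?_⟩, fun ω hω => ⟨?_, ?_⟩, ?_, ?_, ?_, ?_⟩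
  · rw [← sum_lawOf P' Z, hZ, sum_lawOf, h.pmf.2]
  -- Rounds before `i₀` only involve the law of `Z`; in round `i₀` the weight is a function of the
  -- left variable; in later rounds it is a function of the conditioning variable.
  · rcases lt_trichotomy i i₀ with hlt | rfl | hlt
    · exact MarkovChain.of_law_eq Z hZ (A := fun z => z.1 ⟨i, hlt⟩)
        (B := fun z => (fun j : Set.Iio i => z.1 ⟨j, lt_trans j.2 hlt⟩, z.2.1))
        (C := fun z => z.2.2.1) (h.markov_odd i hi)
    · exact (h.markov_odd i hi).reweight_left _ w (fun _ => rfl)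
        (lawOf_comp_eq Z hZ fun z => ((z.1, z.2.1), z.2.2.1))
        (lawOf_comp_eq Z hZ fun z => (z.1, z.2.1))
    · exact (h.markov_odd i hi).reweight_mid _ (fun b => w (b.1 ⟨i₀, hlt⟩)) fun _ => rfl
  · rcases lt_trichotomy i i₀ with hlt | rfl | hlt
    · exact MarkovChain.of_law_eq Z hZ (A := fun z => z.1 ⟨i, hlt⟩)
        (B := fun z => (fun j : Set.Iio i => z.1 ⟨j, lt_trans j.2 hlt⟩, z.2.2.1))
        (C := fun z => z.2.1) (h.markov_even i hi)
    · exact (h.markov_even i hi).reweight_left _ w (fun _ => rfl)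
        (lawOf_comp_eq Z hZ fun z => ((z.1, z.2.2.1), z.2.1))
        (lawOf_comp_eq Z hZ fun z => (z.1, z.2.2.1))
    · exact (h.markov_even i hi).reweight_mid _ (fun b => w (b.1 ⟨i₀, hlt⟩)) fun _ => rfl
  · exact h.markov_Y₁.reweight_mid _ (fun b => w (b.1 i₀)) fun _ => rfl
  · exact h.markov_Y₂.reweight_mid _ (fun b => w (b.1 i₀)) fun _ => rfl
  · exact fun h0 => hω (by simp [P', h0])
  · exact hTw _ fun h0 => hω (by simp [P', h0])
  · refine hT.trans (le_of_eq ?_)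
    have e : ∏ j : Set.Iio i₀, (S j).card = ∏ j ∈ Finset.Iio i₀, (S j).card :=
      (Finset.prod_subtype (Finset.Iio i₀) (p := fun j => j ∈ Set.Iio i₀) (by simp)
        fun j => (S j).card).symm
    simp only [J, Fintype.card_sum, Fintype.card_prod, Fintype.card_pi, Fintype.card_coe,
      Fintype.card_fin, e]
    ring
  · exact lawOf_comp_eq Z hZ fun z => z.2
  · have h1 := logLaw_sub_reweight h.pmf.1 (fun ω => (A₁ ω, (fun i => F i ω), A₂ ω))
      (fun ω => ((fun i => F i ω), A₂ ω)) (fun ω => w (F i₀ ω)) (fun z => w (z.2.1 i₀))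
      (fun z => w (z.1 i₀)) (fun _ => rfl) (fun _ => rfl)
    have h2 := hd 0
    have h3 : ∑ ω, P ω * d₁ ω = logLaw P (fun ω => (A₁ ω, (fun i => F i ω), A₂ ω)) -
      logLaw P (fun ω => ((fun i => F i ω), A₂ ω)) := by
      simp only [logLaw, ← Finset.sum_sub_distrib, ← mul_sub, d₁]
    have h4 := logLaw_comp_eq Z hZ fun z => z.2.2.1
    have h5 := logLaw_comp_eq Z hZ fun z => (z.2.1, z.2.2.1)
    simp only [if_true] at h2
    simp only [natsInfo]
    change logLaw P' _ - logLaw P' _ = ∑ ω, P' ω * d₁ ω at h1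
    rw [h2, h3] at h1
    dsimp only [Z] at h4 h5
    linarith
  · have h1 := logLaw_sub_reweight h.pmf.1 (fun ω => (A₂ ω, (fun i => F i ω), A₁ ω))
      (fun ω => ((fun i => F i ω), A₁ ω)) (fun ω => w (F i₀ ω)) (fun z => w (z.2.1 i₀))
      (fun z => w (z.1 i₀)) (fun _ => rfl) (fun _ => rfl)
    have h2 := hd 1
    have h3 : ∑ ω, P ω * d₂ ω = logLaw P (fun ω => (A₂ ω, (fun i => F i ω), A₁ ω)) -
      logLaw P (fun ω => ((fun i => F i ω), A₁ ω)) := by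
      simp only [logLaw, ← Finset.sum_sub_distrib, ← mul_sub, d₂]
    have h4 := logLaw_comp_eq Z hZ fun z => z.2.1
    have h5 := logLaw_comp_eq Z hZ fun z => (z.2.2.1, z.2.1)
    simp only [one_ne_zero, if_false] at h2
    simp only [natsInfo]
    change logLaw P' _ - logLaw P' _ = ∑ ω, P' ω * d₂ ω at h1
    rw [h2, h3] at h1
    dsimp only [Z] at h4 h5
    linarith

/-- The bounds on the alphabets of the auxiliary variables in `T(r)`, in a uniform shape. -/
def CardBound (N : ℕ) (k : Fin r → ℕ) : Prop :=
  ∀ i, k i ≤ N * (∏ j ∈ Finset.Iio i, k j) + 2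

/-- The rounds are treated in increasing order. A reweighting can only shrink the support, so
earlier reductions persist, and the bound for a round refers to the already reduced alphabets of the
rounds before it. -/
lemma IsAux.exists_small_support [∀ i, Fintype (α i)] {P : Ω → ℝ} {F : ∀ i, Ω → α i} {A₁ : Ω → X₁}
    {A₂ : Ω → X₂} {B₁ : Ω → Y₁} {B₂ : Ω → Y₂} (h : IsAux P F A₁ A₂ B₁ B₂) :
    ∃ (P' : Ω → ℝ) (S : ∀ i, Finset (α i)), IsAux P' F A₁ A₂ B₁ B₂ ∧
      (∀ ω, P' ω ≠ 0 → ∀ i, F i ω ∈ S i) ∧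
      CardBound (Fintype.card X₁ * Fintype.card X₂ * Fintype.card Y₁ * Fintype.card Y₂)
        (fun i => (S i).card) ∧
      lawOf P' (fun ω => (A₁ ω, A₂ ω, B₁ ω, B₂ ω)) = lawOf P (fun ω => (A₁ ω, A₂ ω, B₁ ω, B₂ ω)) ∧
      natsInfo P' A₁ (fun ω i => F i ω) A₂ = natsInfo P A₁ (fun ω i => F i ω) A₂ ∧
      natsInfo P' A₂ (fun ω i => F i ω) A₁ = natsInfo P A₂ (fun ω i => F i ω) A₁ := by
  classical
  suffices H : ∀ m : ℕ, m ≤ r → ∃ (P' : Ω → ℝ) (S : ∀ i, Finset (α i)), IsAux P' F A₁ A₂ B₁ B₂ ∧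
      (∀ ω, P' ω ≠ 0 → ∀ i : Fin r, i.val < m → F i ω ∈ S i) ∧
      (∀ i : Fin r, i.val < m → (S i).card ≤
        Fintype.card X₁ * Fintype.card X₂ * Fintype.card Y₁ * Fintype.card Y₂ *
        (∏ j ∈ Finset.Iio i, (S j).card) + 2) ∧
      lawOf P' (fun ω => (A₁ ω, A₂ ω, B₁ ω, B₂ ω)) = lawOf P (fun ω => (A₁ ω, A₂ ω, B₁ ω, B₂ ω)) ∧
      natsInfo P' A₁ (fun ω i => F i ω) A₂ = natsInfo P A₁ (fun ω i => F i ω) A₂ ∧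
      natsInfo P' A₂ (fun ω i => F i ω) A₁ = natsInfo P A₂ (fun ω i => F i ω) A₁ by
    obtain ⟨P', S, h1, h2, h3, h4⟩ := H r le_rfl
    exact ⟨P', S, h1, fun ω hω i => h2 ω hω i i.2, fun i => h3 i i.2, h4⟩
  intro m
  induction m with
  | zero => exact fun _ => ⟨P, fun _ => ∅, h, by simp, by simp, rfl, rfl, rfl⟩
  | succ m ih =>
    intro hm
    obtain ⟨P', S, h1, h2, h3, h4, h5, h6⟩ := ih (by omega)
    let i₀ : Fin r := ⟨m, hm⟩
    obtain ⟨P'', T, g1, g2, g3, g4, g5, g6⟩ := h1.exists_reweight i₀ S fun ω hω j hj => h2 ω hω j hj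
    have hprod : ∀ i : Fin r, i.val < m + 1 → ∏ j ∈ Finset.Iio i, (Function.update S i₀ T j).card =
        ∏ j ∈ Finset.Iio i, (S j).card := by
      intro i hi
      refine Finset.prod_congr rfl fun j hj => ?_
      have hj' : j ≠ i₀ := by
        rintro rfl
        have := Fin.lt_def.1 (Finset.mem_Iio.1 hj)
        simp only [i₀] at this
        omega
      rw [Function.update_of_ne hj']
    refine ⟨P'', Function.update S i₀ T, g1, fun ω hω i hi => ?_, fun i hi => ?_,
      g4.trans h4, g5.trans h5, g6.trans h6⟩
    · by_cases hi0 : i = i₀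
      · subst hi0
        simpa using (g2 ω hω).2
      · rw [Function.update_of_ne hi0]
        refine h2 ω (g2 ω hω).1 i ?_
        have : i.val ≠ m := fun e => hi0 (Fin.ext e)
        omega
    · rw [hprod i hi]
      by_cases hi0 : i = i₀
      · subst hi0
        simpa using g3
      · rw [Function.update_of_ne hi0]
        refine h3 i ?_
        have : i.val ≠ m := fun e => hi0 (Fin.ext e)
        omega

/-- Every family of auxiliary variables can be replaced by one with small alphabets. -/
lemma IsAux.exists_card_le [∀ i, Fintype (α i)] {P : Ω → ℝ} {F : ∀ i, Ω → α i} {A₁ : Ω → X₁}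
    {A₂ : Ω → X₂} {B₁ : Ω → Y₁} {B₂ : Ω → Y₂} (h : IsAux P F A₁ A₂ B₁ B₂) :
    ∃ (k : Fin r → ℕ) (p : AuxOutcome X₁ X₂ Y₁ Y₂ k → ℝ),
      CardBound (Fintype.card X₁ * Fintype.card X₂ * Fintype.card Y₁ * Fintype.card Y₂) k ∧
      IsAux p (fun i ω => rvF ω i) rvX₁ rvX₂ rvY₁ rvY₂ ∧
      lawOf p (fun ω => (rvX₁ ω, rvX₂ ω, rvY₁ ω, rvY₂ ω)) =
        lawOf P (fun ω => (A₁ ω, A₂ ω, B₁ ω, B₂ ω)) ∧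
      natsInfo p rvX₁ rvF rvX₂ = natsInfo P A₁ (fun ω i => F i ω) A₂ ∧
      natsInfo p rvX₂ rvF rvX₁ = natsInfo P A₂ (fun ω i => F i ω) A₁ := by
  classical
  obtain ⟨P', S, h1, h2, h3, h4, h5, h6⟩ := h.exists_small_support
  obtain ⟨ω₀, hω₀⟩ : ∃ ω, P' ω ≠ 0 := by
    by_contra! hall
    have := h1.pmf.2
    simp [hall] at this
  -- Only injectivity on the support matters. Values outside `S i` are sent to the label of an
  -- outcome `ω₀` of positive mass, which exists because the total mass is one.
  let e : ∀ i, α i → Fin (S i).card := fun i a =>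
    if ha : a ∈ S i then (S i).equivFin ⟨a, ha⟩ else (S i).equivFin ⟨F i ω₀, h2 ω₀ hω₀ i⟩
  have he : ∀ i ω ω', P' ω ≠ 0 → P' ω' ≠ 0 → (F i ω = F i ω' ↔ e i (F i ω) = e i (F i ω')) := by
    intro i ω ω' hω hω'
    simp [e, h2 ω hω i, h2 ω' hω' i]
  let Z : Ω → AuxOutcome X₁ X₂ Y₁ Y₂ (fun i => (S i).card) :=
    fun ω => (fun i => e i (F i ω), A₁ ω, A₂ ω, B₁ ω, B₂ ω)
  refine ⟨fun i => (S i).card, lawOf P' Z, h3, ⟨lawOf_mem_stdSimplex h1.pmf Z, fun i hi => ?_,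
    fun i hi => ?_, ?_, ?_⟩, ?_, ?_, ?_⟩
  · rw [markovChain_lawOf]
    exact (h1.markov_odd i hi).congr (he i)
      (fun ω ω' hω hω' => by simp [Z, rvF, rvX₁, funext_iff, ← he _ ω ω' hω hω'])
      (fun _ _ _ _ => Iff.rfl)
  · rw [markovChain_lawOf]
    exact (h1.markov_even i hi).congr (he i)
      (fun ω ω' hω hω' => by simp [Z, rvF, rvX₂, funext_iff, ← he _ ω ω' hω hω'])
      (fun _ _ _ _ => Iff.rfl)
  · rw [markovChain_lawOf]
    exact h1.markov_Y₁.congr (fun _ _ _ _ => Iff.rfl)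
      (fun ω ω' hω hω' => by simp [Z, rvF, rvX₁, funext_iff, ← he _ ω ω' hω hω'])
      (fun _ _ _ _ => Iff.rfl)
  · rw [markovChain_lawOf]
    exact h1.markov_Y₂.congr (fun _ _ _ _ => Iff.rfl)
      (fun ω ω' hω hω' => by simp [Z, rvF, rvX₂, funext_iff, ← he _ ω ω' hω hω'])
      (fun _ _ _ _ => Iff.rfl)
  · rw [lawOf_lawOf]
    exact h4
  · rw [← h5]
    simp only [natsInfo, logLaw_lawOf]
    congr 1
    · congr 2
      refine logLaw_congr fun ω ω' hω hω' => ?_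
      simp [Z, rvF, rvX₁, rvX₂, funext_iff, ← he _ ω ω' hω hω']
    · refine logLaw_congr fun ω ω' hω hω' => ?_
      simp [Z, rvF, rvX₂, funext_iff, ← he _ ω ω' hω hω']
  · rw [← h6]
    simp only [natsInfo, logLaw_lawOf]
    congr 1
    · congr 2
      refine logLaw_congr fun ω ω' hω hω' => ?_
      simp [Z, rvF, rvX₁, rvX₂, funext_iff, ← he _ ω ω' hω hω']
    · refine logLaw_congr fun ω ω' hω hω' => ?_
      simp [Z, rvF, rvX₁, funext_iff, ← he _ ω ω' hω hω']

end Aux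

/-! ### Compactness -/

/-- The bound on `k i` involves only earlier sizes, so induction on the round bounds every
coordinate. -/
lemma finite_setOf_cardBound (N r : ℕ) : {k : Fin r → ℕ | CardBound N k}.Finite := by
  have key : ∀ i : Fin r, ∃ B, ∀ k : Fin r → ℕ, CardBound N k → k i ≤ B := by
    intro i
    induction i using WellFoundedLT.induction with
    | ind i ih =>
      choose! B hB using ih
      refine ⟨N * (∏ j ∈ Finset.Iio i, B j) + 2, fun k hk => (hk i).trans ?_⟩
      gcongr with j hj
      exact hB j (Finset.mem_Iio.1 hj) k hk
  choose B hB using key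
  exact (Set.finite_Iic B).subset fun k hk i => hB i k hk

lemma continuous_lawOf {Ω α : Type*} [Fintype Ω] (A : Ω → α) (a : α) :
    Continuous fun p : Ω → ℝ => lawOf p A a := by
  refine continuous_finsetSum _ fun ω _ => ?_
  split_ifs <;> fun_prop

lemma continuous_entropy {Ω α : Type*} [Fintype Ω] [Fintype α] (A : Ω → α) :
    Continuous fun p : Ω → ℝ => entropy p A :=
  (continuous_finsetSum _ fun a _ =>
    Real.continuous_negMulLog.comp (continuous_lawOf A a)).div_const _

lemma continuous_condMutualInfo {Ω α β γ : Type*} [Fintype Ω] [Fintype α] [Fintype β] [Fintype γ]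
    (A : Ω → α) (B : Ω → β) (C : Ω → γ) :
    Continuous fun p : Ω → ℝ => condMutualInfo p A B C :=
  ((continuous_entropy _).sub (continuous_entropy _)).sub
    ((continuous_entropy _).sub (continuous_entropy _))

lemma isClosed_markovChain {Ω α β γ : Type*} [Fintype Ω] (A : Ω → α) (B : Ω → β) (C : Ω → γ) :
    IsClosed {p : Ω → ℝ | MarkovChain p A B C} := by
  simp only [MarkovChain, Set.ofPred_forall]
  exact isClosed_iInter fun a => isClosed_iInter fun b => isClosed_iInter fun c =>
    isClosed_eq ((continuous_lawOf _ _).mul (continuous_lawOf _ _))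
      ((continuous_lawOf _ _).mul (continuous_lawOf _ _))

lemma isClosed_isAux {Ω X₁ X₂ Y₁ Y₂ : Type*} [Fintype Ω] {r : ℕ} {α : Fin r → Type*}
    (F : ∀ i, Ω → α i) (A₁ : Ω → X₁) (A₂ : Ω → X₂) (B₁ : Ω → Y₁) (B₂ : Ω → Y₂) :
    IsClosed {P : Ω → ℝ | IsAux P F A₁ A₂ B₁ B₂} := by
  have e : {P : Ω → ℝ | IsAux P F A₁ A₂ B₁ B₂} = stdSimplex ℝ Ω ∩
      ((⋂ i : Fin r, ⋂ _ : Odd (i.val + 1),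
        {P | MarkovChain P (F i) (fun ω => (fun j : Set.Iio i => F j ω, A₁ ω)) A₂}) ∩
      ((⋂ i : Fin r, ⋂ _ : Even (i.val + 1),
        {P | MarkovChain P (F i) (fun ω => (fun j : Set.Iio i => F j ω, A₂ ω)) A₁}) ∩
      ({P | MarkovChain P B₁ (fun ω => (fun i => F i ω, A₁ ω)) (fun ω => (A₂ ω, B₂ ω))} ∩
      {P | MarkovChain P B₂ (fun ω => (fun i => F i ω, A₂ ω)) (fun ω => (A₁ ω, B₁ ω))}))) := by
    ext P
    simp only [Set.mem_inter_iff, Set.mem_iInter, Set.mem_ofPred_eq]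
    exact ⟨fun h => ⟨h.1, h.2, h.3, h.4, h.5⟩, fun h => ⟨h.1, h.2.1, h.2.2.1, h.2.2.2.1, h.2.2.2.2⟩⟩
  rw [e]
  exact (isCompact_stdSimplex ℝ Ω).isClosed.inter <|
    (isClosed_iInter fun i => isClosed_iInter fun _ => isClosed_markovChain _ _ _).inter <|
    (isClosed_iInter fun i => isClosed_iInter fun _ => isClosed_markovChain _ _ _).inter <|
    (isClosed_markovChain _ _ _).inter (isClosed_markovChain _ _ _)

/-- Limits of auxiliary distributions with bounded alphabets belong to `T(r)`. -/
lemma exists_memT_of_approx {X₁ X₂ Y₁ Y₂ : Type*} [Fintype X₁] [Fintype X₂] [Fintype Y₁]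
    [Fintype Y₂] {r : ℕ} (q : X₁ × X₂ → ℝ) (W : X₁ × X₂ → Y₁ × Y₂ → ℝ) (u v : ℕ → ℝ) {a b : ℝ}
    (hu : Tendsto u atTop (𝓝 a)) (hv : Tendsto v atTop (𝓝 b))
    (h : ∀ m : ℕ, ∃ (k : Fin r → ℕ) (p : AuxOutcome X₁ X₂ Y₁ Y₂ k → ℝ),
      CardBound (Fintype.card X₁ * Fintype.card X₂ * Fintype.card Y₁ * Fintype.card Y₂) k ∧
      IsAux p (fun i ω => rvF ω i) rvX₁ rvX₂ rvY₁ rvY₂ ∧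
      (∀ z, |lawOf p (fun ω => (rvX₁ ω, rvX₂ ω, rvY₁ ω, rvY₂ ω)) z - target q W z| ≤
        1 / ((m : ℝ) + 1)) ∧
      condMutualInfo p rvX₁ rvF rvX₂ ≤ u m ∧ condMutualInfo p rvX₂ rvF rvX₁ ≤ v m) :
    ∃ (k : Fin r → ℕ) (p : AuxOutcome X₁ X₂ Y₁ Y₂ k → ℝ), MemT q W p ∧
      condMutualInfo p rvX₁ rvF rvX₂ ≤ a ∧ condMutualInfo p rvX₂ rvF rvX₁ ≤ b := by
  choose k hk using h
  -- Pigeonhole: one of the finitely many size vectors occurs infinitely often, so that a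
  -- subsequence lives in a single simplex.
  obtain ⟨k₀, hk₀, hfreq⟩ : ∃ k₀, CardBound (Fintype.card X₁ * Fintype.card X₂ * Fintype.card Y₁ *
      Fintype.card Y₂) k₀ ∧ ∃ᶠ m in atTop, k m = k₀ := by
    by_contra! hcon
    have h1 : ∀ᶠ m in atTop, ∀ k₀ ∈ {k : Fin r → ℕ | CardBound (Fintype.card X₁ *
        Fintype.card X₂ * Fintype.card Y₁ * Fintype.card Y₂) k}, k m ≠ k₀ := by
      rw [Filter.eventually_all_finite (finite_setOf_cardBound _ r)]
      intro k₀ hk₀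
      simpa using hcon k₀ hk₀
    obtain ⟨m, hm⟩ := h1.exists
    obtain ⟨p, hp, -⟩ := hk m
    exact hm (k m) hp rfl
  obtain ⟨φ, hφ, hφk⟩ := extraction_of_frequently_atTop hfreq
  have hseq : ∀ m, ∃ p : AuxOutcome X₁ X₂ Y₁ Y₂ k₀ → ℝ,
      IsAux p (fun i ω => rvF ω i) rvX₁ rvX₂ rvY₁ rvY₂ ∧
      (∀ z, |lawOf p (fun ω => (rvX₁ ω, rvX₂ ω, rvY₁ ω, rvY₂ ω)) z - target q W z| ≤
        1 / ((φ m : ℝ) + 1)) ∧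
      condMutualInfo p rvX₁ rvF rvX₂ ≤ u (φ m) ∧ condMutualInfo p rvX₂ rvF rvX₁ ≤ v (φ m) := by
    intro m
    have := hk (φ m)
    rw [hφk m] at this
    obtain ⟨p, -, hp⟩ := this
    exact ⟨p, hp⟩
  choose p hp using hseq
  obtain ⟨p₀, -, ψ, hψ, hlim⟩ :=
    (isCompact_stdSimplex ℝ (AuxOutcome X₁ X₂ Y₁ Y₂ k₀)).tendsto_subseq fun m => (hp m).1.pmf
  have hφψ : Tendsto (fun m => φ (ψ m)) atTop atTop := hφ.tendsto_atTop.comp hψ.tendsto_atTop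
  have haux : IsAux p₀ (fun i ω => rvF ω i) rvX₁ rvX₂ rvY₁ rvY₂ :=
    (isClosed_isAux _ _ _ _ _).mem_of_tendsto hlim (Eventually.of_forall fun m => (hp (ψ m)).1)
  have hlaw : lawOf p₀ (fun ω => (rvX₁ ω, rvX₂ ω, rvY₁ ω, rvY₂ ω)) = target q W := by
    funext z
    have h1 : Tendsto (fun m => |lawOf (p (ψ m)) (fun ω => (rvX₁ ω, rvX₂ ω, rvY₁ ω, rvY₂ ω)) z -
        target q W z|) atTop
        (𝓝 |lawOf p₀ (fun ω => (rvX₁ ω, rvX₂ ω, rvY₁ ω, rvY₂ ω)) z - target q W z|) :=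
      ((((continuous_lawOf _ z).tendsto p₀).comp hlim).sub_const _).abs
    have h2 : Tendsto (fun m => 1 / ((φ (ψ m) : ℝ) + 1)) atTop (𝓝 0) :=
      tendsto_one_div_add_atTop_nhds_zero_nat.comp hφψ
    have h3 := le_of_tendsto_of_tendsto' h1 h2 fun m => (hp (ψ m)).2.1 z
    exact sub_eq_zero.1 (abs_nonpos_iff.1 h3)
  refine ⟨k₀, p₀, ⟨haux.pmf, hlaw, haux.markov_odd, haux.markov_even, haux.markov_Y₁,
    haux.markov_Y₂, fun i hi => ?_, fun i _ => hk₀ i⟩, ?_, ?_⟩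
  -- In the first round the product is empty, and the construction gives the additive constant 2,
  -- within the allowed 3.
  · have h1 := hk₀ i
    have h2 : Finset.Iio i = ∅ := by
      ext j
      simp only [Finset.mem_Iio, Fin.lt_def, Finset.notMem_empty, iff_false]
      omega
    rw [h2, Finset.prod_empty, mul_one] at h1
    omega
  · exact le_of_tendsto_of_tendsto' (((continuous_condMutualInfo _ _ _).tendsto p₀).comp hlim)
      (hu.comp hφψ) fun m => (hp (ψ m)).2.2.1
  · exact le_of_tendsto_of_tendsto' (((continuous_condMutualInfo _ _ _).tendsto p₀).comp hlim)
      (hv.comp hφψ) fun m => (hp (ψ m)).2.2.2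

/-! ### Sequentially generated families -/

section Sequential

open scoped Classical

/-- Summing out the last coordinates of a sequentially generated family. -/
lemma sum_prod_agree {r : ℕ} {G : Fin r → Type*} [∀ i, Fintype (G i)]
    (g : ∀ i, ((j : Set.Iio i) → G j) → G i → ℝ) (hg : ∀ i h, ∑ v, g i h v = 1)
    (m : ℕ) (hm : m ≤ r) (c : ∀ i, G i) :
    (∑ c' : ∀ i, G i, if ∀ i : Fin r, i.val < m → c' i = c i then ∏ i, g i (fun j => c' j) (c' i)
      else 0) = ∏ i : Fin r with i.val < m, g i (fun j => c j) (c i) := by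
  obtain ⟨d, rfl⟩ := Nat.exists_eq_add_of_le hm
  clear hm
  revert g hg c
  -- Induction on the number `d` of coordinates to be summed out. The length `s = m + d` is kept
  -- abstract so that `m` can grow while the family stays the same.
  suffices H : ∀ (s d m : ℕ) (hs : s = m + d) (G : Fin s → Type _) [∀ i, Fintype (G i)]
      (g : ∀ i, ((j : Set.Iio i) → G j) → G i → ℝ) (_ : ∀ i h, ∑ v, g i h v = 1) (c : ∀ i, G i),
      (∑ c' : ∀ i, G i, if ∀ i : Fin s, i.val < m → c' i = c i then ∏ i, g i (fun j => c' j) (c' i)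
        else 0) = ∏ i : Fin s with i.val < m, g i (fun j => c j) (c i) from
    fun g hg c => H _ d m rfl G g hg c
  intro s d
  induction d with
  | zero =>
    intro m hs G _ g hg c
    have h1 : ∀ c' : ∀ i, G i, (∀ i : Fin s, i.val < m → c' i = c i) ↔ c' = c :=
      fun c' => ⟨fun h => funext fun i => h i (by omega), fun h => by simp [h]⟩
    have h2 : (Finset.univ.filter fun i : Fin s => i.val < m) = Finset.univ :=
      Finset.filter_true_of_mem fun i _ => by omega
    rw [h2]
    simp only [h1, Finset.sum_ite_eq', Finset.mem_univ, if_true]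
  | succ d ih =>
    intro m hs G _ g hg c
    let i₀ : Fin s := ⟨m, by omega⟩
    have hsplit : ∀ c' : ∀ i, G i, (if ∀ i : Fin s, i.val < m → c' i = c i then
        ∏ i, g i (fun j => c' j) (c' i) else 0) = ∑ v : G i₀,
        if ∀ i : Fin s, i.val < m + 1 → c' i = Function.update c i₀ v i then
          ∏ i, g i (fun j => c' j) (c' i) else 0 := by
      intro c'
      have hiff : ∀ v, (∀ i : Fin s, i.val < m + 1 → c' i = Function.update c i₀ v i) ↔
          (∀ i : Fin s, i.val < m → c' i = c i) ∧ c' i₀ = v := by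
        intro v
        constructor
        · intro h
          refine ⟨fun i hi => ?_, by simpa using h i₀ (by simp [i₀])⟩
          rw [h i (by omega), Function.update_of_ne]
          rintro rfl
          simp [i₀] at hi
        · rintro ⟨h1, h2⟩ i hi
          by_cases hi0 : i = i₀
          · subst hi0
            simpa using h2
          · rw [Function.update_of_ne hi0]
            refine h1 i ?_
            have : i.val ≠ m := fun e => hi0 (Fin.ext e)
            omega
      simp only [hiff, ite_and]
      split_ifs <;> simp
    have hfil : (Finset.univ.filter fun i : Fin s => i.val < m + 1) =
        insert i₀ (Finset.univ.filter fun i : Fin s => i.val < m) := by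
      ext i
      simp only [Finset.mem_filter, Finset.mem_univ, true_and, Finset.mem_insert, Fin.ext_iff, i₀]
      omega
    have hupd : ∀ (v : G i₀) (i : Fin s), i.val < m → Function.update c i₀ v i = c i := by
      intro v i hi
      rw [Function.update_of_ne]
      rintro rfl
      simp [i₀] at hi
    simp only [hsplit]
    rw [Finset.sum_comm]
    have hstep : ∀ v : G i₀, (∑ c' : ∀ i, G i,
        if ∀ i : Fin s, i.val < m + 1 → c' i = Function.update c i₀ v i then
          ∏ i, g i (fun j => c' j) (c' i) else 0) =
        g i₀ (fun j => c j) v * ∏ i : Fin s with i.val < m, g i (fun j => c j) (c i) := by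
      intro v
      rw [ih (m + 1) (by omega) G g hg, hfil, Finset.prod_insert (by simp [i₀])]
      congr 1
      · rw [Function.update_self]
        congr 1
        funext j
        exact hupd v j (Fin.lt_def.1 j.2)
      · refine Finset.prod_congr rfl fun i hi => ?_
        have hi' := (Finset.mem_filter.1 hi).2
        rw [hupd v i hi']
        congr 1
        funext j
        exact hupd v j (lt_trans (Fin.lt_def.1 j.2) hi')
    simp only [hstep]
    rw [← Finset.sum_mul, hg, one_mul]

end Sequential

/-! ### Masked sequences -/

open scoped Classical in
/-- The part of a sequence at the positions satisfying `S`. -/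
def mask {n : ℕ} {X : Type*} (S : Fin n → Prop) (x : Fin n → X) : Fin n → Option X :=
  fun t => if S t then some (x t) else none

lemma mask_eq_iff {n : ℕ} {X : Type*} {S : Fin n → Prop} {x x' : Fin n → X} :
    mask S x = mask S x' ↔ ∀ t, S t → x t = x' t := by
  simp only [mask, funext_iff]
  refine forall_congr' fun t => ?_
  by_cases h : S t <;> simp [h]

/-! ### Markov chains of a code -/

section Markov

open scoped Classical

variable {Ω α β γ : Type*} [Fintype Ω] {p : Ω → ℝ}

lemma MarkovChain.symm {A : Ω → α} {B : Ω → β} {C : Ω → γ} (h : MarkovChain p A B C) :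
    MarkovChain p C B A := by
  intro c b a
  have e₁ : lawOf p (fun ω => (C ω, B ω, A ω)) (c, b, a) =
      lawOf p (fun ω => (A ω, B ω, C ω)) (a, b, c) :=
    lawOf_congr fun ω _ => by simp only [Prod.mk.injEq]; tauto
  have e₂ : lawOf p (fun ω => (C ω, B ω)) (c, b) = lawOf p (fun ω => (B ω, C ω)) (b, c) :=
    lawOf_congr fun ω _ => by simp only [Prod.mk.injEq]; tauto
  have e₃ : lawOf p (fun ω => (B ω, A ω)) (b, a) = lawOf p (fun ω => (A ω, B ω)) (a, b) :=
    lawOf_congr fun ω _ => by simp only [Prod.mk.injEq]; tauto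
  rw [e₁, e₂, e₃, h]
  ring

lemma lawOf_map_fst [Fintype α] {α' : Type*} (p : Ω → ℝ) (A : Ω → α) (f : α → α') (D : Ω → β)
    (a' : α') (d : β) : lawOf p (fun ω => (f (A ω), D ω)) (a', d) =
      ∑ a, if f a = a' then lawOf p (fun ω => (A ω, D ω)) (a, d) else 0 := by
  simp only [lawOf, ← Finset.sum_filter]
  rw [Finset.sum_comm' (t' := Finset.univ) (s' := fun ω => Finset.univ.filter fun a => f a = a')
    (by simp)] <;> simp only [Finset.sum_filter]
  refine Finset.sum_congr rfl fun ω _ => ?_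
  by_cases h : D ω = d
  · simp only [Prod.mk.injEq, h, and_true, ← ite_and]
    rw [Finset.sum_eq_single (A ω)]
    · simp
    · intro b _ hb
      simp [Ne.symm hb]
    · simp
  · simp [h]

lemma MarkovChain.map_left [Fintype α] {α' : Type*} {A : Ω → α} {B : Ω → β} {C : Ω → γ}
    (h : MarkovChain p A B C) (f : α → α') : MarkovChain p (fun ω => f (A ω)) B C := by
  intro a' b c
  rw [lawOf_map_fst p A f (fun ω => (B ω, C ω)), lawOf_map_fst p A f B, Finset.sum_mul,
    Finset.sum_mul]
  refine Finset.sum_congr rfl fun a _ => ?_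
  split_ifs
  · exact h a b c
  · simp

lemma MarkovChain.map_right [Fintype γ] {γ' : Type*} {A : Ω → α} {B : Ω → β} {C : Ω → γ}
    (h : MarkovChain p A B C) (f : γ → γ') : MarkovChain p A B (fun ω => f (C ω)) :=
  (h.symm.map_left f).symm

end Markov

section Code

open scoped Classical

variable {X₁ X₂ Y₁ Y₂ : Type*} [Fintype X₁] [Fintype X₂] [Fintype Y₁] [Fintype Y₂] {r n : ℕ}

lemma sum_prod_pair (q : X₁ × X₂ → ℝ) (hq : ∑ z, q z = 1) :
    ∑ x₁ : Fin n → X₁, ∑ x₂ : Fin n → X₂, ∏ t, q (x₁ t, x₂ t) = 1 := by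
  rw [← Fintype.sum_prod_type', ← one_pow n, ← hq, Fintype.sum_pow]
  exact Fintype.sum_equiv (Equiv.arrowProdEquivProdArrow (Fin n) (fun _ => X₁) (fun _ => X₂)).symm _ _
    fun _ => rfl

/-- The kernel of the terminal whose turn it is. -/
def Code.turn (κ : Code X₁ X₂ Y₁ Y₂ r n) (i : Fin r) (h : (j : Set.Iio i) → Fin (κ.msg j))
    (x₁ : Fin n → X₁) (x₂ : Fin n → X₂) (v : Fin (κ.msg i)) : ℝ :=
  if Odd (i.val + 1) then κ.enc₁ i h x₁ v else κ.enc₂ i h x₂ v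

lemma Code.turn_mem (κ : Code X₁ X₂ Y₁ Y₂ r n) (i : Fin r) (h : (j : Set.Iio i) → Fin (κ.msg j))
    (x₁ : Fin n → X₁) (x₂ : Fin n → X₂) : κ.turn i h x₁ x₂ ∈ stdSimplex ℝ (Fin (κ.msg i)) := by
  by_cases hi : Odd (i.val + 1)
  · have : κ.turn i h x₁ x₂ = κ.enc₁ i h x₁ := by funext v; simp [Code.turn, hi]
    rw [this]
    exact κ.enc₁_mem i h x₁ hi
  · have : κ.turn i h x₁ x₂ = κ.enc₂ i h x₂ := by funext v; simp [Code.turn, hi]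
    rw [this]
    exact κ.enc₂_mem i h x₂ (Nat.not_odd_iff_even.1 hi)

lemma Code.law_eq (κ : Code X₁ X₂ Y₁ Y₂ r n) (q : X₁ × X₂ → ℝ) (ω : κ.Outcome) :
    κ.law q ω = (∏ t, q (ω.1 t, ω.2.1 t)) *
      (∏ i, κ.turn i (fun j => ω.2.2.1 j) ω.1 ω.2.1 (ω.2.2.1 i)) *
      κ.dec₁ ω.2.2.1 ω.1 ω.2.2.2.1 * κ.dec₂ ω.2.2.1 ω.2.1 ω.2.2.2.2 := rfl

lemma Code.law_nonneg (κ : Code X₁ X₂ Y₁ Y₂ r n) {q : X₁ × X₂ → ℝ}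
    (hq : q ∈ stdSimplex ℝ (X₁ × X₂)) (ω : κ.Outcome) : 0 ≤ κ.law q ω := by
  rw [κ.law_eq]
  exact mul_nonneg (mul_nonneg (mul_nonneg (Finset.prod_nonneg fun t _ => hq.1 _)
    (Finset.prod_nonneg fun i _ => (κ.turn_mem i _ _ _).1 _)) ((κ.dec₁_mem _ _).1 _))
    ((κ.dec₂_mem _ _).1 _)

/-- A mass function on an empty alphabet could not have total mass one. The induction supplies a
past at which the kernel can be evaluated. -/
lemma Code.nonempty_msg (κ : Code X₁ X₂ Y₁ Y₂ r n) [Nonempty X₁] [Nonempty X₂] (i : Fin r) :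
    Nonempty (Fin (κ.msg i)) := by
  induction i using WellFoundedLT.induction with
  | ind i ih =>
    have hne : Nonempty ((j : Set.Iio i) → Fin (κ.msg j)) :=
      ⟨fun j => Classical.choice (ih j j.2)⟩
    have x₁ : Fin n → X₁ := fun _ => Classical.arbitrary X₁
    have x₂ : Fin n → X₂ := fun _ => Classical.arbitrary X₂
    have h := (κ.turn_mem i (Classical.choice hne) x₁ x₂).2
    by_contra hempty
    rw [not_nonempty_iff] at hempty
    simp at h

/-- The sources and the first `m` messages. -/
def Code.prefixOf (κ : Code X₁ X₂ Y₁ Y₂ r n) (m : ℕ) (ω : κ.Outcome) :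
    (Fin n → X₁) × (Fin n → X₂) × ((j : {j : Fin r // j.val < m}) → Fin (κ.msg j)) :=
  (ω.1, ω.2.1, fun j => ω.2.2.1 j)

/-- Decoders sum to one, and so do the kernels of the rounds that are not recorded, from the last
one backward (`sum_prod_agree`). -/
lemma Code.lawOf_prefixOf (κ : Code X₁ X₂ Y₁ Y₂ r n) (q : X₁ × X₂ → ℝ) (m : ℕ) (hm : m ≤ r)
    (x₁ : Fin n → X₁) (x₂ : Fin n → X₂) (c : ∀ i, Fin (κ.msg i)) :
    lawOf (κ.law q) (κ.prefixOf m) (x₁, x₂, fun j => c j) = (∏ t, q (x₁ t, x₂ t)) *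
      ∏ i : Fin r with i.val < m, κ.turn i (fun j => c j) x₁ x₂ (c i) := by
  rw [← sum_prod_agree (fun i h v => κ.turn i h x₁ x₂ v) (fun i h => (κ.turn_mem i h x₁ x₂).2) m hm
    c, Finset.mul_sum]
  simp only [lawOf, Fintype.sum_prod_type]
  rw [Finset.sum_eq_single x₁, Finset.sum_eq_single x₂]
  · refine Finset.sum_congr rfl fun c' _ => ?_
    have hiff : ∀ y₁ y₂, κ.prefixOf m (x₁, x₂, c', y₁, y₂) =
        (x₁, x₂, fun j : {j : Fin r // j.val < m} => c j) ↔
        ∀ i : Fin r, i.val < m → c' i = c i := by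
      intro y₁ y₂
      simp only [Code.prefixOf, Prod.mk.injEq, true_and, funext_iff, Subtype.forall]
    simp only [hiff]
    split_ifs
    · simp only [κ.law_eq, ← Finset.mul_sum, (κ.dec₂_mem _ _).2, mul_one, (κ.dec₁_mem _ _).2]
    · simp
  · intro x₂' _ hne
    simp [Code.prefixOf, hne]
  · simp
  · intro x₁' _ hne
    simp [Code.prefixOf, hne]
  · simp

lemma Code.law_mem (κ : Code X₁ X₂ Y₁ Y₂ r n) {q : X₁ × X₂ → ℝ}
    (hq : q ∈ stdSimplex ℝ (X₁ × X₂)) : κ.law q ∈ stdSimplex ℝ κ.Outcome := by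
  refine ⟨κ.law_nonneg hq, ?_⟩
  obtain ⟨⟨a, b⟩⟩ : Nonempty (X₁ × X₂) := by
    by_contra h
    rw [not_nonempty_iff] at h
    simpa using hq.2
  have : Nonempty X₁ := ⟨a⟩
  have : Nonempty X₂ := ⟨b⟩
  have c : ∀ i, Fin (κ.msg i) := fun i => Classical.choice (κ.nonempty_msg i)
  rw [← sum_lawOf (κ.law q) (κ.prefixOf 0), Fintype.sum_prod_type]
  simp only [Fintype.sum_prod_type]
  rw [← sum_prod_pair (n := n) q hq.2]
  refine Finset.sum_congr rfl fun x₁ _ => Finset.sum_congr rfl fun x₂ _ => ?_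
  have : Unique ((j : {j : Fin r // j.val < 0}) → Fin (κ.msg j)) :=
    { default := fun j => c j, uniq := fun d => funext fun j => absurd j.2 (by omega) }
  rw [Fintype.sum_unique]
  have h := κ.lawOf_prefixOf q 0 (by omega) x₁ x₂ c
  simp only [not_lt_zero, Finset.filter_false, Finset.prod_empty, mul_one] at h
  rw [← h]
  congr 3
  exact Subsingleton.elim _ _

variable (κ : Code X₁ X₂ Y₁ Y₂ r n) {q : X₁ × X₂ → ℝ}

/-- Kernels are evaluated on full transcripts, so a partial transcript is completed arbitrarily; the
factors of the formula only look at the recorded rounds. -/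
lemma Code.exists_lawOf_prefixOf (hq : q ∈ stdSimplex ℝ (X₁ × X₂)) (m : ℕ) (hm : m ≤ r) :
    ∃ ext : ((j : {j : Fin r // j.val < m}) → Fin (κ.msg j)) → ∀ i, Fin (κ.msg i),
      (∀ d (j : {j : Fin r // j.val < m}), ext d j = d j) ∧
      ∀ z, lawOf (κ.law q) (κ.prefixOf m) z = (∏ t, q (z.1 t, z.2.1 t)) *
        ∏ i : Fin r with i.val < m,
          κ.turn i (fun j => ext z.2.2 j) z.1 z.2.1 (ext z.2.2 i) := by
  obtain ⟨⟨a, b⟩⟩ : Nonempty (X₁ × X₂) := by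
    by_contra h
    rw [not_nonempty_iff] at h
    simpa using hq.2
  have : Nonempty X₁ := ⟨a⟩
  have : Nonempty X₂ := ⟨b⟩
  let ext : ((j : {j : Fin r // j.val < m}) → Fin (κ.msg j)) → ∀ i, Fin (κ.msg i) := fun d i =>
    if h : i.val < m then d ⟨i, h⟩ else Classical.choice (κ.nonempty_msg i)
  have hext : ∀ d (j : {j : Fin r // j.val < m}), ext d j = d j := fun d j => by simp [ext, j.2]
  refine ⟨ext, hext, fun z => Eq.trans ?_ (κ.lawOf_prefixOf q m hm z.1 z.2.1 (ext z.2.2))⟩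
  simp only [hext]

/-- Given the previous messages, and at each time one of the two sources, the first source and a
message of terminal 1 are independent of the second source. -/
lemma Code.markov_odd (hq : q ∈ stdSimplex ℝ (X₁ × X₂)) (i : Fin r) (hi : Odd (i.val + 1))
    (S T : Fin n → Prop)
    (hST : ∀ t, S t ∨ T t) :
    MarkovChain (κ.law q) (fun ω => (ω.2.2.1 i, ω.1))
      (fun ω => ((fun j : Set.Iio i => ω.2.2.1 j), mask S ω.1, mask T ω.2.1)) (fun ω => ω.2.1) := by
  obtain ⟨ext, hext, hlaw⟩ := κ.exists_lawOf_prefixOf hq (i.val + 1) (by omega)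
  refine (markovChain_lawOf (κ.prefixOf (i.val + 1)) (A := fun z => (z.2.2 ⟨i, by simp⟩, z.1))
    (B := fun z => ((fun j : Set.Iio i => z.2.2 ⟨j, by have := Fin.lt_def.1 j.2; omega⟩),
      mask S z.1, mask T z.2.1)) (C := fun z => z.2.1)).1 ?_
  -- The second sources are exchanged. At each time the two outcomes share a letter of one source,
  -- so the source factors stay or trade places. Odd rounds ignore the second source. Even rounds
  -- come before `i`, where both outcomes have the same messages, so their factors trade places.
  refine markovChain_of_splice (fun ω ω' => (ω.1, ω'.2.1, ω.2.2)) (fun _ _ _ => rfl)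
    (fun ω ω' h => ?_) (fun _ _ _ => rfl) (fun _ _ _ => rfl) (fun ω ω' h => ?_)
  · simp only [Prod.mk.injEq] at h ⊢
    exact ⟨trivial, trivial, h.2.2.symm⟩
  · simp only [Prod.mk.injEq, mask_eq_iff] at h
    obtain ⟨h1, h2, h3⟩ := h
    have hagree : ∀ j : Fin r, j < i → ext ω.2.2 j = ext ω'.2.2 j := by
      intro j hj
      have hj' : j.val < i.val + 1 := by have := Fin.lt_def.1 hj; omega
      have e := congrFun h1 ⟨j, hj⟩
      exact (hext ω.2.2 ⟨j, hj'⟩).trans (e.trans (hext ω'.2.2 ⟨j, hj'⟩).symm)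
    simp only [hlaw]
    rw [mul_mul_mul_comm, mul_mul_mul_comm (∏ t, q (ω.1 t, ω.2.1 t)), ← Finset.prod_mul_distrib,
      ← Finset.prod_mul_distrib, ← Finset.prod_mul_distrib, ← Finset.prod_mul_distrib]
    congr 1
    · refine Finset.prod_congr rfl fun t _ => ?_
      rcases hST t with ht | ht
      · rw [h2 t ht, mul_comm]
      · rw [h3 t ht]
    · refine Finset.prod_congr rfl fun j hj => ?_
      by_cases hodd : Odd (j.val + 1)
      · simp [Code.turn, hodd]
      · have hji : j < i := by
          have h4 := (Finset.mem_filter.1 hj).2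
          have : j ≠ i := fun e => hodd (e ▸ hi)
          exact lt_of_le_of_ne (Fin.le_def.2 (by omega)) this
        have hpast : (fun k : Set.Iio j => ext ω.2.2 k) = fun k : Set.Iio j => ext ω'.2.2 k :=
          funext fun k => hagree k (lt_trans k.2 hji)
        simp only [Code.turn, hodd, if_false, hpast, hagree j hji]
        rw [mul_comm]

/-- The mirror image, by exchange of the first sources: now the factors of the even rounds stay and
those of the earlier odd rounds trade places. -/
lemma Code.markov_even (hq : q ∈ stdSimplex ℝ (X₁ × X₂)) (i : Fin r) (hi : Even (i.val + 1))
    (S T : Fin n → Prop)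
    (hST : ∀ t, S t ∨ T t) :
    MarkovChain (κ.law q) (fun ω => (ω.2.2.1 i, ω.2.1))
      (fun ω => ((fun j : Set.Iio i => ω.2.2.1 j), mask S ω.1, mask T ω.2.1)) (fun ω => ω.1) := by
  obtain ⟨ext, hext, hlaw⟩ := κ.exists_lawOf_prefixOf hq (i.val + 1) (by omega)
  refine (markovChain_lawOf (κ.prefixOf (i.val + 1)) (A := fun z => (z.2.2 ⟨i, by simp⟩, z.2.1))
    (B := fun z => ((fun j : Set.Iio i => z.2.2 ⟨j, by have := Fin.lt_def.1 j.2; omega⟩),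
      mask S z.1, mask T z.2.1)) (C := fun z => z.1)).1 ?_
  refine markovChain_of_splice (fun ω ω' => (ω'.1, ω.2.1, ω.2.2)) (fun _ _ _ => rfl)
    (fun ω ω' h => ?_) (fun _ _ _ => rfl) (fun _ _ _ => rfl) (fun ω ω' h => ?_)
  · simp only [Prod.mk.injEq] at h ⊢
    exact ⟨trivial, h.2.1.symm, trivial⟩
  · simp only [Prod.mk.injEq, mask_eq_iff] at h
    obtain ⟨h1, h2, h3⟩ := h
    have hagree : ∀ j : Fin r, j < i → ext ω.2.2 j = ext ω'.2.2 j := by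
      intro j hj
      have hj' : j.val < i.val + 1 := by have := Fin.lt_def.1 hj; omega
      have e := congrFun h1 ⟨j, hj⟩
      exact (hext ω.2.2 ⟨j, hj'⟩).trans (e.trans (hext ω'.2.2 ⟨j, hj'⟩).symm)
    simp only [hlaw]
    rw [mul_mul_mul_comm, mul_mul_mul_comm (∏ t, q (ω.1 t, ω.2.1 t)), ← Finset.prod_mul_distrib,
      ← Finset.prod_mul_distrib, ← Finset.prod_mul_distrib, ← Finset.prod_mul_distrib]
    congr 1
    · refine Finset.prod_congr rfl fun t _ => ?_
      rcases hST t with ht | ht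
      · rw [h2 t ht]
      · rw [h3 t ht, mul_comm]
    · refine Finset.prod_congr rfl fun j hj => ?_
      by_cases hodd : Odd (j.val + 1)
      · have hji : j < i := by
          have h4 := (Finset.mem_filter.1 hj).2
          have : j ≠ i := fun e => (Nat.not_even_iff_odd.2 hodd) (e ▸ hi)
          exact lt_of_le_of_ne (Fin.le_def.2 (by omega)) this
        have hpast : (fun k : Set.Iio j => ext ω.2.2 k) = fun k : Set.Iio j => ext ω'.2.2 k :=
          funext fun k => hagree k (lt_trans k.2 hji)
        simp only [Code.turn, hodd, if_true, hpast, hagree j hji]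
        rw [mul_comm]
      · simp [Code.turn, hodd]

/-- Given all messages, and at each time one of the two sources, what the terminals see and output
is independent. -/
lemma Code.markov_out (S T : Fin n → Prop) (hST : ∀ t, S t ∨ T t) :
    MarkovChain (κ.law q) (fun ω => (ω.1, ω.2.2.2.1))
      (fun ω => (ω.2.2.1, mask S ω.1, mask T ω.2.1)) (fun ω => (ω.2.1, ω.2.2.2.2)) := by
  -- The second source is exchanged together with the output drawn from it. The whole transcript is
  -- common, so every decoder factor reappears unchanged.
  refine markovChain_of_splice
    (fun ω ω' => (ω.1, ω'.2.1, ω.2.2.1, ω.2.2.2.1, ω'.2.2.2.2)) (fun _ _ _ => rfl)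
    (fun ω ω' h => ?_) (fun _ _ _ => rfl) (fun _ _ _ => rfl) (fun ω ω' h => ?_)
  · simp only [Prod.mk.injEq] at h ⊢
    exact ⟨trivial, trivial, h.2.2.symm⟩
  · simp only [Prod.mk.injEq, mask_eq_iff] at h
    obtain ⟨h1, h2, h3⟩ := h
    have e₁ : (∏ t, q (ω.1 t, ω'.2.1 t)) * (∏ t, q (ω'.1 t, ω.2.1 t)) =
        (∏ t, q (ω.1 t, ω.2.1 t)) * (∏ t, q (ω'.1 t, ω'.2.1 t)) := by
      rw [← Finset.prod_mul_distrib, ← Finset.prod_mul_distrib]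
      refine Finset.prod_congr rfl fun t _ => ?_
      rcases hST t with ht | ht
      · rw [h2 t ht, mul_comm]
      · rw [h3 t ht]
    have e₂ : (∏ i, κ.turn i (fun j => ω'.2.2.1 j) ω.1 ω'.2.1 (ω'.2.2.1 i)) *
        (∏ i, κ.turn i (fun j => ω'.2.2.1 j) ω'.1 ω.2.1 (ω'.2.2.1 i)) =
        (∏ i, κ.turn i (fun j => ω'.2.2.1 j) ω.1 ω.2.1 (ω'.2.2.1 i)) *
        (∏ i, κ.turn i (fun j => ω'.2.2.1 j) ω'.1 ω'.2.1 (ω'.2.2.1 i)) := by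
      rw [← Finset.prod_mul_distrib, ← Finset.prod_mul_distrib]
      refine Finset.prod_congr rfl fun j _ => ?_
      by_cases hodd : Odd (j.val + 1)
      · simp [Code.turn, hodd]
      · simp only [Code.turn, hodd, if_false]
        rw [mul_comm]
    simp only [κ.law_eq]
    simp only [h1]
    linear_combination
      ((∏ i, κ.turn i (fun j => ω'.2.2.1 j) ω.1 ω'.2.1 (ω'.2.2.1 i)) *
        (∏ i, κ.turn i (fun j => ω'.2.2.1 j) ω'.1 ω.2.1 (ω'.2.2.1 i))) *
        κ.dec₁ ω'.2.2.1 ω.1 ω.2.2.2.1 * κ.dec₂ ω'.2.2.1 ω'.2.1 ω'.2.2.2.2 *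
        κ.dec₁ ω'.2.2.1 ω'.1 ω'.2.2.2.1 * κ.dec₂ ω'.2.2.1 ω.2.1 ω.2.2.2.2 * e₁ +
      ((∏ t, q (ω.1 t, ω.2.1 t)) * (∏ t, q (ω'.1 t, ω'.2.1 t))) *
        κ.dec₁ ω'.2.2.1 ω.1 ω.2.2.2.1 * κ.dec₂ ω'.2.2.1 ω'.2.1 ω'.2.2.2.2 *
        κ.dec₁ ω'.2.2.1 ω'.1 ω'.2.2.2.1 * κ.dec₂ ω'.2.2.1 ω.2.1 ω.2.2.2.2 * e₂

end Code

/-! ### I.i.d. sequences -/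

section Iid

open scoped Classical

variable {Z β : Type*} [Fintype Z] {q : Z → ℝ} {n : ℕ}

/-- The mass function of `n` independent samples of `q`. -/
def iid (q : Z → ℝ) (n : ℕ) : (Fin n → Z) → ℝ := fun z => ∏ t, q (z t)

lemma sum_prod_apply (g : Fin n → Z → ℝ) : ∑ z : Fin n → Z, ∏ t, g t (z t) = ∏ t, ∑ a, g t a := by
  rw [Finset.prod_univ_sum, Fintype.piFinset_univ]

lemma iid_mem (hq : q ∈ stdSimplex ℝ Z) : iid q n ∈ stdSimplex ℝ (Fin n → Z) :=
  ⟨fun z => Finset.prod_nonneg fun t _ => hq.1 _, by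
    simp only [iid]
    rw [sum_prod_apply fun _ => q]
    simp [hq.2]⟩

lemma sum_iid_mul_apply (hq : ∑ a, q a = 1) (t : Fin n) (φ : Z → ℝ) :
    ∑ z, iid q n z * φ (z t) = ∑ a, q a * φ a := by
  have h : ∀ z : Fin n → Z, iid q n z * φ (z t) =
      ∏ s, q (z s) * (if s = t then φ (z s) else 1) := by
    intro z
    rw [Finset.prod_mul_distrib]
    simp [iid]
  simp only [h]
  rw [sum_prod_apply fun s a => q a * if s = t then φ a else 1, Finset.prod_eq_single t]
  · simp
  · intro s _ hs
    simp [hs, hq]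
  · simp

lemma lawOf_iid (f : Z → β) (b : Fin n → β) :
    lawOf (iid q n) (fun z t => f (z t)) b = ∏ t, lawOf q f (b t) := by
  refine (Finset.sum_congr rfl fun z _ => ?_).trans
    (sum_prod_apply fun t a => if f a = b t then q a else 0)
  by_cases hz : (fun t => f (z t)) = b
  · have : ∀ t, f (z t) = b t := fun t => congrFun hz t
    simp [this, iid]
  · obtain ⟨t, ht⟩ := Function.ne_iff.1 hz
    rw [if_neg hz]
    exact (Finset.prod_eq_zero (Finset.mem_univ t) (by simp [ht])).symm

lemma logLaw_iid (hq : q ∈ stdSimplex ℝ Z) (f : Z → β) :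
    logLaw (iid q n) (fun z t => f (z t)) = n * logLaw q f := by
  have h : ∀ z : Fin n → Z, iid q n z * Real.log (lawOf (iid q n) (fun z t => f (z t))
      fun t => f (z t)) = ∑ t, iid q n z * Real.log (lawOf q f (f (z t))) := by
    intro z
    by_cases hz : iid q n z = 0
    · simp [hz]
    have hz' : ∀ t, q (z t) ≠ 0 := fun t => (Finset.prod_ne_zero_iff.1 hz) t (Finset.mem_univ t)
    rw [lawOf_iid, Real.log_prod fun t _ => (lawOf_pos hq.1 f (hz' t)).ne', Finset.mul_sum]
  simp only [logLaw, h]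
  rw [Finset.sum_comm]
  simp only [sum_iid_mul_apply hq.2 _ fun a => Real.log (lawOf q f (f a))]
  simp

end Iid

/-! ### Uniform time sharing -/

section Mix

open scoped Classical

variable {Ω α β γ : Type*} [Fintype Ω] {p : Ω → ℝ} {n : ℕ}

/-- The product of `p` and the uniform law on the times `Fin n`. -/
def mix (n : ℕ) (p : Ω → ℝ) : Fin n × Ω → ℝ := fun z => 1 / (n : ℝ) * p z.2

lemma mix_mem (hn : n ≠ 0) (hp : p ∈ stdSimplex ℝ Ω) : mix n p ∈ stdSimplex ℝ (Fin n × Ω) := by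
  refine ⟨fun z => mul_nonneg (by positivity) (hp.1 _), ?_⟩
  simp only [mix, Fintype.sum_prod_type, ← Finset.mul_sum, hp.2]
  simp [hn]

lemma lawOf_mix_eq_avg (A : Fin n → Ω → α) (a : α) :
    lawOf (mix n p) (fun z => A z.1 z.2) a = 1 / (n : ℝ) * ∑ t, lawOf p (A t) a := by
  simp only [lawOf, Fintype.sum_prod_type, mix, Finset.mul_sum, mul_ite, mul_zero]

lemma lawOf_mix (A : Fin n → Ω → α) (t : Fin n) (a : α) :
    lawOf (mix n p) (fun z => (z.1, A z.1 z.2)) (t, a) = 1 / (n : ℝ) * lawOf p (A t) a := by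
  rw [lawOf_mix_eq_avg fun s ω => (s, A s ω)]
  congr 1
  rw [Finset.sum_eq_single t]
  · exact lawOf_congr fun ω _ => by simp
  · intro s _ hs
    simp [lawOf, hs]
  · simp

/-- The time must be part of the conditioning variable: the assumed chains hold at each fixed time,
and a mixture of them need not be a chain. -/
lemma MarkovChain.mix {A : Fin n → Ω → α} {B : Fin n → Ω → β} {C : Fin n → Ω → γ}
    (h : ∀ t, MarkovChain p (A t) (B t) (C t)) :
    MarkovChain (mix n p) (fun z => A z.1 z.2) (fun z => (z.1, B z.1 z.2))
      (fun z => C z.1 z.2) := by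
  rintro a ⟨t, b⟩ c
  have e₁ : lawOf (Coordination.mix n p) (fun z => (A z.1 z.2, (z.1, B z.1 z.2), C z.1 z.2))
      (a, (t, b), c) = 1 / (n : ℝ) * lawOf p (fun ω => (A t ω, B t ω, C t ω)) (a, b, c) := by
    rw [← lawOf_mix fun t ω => (A t ω, B t ω, C t ω)]
    exact lawOf_congr fun ω _ => by simp only [Prod.mk.injEq]; tauto
  have e₂ : lawOf (Coordination.mix n p) (fun z => (A z.1 z.2, (z.1, B z.1 z.2)))
      (a, (t, b)) = 1 / (n : ℝ) * lawOf p (fun ω => (A t ω, B t ω)) (a, b) := by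
    rw [← lawOf_mix fun t ω => (A t ω, B t ω)]
    exact lawOf_congr fun ω _ => by simp only [Prod.mk.injEq]; tauto
  have e₃ : lawOf (Coordination.mix n p) (fun z => ((z.1, B z.1 z.2), C z.1 z.2))
      ((t, b), c) = 1 / (n : ℝ) * lawOf p (fun ω => (B t ω, C t ω)) (b, c) := by
    rw [← lawOf_mix fun t ω => (B t ω, C t ω)]
    exact lawOf_congr fun ω _ => by simp only [Prod.mk.injEq]; tauto
  rw [e₁, e₂, e₃, lawOf_mix]
  linear_combination 1 / (n : ℝ) * (1 / (n : ℝ)) * h t a b c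

/-- `H(T, A_T) = log n + H(A_T | T)`. The term `log (1/n)` cancels whenever two such entropies are
subtracted. -/
lemma logLaw_mix (hn : n ≠ 0) (hp : p ∈ stdSimplex ℝ Ω) (A : Fin n → Ω → α) :
    logLaw (mix n p) (fun z => (z.1, A z.1 z.2)) =
      1 / (n : ℝ) * ∑ t, logLaw p (A t) + Real.log (1 / (n : ℝ)) := by
  have h : ∀ t ω, mix n p (t, ω) * Real.log (lawOf (mix n p) (fun z => (z.1, A z.1 z.2))
      (t, A t ω)) = 1 / (n : ℝ) * (p ω * Real.log (lawOf p (A t) (A t ω))) +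
        1 / (n : ℝ) * Real.log (1 / (n : ℝ)) * p ω := by
    intro t ω
    by_cases hω : p ω = 0
    · simp [mix, hω]
    have hn' : (1 / (n : ℝ)) ≠ 0 := by positivity
    rw [lawOf_mix, Real.log_mul hn' (lawOf_pos hp.1 _ hω).ne']
    simp only [mix]
    ring
  simp only [logLaw, Fintype.sum_prod_type, h, Finset.sum_add_distrib, ← Finset.mul_sum, hp.2]
  simp only [Finset.sum_const, Finset.card_univ, Fintype.card_fin, nsmul_eq_mul]
  field_simp

end Mix

/-! ### Chain rules -/

section Chain

open scoped Classical

variable {Ω α β γ : Type*} [Fintype Ω] {p : Ω → ℝ}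

lemma logLaw_add_le_pair [Fintype α] [Fintype β] (hp : p ∈ stdSimplex ℝ Ω) (A : Ω → α)
    (B : Ω → β) : logLaw p A + logLaw p B ≤ logLaw p (fun ω => (A ω, B ω)) := by
  have h := logLaw_submodular hp A (fun _ => ()) B
  have h0 : logLaw p (fun _ : Ω => ()) = 0 := by simp [logLaw, lawOf, hp.2]
  rw [h0, add_zero, logLaw_congr (p := p) (A := fun ω => (A ω, ())) (B := A) (by simp),
    logLaw_congr (p := p) (A := fun ω => ((), B ω)) (B := B) (by simp),
    logLaw_congr (p := p) (A := fun ω => (A ω, (), B ω)) (B := fun ω => (A ω, B ω)) (by simp)] at h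
  exact h

/-- The information that an interactive transcript reveals about `X` to an observer who knows `X'`
is at most the total entropy of the messages that are not sent by this observer. -/
lemma natsInfo_le_sum_entropy {r : ℕ} {δ : Fin r → Type*} [∀ i, Fintype (δ i)] [Fintype α]
    [Fintype β] (hp : p ∈ stdSimplex ℝ Ω) (C : ∀ i, Ω → δ i) (X : Ω → α) (X' : Ω → β)
    (O : Fin r → Prop) (hM : ∀ i, ¬ O i →
      MarkovChain p (C i) (fun ω => (fun j : Set.Iio i => C j ω, X' ω)) X) :
    natsInfo p X (fun ω i => C i ω) X' ≤ ∑ i with O i, -logLaw p (C i) := by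
  -- `u m` is `-H(X | C_1,…,C_m, X')`, so `u r - u 0` is the information in question. One step adds
  -- the information of one message given the earlier ones and `X'`: at most its entropy, and zero
  -- by the Markov chain if the observer sent it.
  let u : ℕ → ℝ := fun m =>
    logLaw p (fun ω => ((fun j : {j : Fin r // j.val < m} => C j ω), X ω, X' ω)) -
    logLaw p (fun ω => ((fun j : {j : Fin r // j.val < m} => C j ω), X' ω))
  let e : ℕ → ℝ := fun m => if h : m < r then (if O ⟨m, h⟩ then -logLaw p (C ⟨m, h⟩) else 0) else 0
  have hstep : ∀ m ∈ Finset.range r, u (m + 1) - u m ≤ e m := by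
    intro m hm
    have hmr : m < r := Finset.mem_range.1 hm
    let i : Fin r := ⟨m, hmr⟩
    let B : Ω → ((j : Set.Iio i) → δ j) × β := fun ω => (fun j => C j ω, X' ω)
    have hpre : ∀ ω ω', ((fun j : {j : Fin r // j.val < m} => C j ω) =
        fun j : {j : Fin r // j.val < m} => C j ω') ↔
        ((fun j : Set.Iio i => C j ω) = fun j : Set.Iio i => C j ω') := by
      intro ω ω'
      simp only [funext_iff]
      exact ⟨fun h j => h ⟨j, Fin.lt_def.1 j.2⟩, fun h j => h ⟨j, Fin.lt_def.2 j.2⟩⟩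
    have hsucc : ∀ ω ω', ((fun j : {j : Fin r // j.val < m + 1} => C j ω) =
        fun j : {j : Fin r // j.val < m + 1} => C j ω') ↔
        C i ω = C i ω' ∧ ((fun j : Set.Iio i => C j ω) = fun j : Set.Iio i => C j ω') := by
      intro ω ω'
      simp only [funext_iff]
      refine ⟨fun h => ⟨h ⟨i, by simp [i]⟩, fun j => h ⟨j, ?_⟩⟩, fun h j => ?_⟩
      · have : j.val.val < m := Fin.lt_def.1 j.2
        omega
      · rcases lt_or_ge j.val.val m with hj | hj
        · exact h.2 ⟨j, Fin.lt_def.2 hj⟩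
        · have hji : j.val = i := Fin.ext (by have := j.2; simp only [i]; omega)
          have h1 := h.1
          rw [← hji] at h1
          exact h1
    have e₁ : logLaw p (fun ω => ((fun j : {j : Fin r // j.val < m + 1} => C j ω), X ω, X' ω)) =
        logLaw p (fun ω => (C i ω, B ω, X ω)) := logLaw_congr fun ω ω' _ _ => by
      simp only [B, Prod.mk.injEq, hsucc]; tauto
    have e₂ : logLaw p (fun ω => ((fun j : {j : Fin r // j.val < m + 1} => C j ω), X' ω)) =
        logLaw p (fun ω => (C i ω, B ω)) := logLaw_congr fun ω ω' _ _ => by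
      simp only [B, Prod.mk.injEq, hsucc]; tauto
    have e₃ : logLaw p (fun ω => ((fun j : {j : Fin r // j.val < m} => C j ω), X ω, X' ω)) =
        logLaw p (fun ω => (B ω, X ω)) := logLaw_congr fun ω ω' _ _ => by
      simp only [B, Prod.mk.injEq, hpre]; tauto
    have e₄ : logLaw p (fun ω => ((fun j : {j : Fin r // j.val < m} => C j ω), X' ω)) =
        logLaw p B := logLaw_congr fun ω ω' _ _ => by
      simp only [B, Prod.mk.injEq, hpre]
    simp only [u, e, e₁, e₂, e₃, e₄, hmr, dif_pos]
    split_ifs with hO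
    · have h1 := logLaw_add_le_pair hp (C i) B
      have h2 := logLaw_pair_le hp (fun ω => (B ω, X ω)) (C i)
      rw [logLaw_congr (p := p) (A := fun ω => ((B ω, X ω), C i ω))
        (B := fun ω => (C i ω, B ω, X ω))
        (fun ω ω' _ _ => by simp only [Prod.mk.injEq]; tauto)] at h2
      linarith
    · have h1 := (hM i hO).logLaw_eq hp
      linarith
  have hsum := Finset.sum_le_sum hstep
  rw [Finset.sum_range_sub, Finset.sum_range e] at hsum
  have h0 : u 0 = logLaw p (fun ω => (X ω, X' ω)) - logLaw p X' := by
    simp only [u]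
    congr 1 <;> refine logLaw_congr fun ω ω' _ _ => ?_
    · simp only [Prod.mk.injEq, funext_iff, Subtype.forall]; simp
    · simp only [Prod.mk.injEq, funext_iff, Subtype.forall]; simp
  have hr : u r = logLaw p (fun ω => (X ω, (fun i => C i ω), X' ω)) -
      logLaw p (fun ω => ((fun i => C i ω), X' ω)) := by
    simp only [u]
    congr 1 <;> refine logLaw_congr fun ω ω' _ _ => ?_
    · simp only [Prod.mk.injEq, funext_iff, Subtype.forall, Fin.is_lt, forall_const]; tauto
    · simp only [Prod.mk.injEq, funext_iff, Subtype.forall, Fin.is_lt, forall_const]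
  rw [h0, hr] at hsum
  simp only [e, Fin.is_lt, dif_pos, Fin.eta, ← Finset.sum_filter] at hsum
  simp only [natsInfo]
  linarith

variable {n : ℕ} [Fintype α] [Fintype β] [Fintype γ]

/-- The chain rule forward in time: `H(X | C, X') = ∑ H(X_t | C, X_{<t}, X')`, and dropping
`X'_{<t}` from the conditioning can only increase each term. The signs are reversed because `logLaw`
is negative entropy. -/
lemma sum_le_logLaw_sub_fst (hp : p ∈ stdSimplex ℝ Ω) (C : Ω → γ) (X : Ω → Fin n → α)
    (X' : Ω → Fin n → β) :
    ∑ t, (logLaw p (fun ω => (X ω t, (C ω, mask (· < t) (X ω), mask (t < ·) (X' ω)), X' ω t)) -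
      logLaw p (fun ω => ((C ω, mask (· < t) (X ω), mask (t < ·) (X' ω)), X' ω t))) ≤
    logLaw p (fun ω => (X ω, C ω, X' ω)) - logLaw p (fun ω => (C ω, X' ω)) := by
  let a : ℕ → ℝ := fun m => logLaw p (fun ω => (mask (fun s => s.val < m) (X ω), C ω, X' ω))
  have ha0 : a 0 = logLaw p (fun ω => (C ω, X' ω)) := logLaw_congr fun ω ω' _ _ => by
    simp [mask_eq_iff]
  have han : a n = logLaw p (fun ω => (X ω, C ω, X' ω)) := logLaw_congr fun ω ω' _ _ => by
    simp only [Prod.mk.injEq, mask_eq_iff]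
    simp [funext_iff]
  rw [← ha0, ← han, ← Finset.sum_range_sub, Finset.sum_range]
  refine Finset.sum_le_sum fun t _ => ?_
  have h := logLaw_submodular hp (fun ω => X ω t)
    (fun ω => ((C ω, mask (· < t) (X ω), mask (t < ·) (X' ω)), X' ω t)) X'
  have e₁ : logLaw p (fun ω => (X ω t, ((C ω, mask (· < t) (X ω), mask (t < ·) (X' ω)), X' ω t),
      X' ω)) = a (t + 1) := logLaw_congr fun ω ω' _ _ => by
    simp only [Prod.mk.injEq, mask_eq_iff]
    simp only [funext_iff]
    constructor
    · rintro ⟨h1, ⟨⟨h2, h3, -⟩, -⟩, h4⟩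
      refine ⟨fun s hs => ?_, h2, h4⟩
      rcases lt_or_eq_of_le (Nat.lt_succ_iff.1 hs) with hs | hs
      · exact h3 s hs
      · rw [Fin.ext hs, h1]
    · rintro ⟨h1, h2, h3⟩
      exact ⟨h1 t (by omega), ⟨⟨h2, fun s hs => h1 s (by have := Fin.lt_def.1 hs; omega),
        fun s _ => h3 s⟩, h3 t⟩, h3⟩
  have e₂ : logLaw p (fun ω => (((C ω, mask (· < t) (X ω), mask (t < ·) (X' ω)), X' ω t),
      X' ω)) = a t := logLaw_congr fun ω ω' _ _ => by
    simp only [Prod.mk.injEq, mask_eq_iff]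
    simp only [funext_iff]
    exact ⟨fun ⟨⟨⟨h2, h3, _⟩, _⟩, h4⟩ => ⟨fun s hs => h3 s hs, h2, h4⟩,
      fun ⟨h1, h2, h3⟩ => ⟨⟨⟨h2, fun s hs => h1 s hs, fun s _ => h3 s⟩, h3 t⟩, h3⟩⟩
  rw [e₁, e₂] at h
  linarith

/-- The chain rule for `X'` is run backward, from the last letter, so that what is kept after
dropping `X_{>t}` is again `C`, `X_{<t}` and `X'_{>t}`. The same auxiliary variable thus serves both
rates. -/
lemma sum_le_logLaw_sub_snd (hp : p ∈ stdSimplex ℝ Ω) (C : Ω → γ) (X : Ω → Fin n → α)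
    (X' : Ω → Fin n → β) :
    ∑ t, (logLaw p (fun ω => (X' ω t, (C ω, mask (· < t) (X ω), mask (t < ·) (X' ω)), X ω t)) -
      logLaw p (fun ω => ((C ω, mask (· < t) (X ω), mask (t < ·) (X' ω)), X ω t))) ≤
    logLaw p (fun ω => (X' ω, C ω, X ω)) - logLaw p (fun ω => (C ω, X ω)) := by
  let a : ℕ → ℝ := fun m => logLaw p (fun ω => (mask (fun s => m ≤ s.val) (X' ω), C ω, X ω))
  have ha0 : a 0 = logLaw p (fun ω => (X' ω, C ω, X ω)) := logLaw_congr fun ω ω' _ _ => by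
    simp only [Prod.mk.injEq, mask_eq_iff]
    simp [funext_iff]
  have han : a n = logLaw p (fun ω => (C ω, X ω)) := logLaw_congr fun ω ω' _ _ => by
    simp [mask_eq_iff]
  rw [← ha0, ← han, ← Finset.sum_range_sub', Finset.sum_range]
  refine Finset.sum_le_sum fun t _ => ?_
  have h := logLaw_submodular hp (fun ω => X' ω t)
    (fun ω => ((C ω, mask (· < t) (X ω), mask (t < ·) (X' ω)), X ω t)) X
  have e₁ : logLaw p (fun ω => (X' ω t, ((C ω, mask (· < t) (X ω), mask (t < ·) (X' ω)), X ω t),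
      X ω)) = a t := logLaw_congr fun ω ω' _ _ => by
    simp only [Prod.mk.injEq, mask_eq_iff]
    simp only [funext_iff]
    constructor
    · rintro ⟨h1, ⟨⟨h2, -, h3⟩, -⟩, h4⟩
      refine ⟨fun s hs => ?_, h2, h4⟩
      rcases lt_or_eq_of_le hs with hs | hs
      · exact h3 s hs
      · rw [← Fin.ext hs, h1]
    · rintro ⟨h1, h2, h3⟩
      exact ⟨h1 t le_rfl, ⟨⟨h2, fun s _ => h3 s, fun s hs => h1 s (by have := Fin.lt_def.1 hs; omega)⟩,
        h3 t⟩, h3⟩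
  have e₂ : logLaw p (fun ω => (((C ω, mask (· < t) (X ω), mask (t < ·) (X' ω)), X ω t),
      X ω)) = a (t + 1) := logLaw_congr fun ω ω' _ _ => by
    simp only [Prod.mk.injEq, mask_eq_iff]
    simp only [funext_iff]
    exact ⟨fun ⟨⟨⟨h2, _, h3⟩, _⟩, h4⟩ => ⟨fun s hs => h3 s hs, h2, h4⟩,
      fun ⟨h1, h2, h3⟩ => ⟨⟨⟨h2, fun s _ => h3 s, fun s hs => h1 s hs⟩, h3 t⟩, h3⟩⟩
  rw [e₁, e₂] at h
  linarith

end Chain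

/-! ### Single-letterization of a code -/

section SingleLetter

open scoped Classical

variable {X₁ X₂ Y₁ Y₂ : Type*} [Fintype X₁] [Fintype X₂] [Fintype Y₁] [Fintype Y₂] {r n : ℕ}
  (κ : Code X₁ X₂ Y₁ Y₂ r n) {q : X₁ × X₂ → ℝ}

/-- The auxiliary variables of a code at a random time `t`: the messages, where the first one is
accompanied by `t`, the past of the first source, and the future of the second one. -/
def Code.aux (i : Fin r) (z : Fin n × κ.Outcome) :
    Fin (κ.msg i) × Option (Fin n × (Fin n → Option X₁) × (Fin n → Option X₂)) :=
  (z.2.2.2.1 i, if i.val = 0 then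
    some (z.1, mask (· < z.1) z.2.1, mask (z.1 < ·) z.2.2.1) else none)

/-- The extra data sit in the first variable only, so every nonempty past contains them. The past of
the first round is empty and has to be treated apart. -/
lemma Code.aux_past_eq_iff (i : Fin r) (hi : i.val ≠ 0) (z z' : Fin n × κ.Outcome) :
    ((fun j : Set.Iio i => κ.aux j z) = fun j : Set.Iio i => κ.aux j z') ↔
      z.1 = z'.1 ∧ ((fun j : Set.Iio i => z.2.2.2.1 j) = fun j : Set.Iio i => z'.2.2.2.1 j) ∧
      mask (· < z.1) z.2.1 = mask (· < z.1) z'.2.1 ∧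
      mask (z.1 < ·) z.2.2.1 = mask (z.1 < ·) z'.2.2.1 := by
  constructor
  · intro h
    have h0 := congrFun h ⟨⟨0, by omega⟩, Fin.lt_def.2 (by simp; omega)⟩
    simp only [Code.aux, if_true, Prod.mk.injEq, Option.some.injEq] at h0
    obtain ⟨-, h1, h2, h3⟩ := h0
    refine ⟨h1, ?_, by rw [h2, h1], by rw [h3, h1]⟩
    funext j
    exact congrArg Prod.fst (congrFun h j)
  · rintro ⟨h1, h2, h3, h4⟩
    funext j
    have := congrFun h2 j
    simp only [Code.aux, this, h3, h4, ← h1]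

lemma Code.aux_eq_iff (hr : 1 ≤ r) (z z' : Fin n × κ.Outcome) :
    ((fun i => κ.aux i z) = fun i => κ.aux i z') ↔
      z.1 = z'.1 ∧ z.2.2.2.1 = z'.2.2.2.1 ∧
      mask (· < z.1) z.2.1 = mask (· < z.1) z'.2.1 ∧
      mask (z.1 < ·) z.2.2.1 = mask (z.1 < ·) z'.2.2.1 := by
  constructor
  · intro h
    have h0 := congrFun h ⟨0, by omega⟩
    simp only [Code.aux, if_true, Prod.mk.injEq, Option.some.injEq] at h0
    obtain ⟨-, h1, h2, h3⟩ := h0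
    refine ⟨h1, ?_, by rw [h2, h1], by rw [h3, h1]⟩
    funext j
    exact congrArg Prod.fst (congrFun h j)
  · rintro ⟨h1, h2, h3, h4⟩
    funext j
    simp only [Code.aux, h2, h3, h4, ← h1]

lemma mask_le_iff {X : Type*} (t : Fin n) (x x' : Fin n → X) :
    mask (· ≤ t) x = mask (· ≤ t) x' ↔ mask (· < t) x = mask (· < t) x' ∧ x t = x' t := by
  simp only [mask_eq_iff]
  exact ⟨fun h => ⟨fun s hs => h s hs.le, h t le_rfl⟩,
    fun h s hs => (lt_or_eq_of_le hs).elim (h.1 s) fun e => e ▸ h.2⟩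

lemma mask_ge_iff {X : Type*} (t : Fin n) (x x' : Fin n → X) :
    mask (t ≤ ·) x = mask (t ≤ ·) x' ↔ mask (t < ·) x = mask (t < ·) x' ∧ x t = x' t := by
  simp only [mask_eq_iff]
  exact ⟨fun h => ⟨fun s hs => h s hs.le, h t le_rfl⟩,
    fun h s hs => (lt_or_eq_of_le hs).elim (h.1 s) fun e => e ▸ h.2⟩

/-- With an empty past, the whole of `F_1`, the time included, must be independent of the current
letter of `X_2` given that of `X_1` alone. The current letters of `X_2` in two outcomes, possibly at
different times, can be exchanged: the source is i.i.d., the first message ignores `X_2`, and the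
recorded future starts strictly after the current time. -/
lemma Code.markov_first (hq : q ∈ stdSimplex ℝ (X₁ × X₂)) (i : Fin r) (hi : i.val = 0) :
    MarkovChain (mix n (κ.law q)) (κ.aux i) (fun z => z.2.1 z.1) (fun z => z.2.2.1 z.1) := by
  obtain ⟨ext, -, hlaw⟩ := κ.exists_lawOf_prefixOf hq 1 (by omega)
  have hmix : ∀ z, lawOf (mix n (κ.law q)) (fun z => (z.1, κ.prefixOf 1 z.2)) z =
      1 / (n : ℝ) * lawOf (κ.law q) (κ.prefixOf 1) z.2 := fun z =>
    lawOf_mix (fun _ => κ.prefixOf 1) z.1 z.2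
  have key : MarkovChain (lawOf (mix n (κ.law q)) (fun z => (z.1, κ.prefixOf 1 z.2)))
      (fun z => ((z.2.2.2 ⟨i, by omega⟩, some (z.1, mask (· < z.1) z.2.1, mask (z.1 < ·) z.2.2.1)) :
        Fin (κ.msg i) × Option (Fin n × (Fin n → Option X₁) × (Fin n → Option X₂))))
      (fun z => z.2.1 z.1) (fun z => z.2.2.1 z.1) := by
    refine markovChain_of_splice
      (fun z z' => (z.1, z.2.1, Function.update z.2.2.1 z.1 (z'.2.2.1 z'.1), z.2.2.2))
      (fun z z' _ => ?_) (fun _ _ _ => rfl) (fun _ _ _ => by simp) (fun z z' _ => by simp)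
      (fun z z' h => ?_)
    · simp only [Prod.mk.injEq, Option.some.injEq, true_and, mask_eq_iff]
      exact fun s hs => Function.update_of_ne hs.ne' _ _
    · have hturn : ∀ (x₁ : Fin n → X₁) (x₂ x₂' : Fin n → X₂) (c : ∀ i, Fin (κ.msg i)),
          (∏ i : Fin r with i.val < 1, κ.turn i (fun j => c j) x₁ x₂ (c i)) =
          ∏ i : Fin r with i.val < 1, κ.turn i (fun j => c j) x₁ x₂' (c i) := by
        intro x₁ x₂ x₂' c
        refine Finset.prod_congr rfl fun j hj => ?_
        have hj0 : j.val = 0 := by have := (Finset.mem_filter.1 hj).2; omega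
        simp [Code.turn, hj0]
      have hprod : ∀ (x₁ : Fin n → X₁) (x₂ : Fin n → X₂) (t : Fin n) (v : X₂),
          ∏ s, q (x₁ s, Function.update x₂ t v s) =
          q (x₁ t, v) * ∏ s ∈ Finset.univ.erase t, q (x₁ s, x₂ s) := by
        intro x₁ x₂ t v
        rw [← Finset.mul_prod_erase _ _ (Finset.mem_univ t), Function.update_self]
        congr 1
        refine Finset.prod_congr rfl fun s hs => ?_
        rw [Function.update_of_ne (Finset.ne_of_mem_erase hs)]
      simp only [hmix, hlaw, hprod]
      rw [hturn z.2.1 _ z.2.2.1, hturn z'.2.1 _ z'.2.2.1,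
        ← Finset.mul_prod_erase _ (fun s => q (z.2.1 s, z.2.2.1 s)) (Finset.mem_univ z.1),
        ← Finset.mul_prod_erase _ (fun s => q (z'.2.1 s, z'.2.2.1 s)) (Finset.mem_univ z'.1)]
      rw [h]
      ring
  rw [markovChain_lawOf] at key
  refine key.congr (fun z z' _ _ => ?_) (fun _ _ _ _ => Iff.rfl) (fun _ _ _ _ => Iff.rfl)
  simp [Code.aux, hi, Code.prefixOf]

/-- The past of a later round and the current letter of `X_1` amount to `X_1` up to `t` and `X_2`
after `t`; with the letter of `X_2` instead, to `X_1` before `t` and `X_2` from `t` on. Either way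
each time is covered, as the Markov chains of the code require. -/
lemma Code.isAux (hr : 1 ≤ r) (hn : n ≠ 0) (hq : q ∈ stdSimplex ℝ (X₁ × X₂)) :
    IsAux (mix n (κ.law q)) κ.aux (fun z => z.2.1 z.1) (fun z => z.2.2.1 z.1)
      (fun z => z.2.2.2.2.1 z.1) (fun z => z.2.2.2.2.2 z.1) := by
  refine ⟨mix_mem hn (κ.law_mem hq), fun i hi => ?_, fun i hi => ?_, ?_, ?_⟩
  · by_cases h0 : i.val = 0
    · refine (κ.markov_first hq i h0).congr (fun _ _ _ _ => Iff.rfl) (fun z z' _ _ => ?_)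
        (fun _ _ _ _ => Iff.rfl)
      have : ∀ j : Set.Iio i, False := fun j => by
        have := Fin.lt_def.1 j.2
        omega
      simp only [Prod.mk.injEq]
      exact ⟨fun h => ⟨funext fun j => (this j).elim, h⟩, fun h => h.2⟩
    · have h := MarkovChain.mix fun t : Fin n => ((κ.markov_odd hq i hi (· ≤ t) (t < ·)
        fun s => le_or_gt s t).map_left fun a => a.1).map_right fun x => x t
      refine h.congr (fun z z' _ _ => by simp [Code.aux, h0]) (fun z z' _ _ => ?_)
        (fun _ _ _ _ => Iff.rfl)
      simp only [Prod.mk.injEq, κ.aux_past_eq_iff i h0]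
      constructor
      · rintro ⟨h1, h2, h3, h4⟩
        rw [← h1] at h3 h4 ⊢
        rw [mask_le_iff] at h3
        exact ⟨⟨rfl, h2, h3.1, h4⟩, h3.2⟩
      · rintro ⟨⟨h1, h2, h3, h4⟩, h5⟩
        rw [← h1] at h5 ⊢
        exact ⟨rfl, h2, (mask_le_iff _ _ _).2 ⟨h3, h5⟩, h4⟩
  · have h0 : i.val ≠ 0 := fun h0 => by simp [h0] at hi
    have h := MarkovChain.mix fun t : Fin n => ((κ.markov_even hq i hi (· < t) (t ≤ ·)
      fun s => lt_or_ge s t).map_left fun a => a.1).map_right fun x => x t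
    refine h.congr (fun z z' _ _ => by simp [Code.aux, h0]) (fun z z' _ _ => ?_)
      (fun _ _ _ _ => Iff.rfl)
    simp only [Prod.mk.injEq, κ.aux_past_eq_iff i h0]
    constructor
    · rintro ⟨h1, h2, h3, h4⟩
      rw [← h1] at h3 h4 ⊢
      rw [mask_ge_iff] at h4
      exact ⟨⟨rfl, h2, h3, h4.1⟩, h4.2⟩
    · rintro ⟨⟨h1, h2, h3, h4⟩, h5⟩
      rw [← h1] at h5 ⊢
      exact ⟨rfl, h2, h3, (mask_ge_iff _ _ _).2 ⟨h4, h5⟩⟩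
  · have h := MarkovChain.mix fun t : Fin n => ((κ.markov_out (q := q) (· ≤ t) (t < ·)
      fun s => le_or_gt s t).map_left fun a => a.2 t).map_right fun a => (a.1 t, a.2 t)
    refine h.congr (fun _ _ _ _ => Iff.rfl) (fun z z' _ _ => ?_) (fun _ _ _ _ => Iff.rfl)
    simp only [Prod.mk.injEq, κ.aux_eq_iff hr]
    constructor
    · rintro ⟨h1, h2, h3, h4⟩
      rw [← h1] at h3 h4 ⊢
      rw [mask_le_iff] at h3
      exact ⟨⟨rfl, h2, h3.1, h4⟩, h3.2⟩
    · rintro ⟨⟨h1, h2, h3, h4⟩, h5⟩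
      rw [← h1] at h5 ⊢
      exact ⟨rfl, h2, (mask_le_iff _ _ _).2 ⟨h3, h5⟩, h4⟩
  · have h := MarkovChain.mix fun t : Fin n => ((κ.markov_out (q := q) (· < t) (t ≤ ·)
      fun s => lt_or_ge s t).symm.map_left fun a => a.2 t).map_right fun a => (a.1 t, a.2 t)
    refine h.congr (fun _ _ _ _ => Iff.rfl) (fun z z' _ _ => ?_) (fun _ _ _ _ => Iff.rfl)
    simp only [Prod.mk.injEq, κ.aux_eq_iff hr]
    constructor
    · rintro ⟨h1, h2, h3, h4⟩
      rw [← h1] at h3 h4 ⊢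
      rw [mask_ge_iff] at h4
      exact ⟨⟨rfl, h2, h3, h4.1⟩, h4.2⟩
    · rintro ⟨⟨h1, h2, h3, h4⟩, h5⟩
      rw [← h1] at h5 ⊢
      exact ⟨rfl, h2, h3, (mask_ge_iff _ _ _).2 ⟨h4, h5⟩⟩

lemma Code.lawOf_source (hq : q ∈ stdSimplex ℝ (X₁ × X₂)) :
    lawOf (κ.law q) (fun ω t => (ω.1 t, ω.2.1 t)) = iid q n := by
  funext z
  obtain ⟨ext, -, hlaw⟩ := κ.exists_lawOf_prefixOf hq 0 (by omega)
  have h := hlaw (fun t => (z t).1, fun t => (z t).2, fun j => absurd j.2 (by omega))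
  simp only [not_lt_zero, Finset.filter_false, Finset.prod_empty, mul_one] at h
  refine Eq.trans (lawOf_congr fun ω _ => ?_) h
  simp only [Code.prefixOf, funext_iff, Prod.ext_iff]
  exact ⟨fun h => ⟨fun t => (h t).1, fun t => (h t).2, fun j => absurd j.2 (by omega)⟩,
    fun h t => ⟨h.1 t, h.2.1 t⟩⟩

lemma Code.logLaw_source {β : Type*} (hq : q ∈ stdSimplex ℝ (X₁ × X₂)) (f : X₁ × X₂ → β) :
    logLaw (κ.law q) (fun ω t => f (ω.1 t, ω.2.1 t)) = n * logLaw q f := by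
  rw [← logLaw_iid hq, ← κ.lawOf_source hq, logLaw_lawOf]

lemma Code.lawOf_mix_source (hn : n ≠ 0) (hq : q ∈ stdSimplex ℝ (X₁ × X₂)) :
    lawOf (mix n (κ.law q)) (fun z => (z.2.1 z.1, z.2.2.1 z.1)) = q := by
  funext a
  have h : ∀ t, lawOf (κ.law q) (fun ω => (ω.1 t, ω.2.1 t)) a = q a := by
    intro t
    have e : lawOf (κ.law q) (fun ω => (ω.1 t, ω.2.1 t)) =
        lawOf (iid q n) (fun z => z t) := by
      rw [← κ.lawOf_source hq, lawOf_lawOf]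
    rw [e]
    have := sum_iid_mul_apply hq.2 t fun b => if b = a then 1 else 0
    simp only [mul_ite, mul_one, mul_zero, Finset.sum_ite_eq', Finset.mem_univ, if_true] at this
    rw [← this]
    refine Finset.sum_congr rfl fun z _ => ?_
    by_cases hz : z t = a <;> simp [hz]
  rw [lawOf_mix_eq_avg fun t (ω : κ.Outcome) => (ω.1 t, ω.2.1 t)]
  simp [h, hn]

/-- The source terms agree exactly, `H(X_1^n | X_2^n) = n H(X_1 | X_2)`, because the source is
i.i.d.; the rest is `sum_le_logLaw_sub_fst`. -/
lemma Code.natsInfo_aux_fst_le (hr : 1 ≤ r) (hn : n ≠ 0) (hq : q ∈ stdSimplex ℝ (X₁ × X₂)) :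
    n * natsInfo (mix n (κ.law q)) (fun z => z.2.1 z.1) (fun z i => κ.aux i z)
      (fun z => z.2.2.1 z.1) ≤
      natsInfo (κ.law q) (fun ω => ω.1) (fun ω i => ω.2.2.1 i) (fun ω => ω.2.1) := by
  have hp := κ.law_mem hq
  have h1 := sum_le_logLaw_sub_fst hp (fun ω => ω.2.2.1) (fun ω => ω.1) (fun ω => ω.2.1)
  have e₁ : logLaw (mix n (κ.law q)) (fun z => (z.2.1 z.1, (fun i => κ.aux i z), z.2.2.1 z.1)) =
      logLaw (mix n (κ.law q)) (fun z => (z.1, z.2.1 z.1,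
        (z.2.2.2.1, mask (· < z.1) z.2.1, mask (z.1 < ·) z.2.2.1), z.2.2.1 z.1)) := by
    refine logLaw_congr fun z z' _ _ => ?_
    simp only [Prod.mk.injEq, κ.aux_eq_iff hr]
    constructor
    · rintro ⟨h1, ⟨h2, h3, h4, h5⟩, h6⟩
      exact ⟨h2, h1, ⟨h3, by rw [← h2, h4], by rw [← h2, h5]⟩, h6⟩
    · rintro ⟨h2, h1, ⟨h3, h4, h5⟩, h6⟩
      exact ⟨h1, ⟨h2, h3, by rw [h4, h2], by rw [h5, h2]⟩, h6⟩
  have e₂ : logLaw (mix n (κ.law q)) (fun z => ((fun i => κ.aux i z), z.2.2.1 z.1)) =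
      logLaw (mix n (κ.law q)) (fun z => (z.1,
        (z.2.2.2.1, mask (· < z.1) z.2.1, mask (z.1 < ·) z.2.2.1), z.2.2.1 z.1)) := by
    refine logLaw_congr fun z z' _ _ => ?_
    simp only [Prod.mk.injEq, κ.aux_eq_iff hr]
    constructor
    · rintro ⟨⟨h2, h3, h4, h5⟩, h6⟩
      exact ⟨h2, ⟨h3, by rw [← h2, h4], by rw [← h2, h5]⟩, h6⟩
    · rintro ⟨h2, ⟨h3, h4, h5⟩, h6⟩
      exact ⟨⟨h2, h3, by rw [h4, h2], by rw [h5, h2]⟩, h6⟩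
  rw [logLaw_mix hn hp fun t ω => (ω.1 t,
    (ω.2.2.1, mask (· < t) ω.1, mask (t < ·) ω.2.1), ω.2.1 t)] at e₁
  rw [logLaw_mix hn hp fun t ω => (
    (ω.2.2.1, mask (· < t) ω.1, mask (t < ·) ω.2.1), ω.2.1 t)] at e₂
  have e₃ : logLaw (mix n (κ.law q)) (fun z => z.2.2.1 z.1) = logLaw q Prod.snd := by
    rw [← κ.lawOf_mix_source hn hq, logLaw_lawOf, κ.lawOf_mix_source hn hq]
  have e₄ : logLaw (mix n (κ.law q)) (fun z => (z.2.1 z.1, z.2.2.1 z.1)) = logLaw q id := by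
    rw [← κ.lawOf_mix_source hn hq, logLaw_lawOf, κ.lawOf_mix_source hn hq]
    rfl
  have e₅ : logLaw (κ.law q) (fun ω => ω.2.1) = n * logLaw q Prod.snd := κ.logLaw_source hq Prod.snd
  have e₆ : logLaw (κ.law q) (fun ω => (ω.1, ω.2.1)) = n * logLaw q id := by
    rw [← κ.logLaw_source hq id]
    refine logLaw_congr fun ω ω' _ _ => ?_
    simp only [Prod.mk.injEq, funext_iff, id, forall_and]
  simp only [natsInfo, e₁, e₂, e₃, e₄, e₅, e₆]
  rw [Finset.sum_sub_distrib] at h1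
  have hn' : (n : ℝ) ≠ 0 := Nat.cast_ne_zero.2 hn
  field_simp
  linarith

lemma Code.natsInfo_aux_snd_le (hr : 1 ≤ r) (hn : n ≠ 0) (hq : q ∈ stdSimplex ℝ (X₁ × X₂)) :
    n * natsInfo (mix n (κ.law q)) (fun z => z.2.2.1 z.1) (fun z i => κ.aux i z)
      (fun z => z.2.1 z.1) ≤
      natsInfo (κ.law q) (fun ω => ω.2.1) (fun ω i => ω.2.2.1 i) (fun ω => ω.1) := by
  have hp := κ.law_mem hq
  have h1 := sum_le_logLaw_sub_snd hp (fun ω => ω.2.2.1) (fun ω => ω.1) (fun ω => ω.2.1)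
  have e₁ : logLaw (mix n (κ.law q)) (fun z => (z.2.2.1 z.1, (fun i => κ.aux i z), z.2.1 z.1)) =
      logLaw (mix n (κ.law q)) (fun z => (z.1, z.2.2.1 z.1,
        (z.2.2.2.1, mask (· < z.1) z.2.1, mask (z.1 < ·) z.2.2.1), z.2.1 z.1)) := by
    refine logLaw_congr fun z z' _ _ => ?_
    simp only [Prod.mk.injEq, κ.aux_eq_iff hr]
    constructor
    · rintro ⟨h1, ⟨h2, h3, h4, h5⟩, h6⟩
      exact ⟨h2, h1, ⟨h3, by rw [← h2, h4], by rw [← h2, h5]⟩, h6⟩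
    · rintro ⟨h2, h1, ⟨h3, h4, h5⟩, h6⟩
      exact ⟨h1, ⟨h2, h3, by rw [h4, h2], by rw [h5, h2]⟩, h6⟩
  have e₂ : logLaw (mix n (κ.law q)) (fun z => ((fun i => κ.aux i z), z.2.1 z.1)) =
      logLaw (mix n (κ.law q)) (fun z => (z.1,
        (z.2.2.2.1, mask (· < z.1) z.2.1, mask (z.1 < ·) z.2.2.1), z.2.1 z.1)) := by
    refine logLaw_congr fun z z' _ _ => ?_
    simp only [Prod.mk.injEq, κ.aux_eq_iff hr]
    constructor
    · rintro ⟨⟨h2, h3, h4, h5⟩, h6⟩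
      exact ⟨h2, ⟨h3, by rw [← h2, h4], by rw [← h2, h5]⟩, h6⟩
    · rintro ⟨h2, ⟨h3, h4, h5⟩, h6⟩
      exact ⟨⟨h2, h3, by rw [h4, h2], by rw [h5, h2]⟩, h6⟩
  rw [logLaw_mix hn hp fun t ω => (ω.2.1 t,
    (ω.2.2.1, mask (· < t) ω.1, mask (t < ·) ω.2.1), ω.1 t)] at e₁
  rw [logLaw_mix hn hp fun t ω => (
    (ω.2.2.1, mask (· < t) ω.1, mask (t < ·) ω.2.1), ω.1 t)] at e₂
  have e₃ : logLaw (mix n (κ.law q)) (fun z => z.2.1 z.1) = logLaw q Prod.fst := by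
    rw [← κ.lawOf_mix_source hn hq, logLaw_lawOf, κ.lawOf_mix_source hn hq]
  have e₄ : logLaw (mix n (κ.law q)) (fun z => (z.2.2.1 z.1, z.2.1 z.1)) = logLaw q Prod.swap := by
    rw [← κ.lawOf_mix_source hn hq, logLaw_lawOf, κ.lawOf_mix_source hn hq]
    rfl
  have e₅ : logLaw (κ.law q) (fun ω => ω.1) = n * logLaw q Prod.fst := κ.logLaw_source hq Prod.fst
  have e₆ : logLaw (κ.law q) (fun ω => (ω.2.1, ω.1)) = n * logLaw q Prod.swap := by
    rw [← κ.logLaw_source hq Prod.swap]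
    refine logLaw_congr fun ω ω' _ _ => ?_
    simp only [Prod.mk.injEq, funext_iff, Prod.swap, forall_and]
  simp only [natsInfo, e₁, e₂, e₃, e₄, e₅, e₆]
  rw [Finset.sum_sub_distrib] at h1
  have hn' : (n : ℝ) ≠ 0 := Nat.cast_ne_zero.2 hn
  field_simp
  linarith

/-- To an observer of `X_2^n` the even rounds are uninformative: this is `Code.markov_even` with the
second source fully revealed and the first not at all. Only the entropies of the odd messages are
paid. -/
lemma Code.natsInfo_fst_le (hq : q ∈ stdSimplex ℝ (X₁ × X₂)) :
    natsInfo (κ.law q) (fun ω => ω.1) (fun ω i => ω.2.2.1 i) (fun ω => ω.2.1) ≤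
      Real.log 2 * ∑ i with Odd (i.val + 1), κ.msgEntropy q i := by
  refine (natsInfo_le_sum_entropy (κ.law_mem hq) (fun i ω => ω.2.2.1 i) (fun ω => ω.1)
    (fun ω => ω.2.1) (fun i => Odd (i.val + 1)) fun i hi => ?_).trans (le_of_eq ?_)
  · refine ((κ.markov_even hq i (Nat.not_odd_iff_even.1 hi) (fun _ => False) (fun _ => True)
      fun _ => Or.inr trivial).map_left fun a => a.1).congr (fun _ _ _ _ => Iff.rfl)
      (fun ω ω' _ _ => ?_) (fun _ _ _ _ => Iff.rfl)
    simp only [Prod.mk.injEq, mask_eq_iff]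
    simp [funext_iff]
  · have h2 : Real.log 2 ≠ 0 := (Real.log_pos (by norm_num)).ne'
    rw [Finset.mul_sum]
    refine Finset.sum_congr (by ext; simp) fun i _ => ?_
    rw [Code.msgEntropy, entropy_eq, mul_div_cancel₀ _ h2]

lemma Code.natsInfo_snd_le (hq : q ∈ stdSimplex ℝ (X₁ × X₂)) :
    natsInfo (κ.law q) (fun ω => ω.2.1) (fun ω i => ω.2.2.1 i) (fun ω => ω.1) ≤
      Real.log 2 * ∑ i with Even (i.val + 1), κ.msgEntropy q i := by
  refine (natsInfo_le_sum_entropy (κ.law_mem hq) (fun i ω => ω.2.2.1 i) (fun ω => ω.2.1)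
    (fun ω => ω.1) (fun i => Even (i.val + 1)) fun i hi => ?_).trans (le_of_eq ?_)
  · refine ((κ.markov_odd hq i (Nat.not_even_iff_odd.1 hi) (fun _ => True) (fun _ => False)
      fun _ => Or.inl trivial).map_left fun a => a.1).congr (fun _ _ _ _ => Iff.rfl)
      (fun ω ω' _ _ => ?_) (fun _ _ _ _ => Iff.rfl)
    simp only [Prod.mk.injEq, mask_eq_iff]
    simp [funext_iff]
  · have h2 : Real.log 2 ≠ 0 := (Real.log_pos (by norm_num)).ne'
    rw [Finset.mul_sum]
    refine Finset.sum_congr (by ext; simp) fun i _ => ?_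
    rw [Code.msgEntropy, entropy_eq, mul_div_cancel₀ _ h2]

end SingleLetter

/-! ### Converse -/

section Converse

open scoped Classical

variable {X₁ X₂ Y₁ Y₂ : Type*} [Fintype X₁] [Fintype X₂] [Fintype Y₁] [Fintype Y₂] {r n : ℕ}

lemma target_mem {q : X₁ × X₂ → ℝ} (hq : q ∈ stdSimplex ℝ (X₁ × X₂))
    {W : X₁ × X₂ → Y₁ × Y₂ → ℝ} (hW : ∀ x, W x ∈ stdSimplex ℝ (Y₁ × Y₂)) :
    target q W ∈ stdSimplex ℝ (X₁ × X₂ × Y₁ × Y₂) := by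
  refine ⟨fun z => mul_nonneg (hq.1 _) ((hW _).1 _), ?_⟩
  rw [← hq.2, Fintype.sum_prod_type, Fintype.sum_prod_type]
  refine Finset.sum_congr rfl fun x₁ _ => ?_
  rw [Fintype.sum_prod_type]
  refine Finset.sum_congr rfl fun x₂ _ => ?_
  simp only [target, ← Finset.mul_sum]
  rw [show ∑ y : Y₁ × Y₂, W (x₁, x₂) (y.1, y.2) = 1 from (hW (x₁, x₂)).2, mul_one]

lemma le_one_of_mem_stdSimplex {α : Type*} [Fintype α] {p : α → ℝ} (hp : p ∈ stdSimplex ℝ α)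
    (a : α) : p a ≤ 1 := by
  rw [← hp.2]
  exact Finset.single_le_sum (fun a _ => hp.1 a) (Finset.mem_univ a)

lemma empirical_nonneg {α : Type*} (z : Fin n → α) (a : α) : 0 ≤ empirical z a := by
  unfold empirical
  positivity

lemma empirical_eq_sum {α : Type*} (z : Fin n → α) (a : α) :
    empirical z a = 1 / (n : ℝ) * ∑ t, if z t = a then 1 else 0 := by
  simp [empirical, div_eq_inv_mul]

lemma empirical_mem {α : Type*} [Fintype α] (hn : n ≠ 0) (z : Fin n → α) :
    empirical z ∈ stdSimplex ℝ α := by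
  refine ⟨empirical_nonneg z, ?_⟩
  simp only [empirical_eq_sum, ← Finset.mul_sum]
  rw [Finset.sum_comm]
  simp [hn]

/-- The law of a random letter of a code is close to the target as soon as the bad event is
unlikely. -/
lemma Code.abs_lawOf_letter_sub_target_le (κ : Code X₁ X₂ Y₁ Y₂ r n) (hn : n ≠ 0)
    {q : X₁ × X₂ → ℝ} (hq : q ∈ stdSimplex ℝ (X₁ × X₂)) {W : X₁ × X₂ → Y₁ × Y₂ → ℝ}
    (hW : ∀ x, W x ∈ stdSimplex ℝ (Y₁ × Y₂)) {ε : ℝ} (hε : 0 ≤ ε) (a : X₁ × X₂ × Y₁ × Y₂) :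
    |lawOf (mix n (κ.law q)) (fun z => (z.2.1 z.1, z.2.2.1 z.1, z.2.2.2.2.1 z.1,
      z.2.2.2.2.2 z.1)) a - target q W a| ≤ 2 * ε + prob (κ.law q) (κ.badEvent q W ε) := by
  have hp := κ.law_mem hq
  let emp : κ.Outcome → X₁ × X₂ × Y₁ × Y₂ → ℝ := fun ω =>
    empirical fun t => (ω.1 t, ω.2.1 t, ω.2.2.2.1 t, ω.2.2.2.2 t)
  -- The law of the letter at a uniform time is the mean of the empirical distribution. Off the bad
  -- event its entries err by at most `2ε`, and on it by at most 1.
  have e : lawOf (mix n (κ.law q)) (fun z => (z.2.1 z.1, z.2.2.1 z.1, z.2.2.2.2.1 z.1,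
      z.2.2.2.2.2 z.1)) a - target q W a = ∑ ω, κ.law q ω * (emp ω a - target q W a) := by
    simp only [mul_sub, Finset.sum_sub_distrib, ← Finset.sum_mul, hp.2, one_mul]
    congr 1
    rw [lawOf_mix_eq_avg fun t (ω : κ.Outcome) => (ω.1 t, ω.2.1 t, ω.2.2.2.1 t, ω.2.2.2.2 t)]
    simp only [emp, empirical_eq_sum, lawOf]
    rw [Finset.sum_comm, Finset.mul_sum]
    refine Finset.sum_congr rfl fun ω _ => ?_
    rw [Finset.mul_sum, Finset.mul_sum, Finset.mul_sum]
    refine Finset.sum_congr rfl fun t _ => ?_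
    split_ifs <;> ring
  rw [e]
  have hb : ∀ ω, |κ.law q ω * (emp ω a - target q W a)| ≤
      κ.law q ω * (2 * ε) + if ω ∈ κ.badEvent q W ε then κ.law q ω else 0 := by
    intro ω
    rw [abs_mul, abs_of_nonneg (hp.1 ω)]
    split_ifs with hω
    · have h1 := le_one_of_mem_stdSimplex (empirical_mem hn
        fun t => (ω.1 t, ω.2.1 t, ω.2.2.2.1 t, ω.2.2.2.2 t)) a
      have h2 := empirical_nonneg (fun t => (ω.1 t, ω.2.1 t, ω.2.2.2.1 t, ω.2.2.2.2 t)) a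
      have h3 := le_one_of_mem_stdSimplex (target_mem hq hW) a
      have h4 := (target_mem hq hW).1 a
      have h5 : |emp ω a - target q W a| ≤ 1 := by
        rw [abs_le]
        constructor <;> simp only [emp] <;> linarith
      nlinarith [hp.1 ω, mul_nonneg (hp.1 ω) hε]
    · have h1 : tvDist (emp ω) (target q W) ≤ ε := not_lt.1 hω
      have h2 : |emp ω a - target q W a| ≤ 2 * tvDist (emp ω) (target q W) := by
        simp only [tvDist]
        rw [← mul_assoc]
        norm_num
        exact Finset.single_le_sum (f := fun a => |emp ω a - target q W a|)
          (fun _ _ => abs_nonneg _) (Finset.mem_univ a)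
      nlinarith [hp.1 ω]
  refine (Finset.abs_sum_le_sum_abs _ _).trans ((Finset.sum_le_sum fun ω _ => hb ω).trans ?_)
  rw [Finset.sum_add_distrib, ← Finset.sum_mul, hp.2, one_mul]
  rfl

lemma Achievable.exists_isAux {q : X₁ × X₂ → ℝ} (hq : q ∈ stdSimplex ℝ (X₁ × X₂))
    {W : X₁ × X₂ → Y₁ × Y₂ → ℝ} (hW : ∀ x, W x ∈ stdSimplex ℝ (Y₁ × Y₂)) (hr : 1 ≤ r) {R₁ R₂ : ℝ}
    (h : Achievable r q W R₁ R₂) {ε : ℝ} (hε : 0 < ε) :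
    ∃ (k : Fin r → ℕ) (p : AuxOutcome X₁ X₂ Y₁ Y₂ k → ℝ),
      CardBound (Fintype.card X₁ * Fintype.card X₂ * Fintype.card Y₁ * Fintype.card Y₂) k ∧
      IsAux p (fun i ω => rvF ω i) rvX₁ rvX₂ rvY₁ rvY₂ ∧
      (∀ z, |lawOf p (fun ω => (rvX₁ ω, rvX₂ ω, rvY₁ ω, rvY₂ ω)) z - target q W z| ≤ ε) ∧
      condMutualInfo p rvX₁ rvF rvX₂ ≤ R₁ ∧ condMutualInfo p rvX₂ rvF rvX₁ ≤ R₂ := by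
  obtain ⟨κ, hrate, hbad⟩ := h
  -- Tolerance `ε / 4` and failure probability below `ε / 2` give a total error of at most `2 · ε /
  -- 4 + ε / 2 = ε`.
  have hev := (hbad (ε / 4) (by positivity)).eventually (gt_mem_nhds (half_pos hε))
  obtain ⟨n, hn, hn1⟩ := (hev.and (eventually_ge_atTop 1)).exists
  have hn0 : n ≠ 0 := by omega
  obtain ⟨k, p, h1, h2, h3, h4, h5⟩ := ((κ n).isAux hr hn0 hq).exists_card_le
  refine ⟨k, p, h1, h2, fun z => ?_, ?_, ?_⟩
  · rw [h3]
    have := (κ n).abs_lawOf_letter_sub_target_le hn0 hq hW (ε := ε / 4) (by positivity) z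
    linarith
  · rw [condMutualInfo_eq_natsInfo, h4, div_le_iff₀ (Real.log_pos (by norm_num))]
    have g1 := (κ n).natsInfo_aux_fst_le hr hn0 hq
    have g2 := (κ n).natsInfo_fst_le hq
    have g3 := (hrate n hn1).1
    have hn' : (0 : ℝ) < n := by exact_mod_cast hn1
    rw [div_mul_eq_mul_div, one_mul, div_le_iff₀ hn'] at g3
    refine le_of_mul_le_mul_left ?_ hn'
    have hl : (0 : ℝ) < Real.log 2 := Real.log_pos (by norm_num)
    nlinarith
  · rw [condMutualInfo_eq_natsInfo, h5, div_le_iff₀ (Real.log_pos (by norm_num))]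
    have g1 := (κ n).natsInfo_aux_snd_le hr hn0 hq
    have g2 := (κ n).natsInfo_snd_le hq
    have g3 := (hrate n hn1).2
    have hn' : (0 : ℝ) < n := by exact_mod_cast hn1
    rw [div_mul_eq_mul_div, one_mul, div_le_iff₀ hn'] at g3
    refine le_of_mul_le_mul_left ?_ hn'
    have hl : (0 : ℝ) < Real.log 2 := Real.log_pos (by norm_num)
    nlinarith

lemma Code.msgEntropy_nonneg (κ : Code X₁ X₂ Y₁ Y₂ r n) {q : X₁ × X₂ → ℝ}
    (hq : q ∈ stdSimplex ℝ (X₁ × X₂)) (i : Fin r) : 0 ≤ κ.msgEntropy q i := by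
  rw [Code.msgEntropy, entropy_eq]
  exact div_nonneg (neg_nonneg.2 (logLaw_nonpos (κ.law_mem hq) _)) (Real.log_nonneg (by norm_num))

lemma Achievable.nonneg {q : X₁ × X₂ → ℝ} (hq : q ∈ stdSimplex ℝ (X₁ × X₂))
    {W : X₁ × X₂ → Y₁ × Y₂ → ℝ} {R₁ R₂ : ℝ} (h : Achievable r q W R₁ R₂) : 0 ≤ R₁ ∧ 0 ≤ R₂ := by
  obtain ⟨κ, hrate, -⟩ := h
  obtain ⟨h1, h2⟩ := hrate 1 le_rfl
  exact ⟨(mul_nonneg (by positivity) (Finset.sum_nonneg fun i _ =>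
    (κ 1).msgEntropy_nonneg hq i)).trans h1, (mul_nonneg (by positivity)
    (Finset.sum_nonneg fun i _ => (κ 1).msgEntropy_nonneg hq i)).trans h2⟩

/-- The closure and the vanishing error are handled by one limit: the `m`-th achievable pair of a
sequence converging to `R` is used with error `1 / (m + 1)`. -/
theorem exists_memT_of_mem_rateRegion {q : X₁ × X₂ → ℝ} (hq : q ∈ stdSimplex ℝ (X₁ × X₂))
    {W : X₁ × X₂ → Y₁ × Y₂ → ℝ} (hW : ∀ x, W x ∈ stdSimplex ℝ (Y₁ × Y₂)) (hr : 1 ≤ r) {R : ℝ × ℝ}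
    (hR : R ∈ rateRegion r q W) :
    0 ≤ R.1 ∧ 0 ≤ R.2 ∧ ∃ (k : Fin r → ℕ) (p : AuxOutcome X₁ X₂ Y₁ Y₂ k → ℝ), MemT q W p ∧
      condMutualInfo p rvX₁ rvF rvX₂ ≤ R.1 ∧ condMutualInfo p rvX₂ rvF rvX₁ ≤ R.2 := by
  obtain ⟨u, hu, hlim⟩ := mem_closure_iff_seq_limit.1 hR
  have h1 : Tendsto (fun m => (u m).1) atTop (𝓝 R.1) := (continuous_fst.tendsto R).comp hlim
  have h2 : Tendsto (fun m => (u m).2) atTop (𝓝 R.2) := (continuous_snd.tendsto R).comp hlim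
  refine ⟨ge_of_tendsto' h1 fun m => (Achievable.nonneg hq (hu m)).1,
    ge_of_tendsto' h2 fun m => (Achievable.nonneg hq (hu m)).2,
    exists_memT_of_approx q W _ _ h1 h2 fun m => ?_⟩
  exact Achievable.exists_isAux hq hW hr (hu m) (by positivity)

end Converse

/-! ### Probabilities of events -/

section Prob

open scoped Classical

variable {Ω : Type*} [Fintype Ω] {p : Ω → ℝ}

lemma prob_nonneg (hp : ∀ ω, 0 ≤ p ω) (E : Set Ω) : 0 ≤ prob p E :=
  Finset.sum_nonneg fun ω _ => by split_ifs <;> simp [hp ω]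

lemma prob_mono (hp : ∀ ω, 0 ≤ p ω) {E E' : Set Ω} (h : E ⊆ E') : prob p E ≤ prob p E' := by
  refine Finset.sum_le_sum fun ω _ => ?_
  by_cases h1 : ω ∈ E
  · simp [h1, h h1]
  · rw [if_neg h1]
    split_ifs <;> simp [hp ω]

lemma lawOf_eq_prob {α : Type*} (p : Ω → ℝ) (A : Ω → α) (a : α) :
    lawOf p A a = prob p {ω | A ω = a} := rfl

lemma prob_inter_add_prob_diff (p : Ω → ℝ) (E E' : Set Ω) :
    prob p (E ∩ E') + prob p (E \ E') = prob p E := by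
  simp only [prob, ← Finset.sum_add_distrib]
  refine Finset.sum_congr rfl fun ω _ => ?_
  by_cases h1 : ω ∈ E <;> by_cases h2 : ω ∈ E' <;> simp [h1, h2]

end Prob

/-! ### Coupling by exponential races -/

section Race

open scoped Classical
open MeasureTheory

lemma lintegral_exp_Ioi {b : ℝ} (hb : 0 < b) (a : ℝ) :
    ∫⁻ x in Set.Ioi a, ENNReal.ofReal (Real.exp (-b * x)) =
      ENNReal.ofReal (Real.exp (-b * a) / b) := by
  rw [← ofReal_integral_eq_lintegral_ofReal (integrableOn_exp_mul_Ioi (by linarith) a)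
    (Eventually.of_forall fun x => (Real.exp_pos _).le), integral_exp_mul_Ioi (by linarith)]
  congr 1
  field_simp

/-- The standard exponential law. -/
def stdExp : Measure ℝ :=
  (volume.restrict (Set.Ioi 0)).withDensity fun x => ENNReal.ofReal (Real.exp (-x))

lemma stdExp_Ioi {a : ℝ} (ha : 0 ≤ a) : stdExp (Set.Ioi a) = ENNReal.ofReal (Real.exp (-a)) := by
  rw [stdExp, withDensity_apply _ measurableSet_Ioi, Measure.restrict_restrict measurableSet_Ioi,
    Set.inter_eq_left.2 (Set.Ioi_subset_Ioi ha)]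
  simpa using lintegral_exp_Ioi one_pos a

instance : IsProbabilityMeasure stdExp := by
  constructor
  rw [stdExp, withDensity_apply _ MeasurableSet.univ, Measure.restrict_univ]
  simpa using lintegral_exp_Ioi one_pos 0

lemma lintegral_stdExp {M : ℝ} (hM : 0 ≤ M) :
    ∫⁻ s, (if 0 < s then ENNReal.ofReal (Real.exp (-M * s)) else 0) ∂stdExp =
      ENNReal.ofReal (1 / (1 + M)) := by
  rw [stdExp, lintegral_withDensity_eq_lintegral_mul _ (by fun_prop)
    (Measurable.ite measurableSet_Ioi (by fun_prop) (by fun_prop))]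
  have h := lintegral_exp_Ioi (b := 1 + M) (by linarith) 0
  simp only [mul_zero, Real.exp_zero] at h
  rw [← h]
  refine setLIntegral_congr_fun measurableSet_Ioi fun s hs => ?_
  simp only [Pi.mul_apply, if_pos (Set.mem_Ioi.1 hs)]
  rw [← ENNReal.ofReal_mul (Real.exp_pos _).le, ← Real.exp_add]
  ring_nf

/-- The probability that competitor `i` wins an exponential race with handicaps `m`. -/
lemma measure_race {N : ℕ} (i : Fin (N + 1)) (m : Fin N → ℝ) (hm : ∀ j, 0 ≤ m j) :
    (Measure.pi fun _ : Fin (N + 1) => stdExp)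
      {S | 0 < S i ∧ ∀ j, m j * S i < S (i.succAbove j)} =
      ENNReal.ofReal (1 / (1 + ∑ j, m j)) := by
  have hmp := measurePreserving_piFinSuccAbove (fun _ : Fin (N + 1) => stdExp) i
  let D : Set (ℝ × (Fin N → ℝ)) := {z | 0 < z.1 ∧ ∀ j, m j * z.1 < z.2 j}
  have hD : MeasurableSet D := by
    have : D = {z | 0 < z.1} ∩ ⋂ j, {z : ℝ × (Fin N → ℝ) | m j * z.1 < z.2 j} := by
      ext z
      simp [D]
    rw [this]
    exact (measurableSet_lt measurable_const measurable_fst).inter (MeasurableSet.iInter fun j =>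
      measurableSet_lt (by fun_prop) (by fun_prop))
  have he : {S : Fin (N + 1) → ℝ | 0 < S i ∧ ∀ j, m j * S i < S (i.succAbove j)} =
      MeasurableEquiv.piFinSuccAbove (fun _ => ℝ) i ⁻¹' D := rfl
  -- Fubini: given `S i = s`, the rivals clear their thresholds independently, with total
  -- probability `exp (-s ∑ m j)`, and this is integrated against the exponential law.
  rw [he, hmp.measure_preimage hD.nullMeasurableSet, Measure.prod_apply hD,
    ← lintegral_stdExp (Finset.sum_nonneg fun j _ => hm j)]
  refine lintegral_congr fun s => ?_
  by_cases hs : 0 < s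
  · have hpre : Prod.mk s ⁻¹' D = Set.pi Set.univ fun j => Set.Ioi (m j * s) := by
      ext T
      simp [D, hs]
    rw [hpre, Measure.pi_pi, if_pos hs]
    simp only [stdExp_Ioi (mul_nonneg (hm _) hs.le)]
    rw [← ENNReal.ofReal_prod_of_nonneg fun j _ => (Real.exp_pos _).le, ← Real.exp_sum]
    congr 2
    rw [Finset.sum_neg_distrib, ← Finset.sum_mul]
    ring
  · have hpre : Prod.mk s ⁻¹' D = ∅ := by
      ext T
      simp [D, hs]
    rw [hpre, measure_empty, if_neg hs]

lemma measureReal_race {U : Type*} [Fintype U] {N : ℕ} (e : U ≃ Fin (N + 1)) (u : U) (m : U → ℝ)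
    (hm : ∀ v, 0 ≤ m v) :
    (Measure.pi fun _ : Fin (N + 1) => stdExp).real
      {S | 0 < S (e u) ∧ ∀ v ≠ u, m v * S (e u) < S (e v)} =
      1 / (1 + (∑ v, m v - m u)) := by
  have h := measure_race (e u) (fun j => m (e.symm ((e u).succAbove j))) fun j => hm _
  have hset : {S : Fin (N + 1) → ℝ | 0 < S (e u) ∧ ∀ v ≠ u, m v * S (e u) < S (e v)} =
      {S | 0 < S (e u) ∧ ∀ j, m (e.symm ((e u).succAbove j)) * S (e u) <
        S ((e u).succAbove j)} := by
    ext S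
    refine and_congr_right fun _ => ⟨fun hS j => ?_, fun hS v hv => ?_⟩
    · have := hS (e.symm ((e u).succAbove j)) fun h0 =>
        Fin.succAbove_ne (e u) j (e.symm_apply_eq.1 h0)
      simpa using this
    · obtain ⟨j, hj⟩ := Fin.exists_succAbove_eq (x := e v) (y := e u) (by simpa using hv)
      have := hS j
      simpa [hj] using this
  have hsum : ∑ v, m v - m u = ∑ j, m (e.symm ((e u).succAbove j)) := by
    rw [← Equiv.sum_comp e.symm, Fin.sum_univ_succAbove _ (e u)]
    simp
  rw [hset, hsum, Measure.real, h, ENNReal.toReal_ofReal]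
  have hnn : 0 ≤ ∑ j, m (e.symm ((e u).succAbove j)) := Finset.sum_nonneg fun j _ => hm _
  positivity

/-- A joint sampling of finitely many mass functions such that a sample of `p θ` agrees with the
sample of `p θ'` with high probability where `p θ / p θ'` is small. -/
theorem exists_coupling {Θ U : Type*} [Fintype Θ] [Fintype U] [Nonempty U] (p : Θ → U → ℝ)
    (hp : ∀ θ, p θ ∈ stdSimplex ℝ U) :
    ∃ π : (Θ → U) → ℝ, π ∈ stdSimplex ℝ (Θ → U) ∧ (∀ θ u, lawOf π (fun σ => σ θ) u = p θ u) ∧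
      ∀ θ θ' u τ, 0 ≤ τ → p θ u ≤ τ * p θ' u →
        prob π ({σ | σ θ = u} \ {σ | σ θ' = u}) ≤ τ * p θ u := by
  obtain ⟨N, hN⟩ : ∃ N, Fintype.card U = N + 1 :=
    ⟨_, (Nat.succ_pred_eq_of_pos Fintype.card_pos).symm⟩
  let e : U ≃ Fin (N + 1) := Fintype.equivFinOfCardEq hN
  let μ : Measure (Fin (N + 1) → ℝ) := Measure.pi fun _ => stdExp
  -- The value `u` wins the race for `p θ` when `S u / p θ u` is strictly the smallest.
  -- Cross-multiplication avoids dividing by zero masses, and the arrival times `S` are shared by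
  -- all `θ`.
  let E : Θ → U → Set (Fin (N + 1) → ℝ) := fun θ u =>
    {S | ∀ v ≠ u, p θ v * S (e u) < p θ u * S (e v)}
  have hEm : ∀ θ u, MeasurableSet (E θ u) := by
    intro θ u
    have : E θ u = ⋂ v, ⋂ _ : v ≠ u, {S | p θ v * S (e u) < p θ u * S (e v)} := by
      ext S
      simp [E]
    rw [this]
    exact MeasurableSet.iInter fun v => MeasurableSet.iInter fun _ =>
      measurableSet_lt (by fun_prop) (by fun_prop)
  have hEdisj : ∀ θ u u' S, S ∈ E θ u → S ∈ E θ u' → u = u' := by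
    intro θ u u' S h1 h2
    by_contra hne
    have h3 := h1 u' (Ne.symm hne)
    have h4 := h2 u hne
    linarith
  let sel : (Fin (N + 1) → ℝ) → Θ → U := fun S θ =>
    if h : ∃ u, S ∈ E θ u then h.choose else Classical.arbitrary U
  have hsel : ∀ θ u S, S ∈ E θ u → sel S θ = u := by
    intro θ u S h
    have hex : ∃ u, S ∈ E θ u := ⟨u, h⟩
    simp only [sel, dif_pos hex]
    exact hEdisj θ _ _ S hex.choose_spec h
  have hselm : ∀ θ u, MeasurableSet {S | sel S θ = u} := by
    intro θ u
    by_cases hu : u = Classical.arbitrary U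
    · have : {S | sel S θ = u} = E θ u ∪ (⋃ v, E θ v)ᶜ := by
        ext S
        simp only [Set.mem_union, Set.mem_compl_iff, Set.mem_iUnion]
        constructor
        · intro h
          by_cases hex : ∃ v, S ∈ E θ v
          · obtain ⟨v, hv⟩ := hex
            left
            rwa [← show v = u from (hsel θ v S hv).symm.trans h]
          · exact Or.inr hex
        · rintro (h | h)
          · exact hsel θ u S h
          · change sel S θ = u
            simp only [sel, dif_neg h, hu]
      rw [this]
      exact (hEm θ u).union (MeasurableSet.iUnion fun v => hEm θ v).compl
    · have : {S | sel S θ = u} = E θ u := by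
        ext S
        constructor
        · intro h
          by_cases hex : ∃ v, S ∈ E θ v
          · obtain ⟨v, hv⟩ := hex
            rwa [← show v = u from (hsel θ v S hv).symm.trans h]
          · have : sel S θ = u := h
            simp only [sel, dif_neg hex] at this
            exact absurd this.symm hu
        · exact fun h => hsel θ u S h
      rw [this]
      exact hEm θ u
  have hfib : ∀ σ, MeasurableSet (sel ⁻¹' {σ}) := by
    intro σ
    have : sel ⁻¹' {σ} = ⋂ θ, {S | sel S θ = σ θ} := by
      ext S
      simp [funext_iff]
    rw [this]
    exact MeasurableSet.iInter fun θ => hselm θ _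
  let π : (Θ → U) → ℝ := fun σ => μ.real (sel ⁻¹' {σ})
  have hev : ∀ Q : Set (Θ → U), prob π Q = μ.real (sel ⁻¹' Q) := by
    intro Q
    rw [prob, ← Finset.sum_filter, sum_measureReal_preimage_singleton _ fun σ _ => hfib σ]
    congr 1
    ext S
    simp
  have hπ : π ∈ stdSimplex ℝ (Θ → U) := by
    refine ⟨fun σ => measureReal_nonneg, ?_⟩
    have := hev Set.univ
    simpa [prob] using this
  -- Lower bounds suffice: the masses on both sides sum to one, so equality follows and ties never
  -- have to be shown negligible.
  have hlower : ∀ θ u, p θ u ≤ lawOf π (fun σ => σ θ) u := by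
    intro θ u
    by_cases hu : p θ u = 0
    · rw [hu]
      exact lawOf_nonneg hπ.1 _ _
    have hu' : 0 < p θ u := lt_of_le_of_ne ((hp θ).1 u) (Ne.symm hu)
    have h1 := measureReal_race e u (fun v => p θ v / p θ u)
      fun v => div_nonneg ((hp θ).1 v) hu'.le
    rw [← Finset.sum_div, (hp θ).2, div_self hu, add_sub_cancel, one_div_one_div] at h1
    have h2 : lawOf π (fun σ => σ θ) u = μ.real {S | sel S θ = u} := hev {σ | σ θ = u}
    rw [h2, ← h1]
    refine measureReal_mono fun S hS => hsel θ u S fun v hv => ?_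
    have := hS.2 v hv
    rwa [div_mul_eq_mul_div, div_lt_iff₀ hu', mul_comm (S (e v))] at this
  have hmarg : ∀ θ u, lawOf π (fun σ => σ θ) u = p θ u := by
    intro θ u
    have := (Finset.sum_eq_sum_iff_of_le fun u (_ : u ∈ Finset.univ) => hlower θ u).1
      (by rw [sum_lawOf, hπ.2, (hp θ).2]) u (Finset.mem_univ u)
    exact this.symm
  refine ⟨π, hπ, hmarg, fun θ θ' u τ hτ hle => ?_⟩
  by_cases hu : p θ u = 0
  · rw [hu, mul_zero]
    exact (prob_mono hπ.1 Set.sdiff_subset).trans (le_of_eq ((hmarg θ u).trans hu))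
  have hu' : 0 < p θ u := lt_of_le_of_ne ((hp θ).1 u) (Ne.symm hu)
  have hq0 := (hp θ').1 u
  have hq' : 0 < p θ' u := by
    refine lt_of_le_of_ne hq0 fun h => ?_
    rw [← h, mul_zero] at hle
    linarith
  -- If `u` wins against the sums of the two handicaps, it wins both races. The probability of this
  -- is `1 / (1/a + 1/b - 1)`, with `a = p θ u` and `b = p θ' u`.
  have hmatch : 1 / (1 / p θ u + 1 / p θ' u - 1) ≤
      prob π ({σ | σ θ = u} ∩ {σ | σ θ' = u}) := by
    have h1 := measureReal_race e u (fun v => p θ v / p θ u + p θ' v / p θ' u)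
      fun v => add_nonneg (div_nonneg ((hp θ).1 v) hu'.le) (div_nonneg ((hp θ').1 v) hq'.le)
    rw [Finset.sum_add_distrib, ← Finset.sum_div, ← Finset.sum_div, (hp θ).2, (hp θ').2,
      div_self hu, div_self hq'.ne'] at h1
    rw [show 1 / p θ u + 1 / p θ' u - 1 = 1 + (1 / p θ u + 1 / p θ' u - (1 + 1)) by ring, ← h1,
      hev]
    refine measureReal_mono fun S hS => ⟨hsel θ u S fun v hv => ?_, hsel θ' u S fun v hv => ?_⟩
    · have h2 := hS.2 v hv
      have h3 : p θ v / p θ u * S (e u) < S (e v) := lt_of_le_of_lt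
        (mul_le_mul_of_nonneg_right (le_add_of_nonneg_right (div_nonneg ((hp θ').1 v) hq'.le))
          hS.1.le) h2
      rwa [div_mul_eq_mul_div, div_lt_iff₀ hu', mul_comm (S (e v))] at h3
    · have h2 := hS.2 v hv
      have h3 : p θ' v / p θ' u * S (e u) < S (e v) := lt_of_le_of_lt
        (mul_le_mul_of_nonneg_right (le_add_of_nonneg_left (div_nonneg ((hp θ).1 v) hu'.le))
          hS.1.le) h2
      rwa [div_mul_eq_mul_div, div_lt_iff₀ hq', mul_comm (S (e v))] at h3
  have hsplit := prob_inter_add_prob_diff π {σ | σ θ = u} {σ | σ θ' = u}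
  rw [← lawOf_eq_prob, hmarg θ u] at hsplit
  set a := p θ u
  set b := p θ' u
  have ha1 : a ≤ 1 := le_one_of_mem_stdSimplex (hp θ) u
  have hb1 : b ≤ 1 := le_one_of_mem_stdSimplex (hp θ') u
  have hden : 0 < a + b - a * b := by nlinarith
  have hval : 1 / (1 / a + 1 / b - 1) = a * b / (a + b - a * b) := by
    have h1 : 1 / a + 1 / b - 1 = (a + b - a * b) / (a * b) := by
      field_simp
      ring
    rw [h1, one_div_div]
  have hfin : a - a * b / (a + b - a * b) ≤ τ * a := by
    have h1 : a - a * b / (a + b - a * b) = a * (a * (1 - b) / (a + b - a * b)) := by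
      field_simp
      ring
    have h2 : a * (1 - b) / (a + b - a * b) ≤ τ := by
      rw [div_le_iff₀ hden]
      have h3 : b * (1 - b) ≤ a + b - a * b := by nlinarith
      have h4 : a * (1 - b) ≤ τ * b * (1 - b) := mul_le_mul_of_nonneg_right hle (by linarith)
      nlinarith [mul_le_mul_of_nonneg_left h3 hτ]
    rw [h1, mul_comm τ]
    exact mul_le_mul_of_nonneg_left h2 hu'.le
  rw [hval] at hmatch
  linarith

end Race

/-! ### Interactive simulation with shared seeds -/

section Build

variable {r : ℕ} {G : Fin r → Type*}

/-- The family generated by a rule that computes each member from the previous ones. -/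
def build (step : ∀ i, ((j : Set.Iio i) → G j) → G i) (i : Fin r) : G i :=
  (wellFounded_lt (α := Fin r)).fix (fun i ih => step i fun j => ih j j.2) i

lemma build_eq (step : ∀ i, ((j : Set.Iio i) → G j) → G i) (i : Fin r) :
    build step i = step i fun j => build step j :=
  WellFounded.fix_eq _ _ _

/-- A recursively generated family is the unique fixed point of its rule. For random rules, the
event of producing a given family thus splits into one condition per round. -/
lemma eq_build_iff (step : ∀ i, ((j : Set.Iio i) → G j) → G i) (g : ∀ i, G i) :
    build step = g ↔ ∀ i, step i (fun j => g j) = g i := by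
  constructor
  · rintro rfl i
    exact (build_eq step i).symm
  · intro h
    funext i
    induction i using WellFoundedLT.induction with
    | ind i ih =>
      rw [build_eq, ← h i]
      congr 1
      funext j
      exact ih j j.2

end Build

/-! ### Reconstruction of the samples by one terminal -/

section Recon

variable {r : ℕ} {G : Fin r → Type*} {M : Fin r → ℕ}
  (s : ∀ i, ((j : Set.Iio i) → G j) → Option (Fin (M i)) → G i × Fin (M i)) (own : Fin r → Prop)
  [DecidablePred own]

/-- The reconstruction by a terminal with sampler `s` that speaks in the rounds `own`, from the
messages `c`. -/
def recon (c : ∀ i, Fin (M i)) : ∀ i, G i :=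
  build fun i h => (s i h (if own i then none else some (c i))).1

/-- The message of a terminal in round `i`. -/
def say (c : ∀ i, Fin (M i)) (i : Fin r) : Fin (M i) :=
  (s i (fun j => recon s own c j) none).2

lemma recon_eq (c : ∀ i, Fin (M i)) (i : Fin r) : recon s own c i =
    (s i (fun j => recon s own c j) (if own i then none else some (c i))).1 :=
  build_eq _ i

lemma recon_congr {c c' : ∀ i, Fin (M i)} (i : Fin r) (h : ∀ j ≤ i, c j = c' j) :
    recon s own c i = recon s own c' i := by
  induction i using WellFoundedLT.induction with
  | ind i ih =>
    have h1 : (fun j : Set.Iio i => recon s own c j) = fun j : Set.Iio i => recon s own c' j :=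
      funext fun j => ih j j.2 fun l hl => h l (hl.trans (le_of_lt j.2))
    rw [recon_eq, recon_eq, h1, h i le_rfl]

/-- Causality: a message depends only on strictly earlier ones, so the default values put by
`extend` at the other rounds are harmless. -/
lemma say_congr {c c' : ∀ i, Fin (M i)} (i : Fin r) (h : ∀ j < i, c j = c' j) :
    say s own c i = say s own c' i := by
  have h1 : (fun j : Set.Iio i => recon s own c j) = fun j : Set.Iio i => recon s own c' j :=
    funext fun j => recon_congr s own j fun l hl => h l (lt_of_le_of_lt hl j.2)
  rw [say, say, h1]

/-- Extension of the messages of the rounds before `i` to all rounds. -/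
def extend (hM : ∀ i, 0 < M i) (i : Fin r) (h : (j : Set.Iio i) → Fin (M j)) (j : Fin r) :
    Fin (M j) :=
  if hj : j < i then h ⟨j, hj⟩ else ⟨0, hM j⟩

lemma extend_past (hM : ∀ i, 0 < M i) (c : ∀ i, Fin (M i)) (i j : Fin r) (hj : j < i) :
    extend hM i (fun l => c l) j = c j := by
  simp [extend, hj]

end Recon

/-! ### The exchange of messages and its ideal version -/

section Protocol

open scoped Classical

variable {r : ℕ} {G : Fin r → Type*} {M : Fin r → ℕ} {A₁ A₂ : Type*}

/-- The turn of terminal 1. -/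
abbrev IsOdd (i : Fin r) : Prop := Odd (i.val + 1)

variable (s₁ s₂ : ∀ i, ((j : Set.Iio i) → G j) → Option (Fin (M i)) → G i × Fin (M i))

/-- The messages that two terminals exchange. -/
def transcript (hM : ∀ i, 0 < M i) : ∀ i, Fin (M i) :=
  build fun i h => if IsOdd i then say s₁ IsOdd (extend hM i h) i
    else say s₂ (fun i => ¬ IsOdd i) (extend hM i h) i

/-- The samples and messages when both terminals know all samples of the past. -/
def ideal : ∀ i, G i × Fin (M i) :=
  build fun i h => if IsOdd i then s₁ i (fun j => (h j).1) none else s₂ i (fun j => (h j).1) none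

lemma transcript_eq (hM : ∀ i, 0 < M i) (i : Fin r) : transcript s₁ s₂ hM i =
    if IsOdd i then say s₁ IsOdd (transcript s₁ s₂ hM) i
    else say s₂ (fun i => ¬ IsOdd i) (transcript s₁ s₂ hM) i := by
  have h1 := say_congr s₁ IsOdd i fun j hj => extend_past hM (transcript s₁ s₂ hM) i j hj
  have h2 := say_congr s₂ (fun i => ¬ IsOdd i) i
    fun j hj => extend_past hM (transcript s₁ s₂ hM) i j hj
  rw [← h1, ← h2]
  exact build_eq _ i

/-- If the listener always reproduces the sample of the speaker from the message, then the
terminals produce the ideal samples. -/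
lemma recon_eq_ideal (hM : ∀ i, 0 < M i)
    (h : ∀ i, (if IsOdd i then s₂ i (fun j => (ideal s₁ s₂ j).1) (some (ideal s₁ s₂ i).2)
      else s₁ i (fun j => (ideal s₁ s₂ j).1) (some (ideal s₁ s₂ i).2)) = ideal s₁ s₂ i) :
    recon s₁ IsOdd (transcript s₁ s₂ hM) = (fun i => (ideal s₁ s₂ i).1) ∧
    recon s₂ (fun i => ¬ IsOdd i) (transcript s₁ s₂ hM) = fun i => (ideal s₁ s₂ i).1 := by
  suffices H : ∀ i, recon s₁ IsOdd (transcript s₁ s₂ hM) i = (ideal s₁ s₂ i).1 ∧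
      recon s₂ (fun i => ¬ IsOdd i) (transcript s₁ s₂ hM) i = (ideal s₁ s₂ i).1 from
    ⟨funext fun i => (H i).1, funext fun i => (H i).2⟩
  intro i
  induction i using WellFoundedLT.induction with
  | ind i ih =>
    have h1 : (fun j : Set.Iio i => recon s₁ IsOdd (transcript s₁ s₂ hM) j) =
        fun j : Set.Iio i => (ideal s₁ s₂ j).1 := funext fun j => (ih j j.2).1
    have h2 : (fun j : Set.Iio i => recon s₂ (fun i => ¬ IsOdd i) (transcript s₁ s₂ hM) j) =
        fun j : Set.Iio i => (ideal s₁ s₂ j).1 := funext fun j => (ih j j.2).2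
    have hid : ideal s₁ s₂ i = if IsOdd i then s₁ i (fun j => (ideal s₁ s₂ j).1) none
        else s₂ i (fun j => (ideal s₁ s₂ j).1) none := build_eq _ i
    have hi := h i
    by_cases hodd : IsOdd i
    · rw [if_pos hodd] at hi hid
      have ht : transcript s₁ s₂ hM i = (ideal s₁ s₂ i).2 := by
        rw [transcript_eq, if_pos hodd, say, h1, ← hid]
      rw [recon_eq, recon_eq, h1, h2, if_pos hodd, if_neg (not_not.2 hodd), ht, hi, ← hid]
      exact ⟨rfl, rfl⟩
    · rw [if_neg hodd] at hi hid
      have ht : transcript s₁ s₂ hM i = (ideal s₁ s₂ i).2 := by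
        rw [transcript_eq, if_neg hodd, say, h2, ← hid]
      rw [recon_eq, recon_eq, h1, h2, if_neg hodd, if_pos hodd, ht, hi, ← hid]
      exact ⟨rfl, rfl⟩

end Protocol

/-! ### Independent seeds, one per round -/

section Seeds

open scoped Classical

variable {ι : Type*} [Fintype ι] [DecidableEq ι] {S : ι → Type*} [∀ i, Fintype (S i)]

lemma sum_prod_apply_pi (g : ∀ i, S i → ℝ) :
    ∑ σ : ∀ i, S i, ∏ i, g i (σ i) = ∏ i, ∑ a, g i a := by
  rw [Finset.prod_univ_sum, Fintype.piFinset_univ]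

lemma prod_mem_stdSimplex {π : ∀ i, S i → ℝ} (hπ : ∀ i, π i ∈ stdSimplex ℝ (S i)) :
    (fun σ : ∀ i, S i => ∏ i, π i (σ i)) ∈ stdSimplex ℝ (∀ i, S i) :=
  ⟨fun σ => Finset.prod_nonneg fun i _ => (hπ i).1 _, by
    rw [sum_prod_apply_pi]
    simp [fun i => (hπ i).2]⟩

lemma prob_pi (π : ∀ i, S i → ℝ) (Q : ∀ i, Set (S i)) :
    prob (fun σ : ∀ i, S i => ∏ i, π i (σ i)) {σ | ∀ i, σ i ∈ Q i} = ∏ i, prob (π i) (Q i) := by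
  simp only [prob]
  rw [← sum_prod_apply_pi]
  refine Finset.sum_congr rfl fun σ _ => ?_
  by_cases h : ∀ i, σ i ∈ Q i
  · rw [if_pos (by exact h)]
    exact Finset.prod_congr rfl fun i _ => by rw [if_pos (h i)]
  · rw [if_neg (by exact h)]
    push Not at h
    obtain ⟨i, hi⟩ := h
    exact (Finset.prod_eq_zero (Finset.mem_univ i) (by rw [if_neg hi])).symm

end Seeds

/-! ### One-shot simulation of an interaction -/

section OneShot

open scoped Classical

variable {r : ℕ} {G : Fin r → Type*} [∀ i, Fintype (G i)] {A₁ A₂ : Type*} {M : Fin r → ℕ}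

variable (G A₁ A₂) in
/-- What one of the terminals knows before round `i`. -/
abbrev View (i : Fin r) : Type _ :=
  ((j : Set.Iio i) → G j) × A₁ ⊕ ((j : Set.Iio i) → G j) × A₂

/-- The view of the terminal that speaks in round `i`. -/
def speaker (i : Fin r) (h : (j : Set.Iio i) → G j) (a : A₁ × A₂) : View G A₁ A₂ i :=
  if IsOdd i then .inl (h, a.1) else .inr (h, a.2)

/-- The view of the terminal that listens in round `i`. -/
def listener (i : Fin r) (h : (j : Set.Iio i) → G j) (a : A₁ × A₂) : View G A₁ A₂ i :=
  if IsOdd i then .inr (h, a.2) else .inl (h, a.1)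

/-- The mass function from which a sample and a message are drawn: the message is uniform for the
speaker, and given for the listener. -/
def sampler (K : ∀ i, View G A₁ A₂ i → G i → ℝ) (i : Fin r)
    (θ : View G A₁ A₂ i × Option (Fin (M i))) (u : G i × Fin (M i)) : ℝ :=
  K i θ.1 u.1 * θ.2.elim (1 / (M i : ℝ)) fun m => if u.2 = m then 1 else 0

lemma sampler_mem (hM : ∀ i, 0 < M i) {K : ∀ i, View G A₁ A₂ i → G i → ℝ}
    (hK : ∀ i v, K i v ∈ stdSimplex ℝ (G i)) (i : Fin r)
    (θ : View G A₁ A₂ i × Option (Fin (M i))) :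
    sampler K i θ ∈ stdSimplex ℝ (G i × Fin (M i)) := by
  have hMi : (M i : ℝ) ≠ 0 := by exact_mod_cast (hM i).ne'
  obtain ⟨v, o⟩ := θ
  refine ⟨fun u => mul_nonneg ((hK i v).1 _) ?_, ?_⟩
  · cases o with
    | none => simp
    | some m => simp only [Option.elim_some]; split_ifs <;> norm_num
  · rw [Fintype.sum_prod_type, ← (hK i v).2]
    refine Finset.sum_congr rfl fun g _ => ?_
    simp only [sampler, ← Finset.mul_sum]
    cases o with
    | none => simp [hMi]
    | some m => simp

/-- The expected cost of sequential sampling with independent couplings, where a unit is charged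
whenever the sample of a second mass function differs from the first one. -/
lemma sum_seed_le {U Θ : Fin r → Type*} [∀ i, Fintype (U i)] [∀ i, Fintype (Θ i)]
    {p : ∀ i, Θ i → U i → ℝ} (hp : ∀ i t, p i t ∈ stdSimplex ℝ (U i))
    {π : ∀ i, (Θ i → U i) → ℝ} (hπ : ∀ i, π i ∈ stdSimplex ℝ (Θ i → U i))
    (hmarg : ∀ i t u, lawOf (π i) (fun σ => σ t) u = p i t u) {τ : ℝ} (hτ : 0 ≤ τ)
    (hmis : ∀ i t t' u, p i t u ≤ τ * p i t' u →
      prob (π i) ({σ | σ t = u} \ {σ | σ t' = u}) ≤ τ * p i t u)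
    (sp ls : (∀ i, U i) → ∀ i, Θ i) (gen : (∀ i, Θ i → U i) → ∀ i, U i)
    (hgen : ∀ σ u, gen σ = u ↔ ∀ i, σ i (sp u i) = u i) (φ : (∀ i, U i) → ℝ) :
    ∑ σ : ∀ i, Θ i → U i, (∏ i, π i (σ i)) *
        (φ (gen σ) + ∑ i, if σ i (ls (gen σ) i) = gen σ i then 0 else 1) ≤
      ∑ u, (∏ i, p i (sp u i) (u i)) * (φ u + ∑ i,
        (τ + if p i (sp u i) (u i) ≤ τ * p i (ls u i) (u i) then 0 else 1)) := by
  let P : (∀ i, Θ i → U i) → ℝ := fun σ => ∏ i, π i (σ i)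
  have hP : P ∈ stdSimplex ℝ (∀ i, Θ i → U i) := prod_mem_stdSimplex hπ
  -- Producing `u` is one condition on the seed of each round, with parameters determined by `u`, so
  -- independence turns its probability into a product.
  have hprob : ∀ u, prob P {σ | gen σ = u} = ∏ i, p i (sp u i) (u i) := by
    intro u
    have h1 : {σ | gen σ = u} = {σ | ∀ i, σ i ∈ {x : Θ i → U i | x (sp u i) = u i}} := by
      ext σ
      exact hgen σ u
    rw [h1]
    refine (prob_pi π _).trans (Finset.prod_congr rfl fun i _ => ?_)
    rw [← lawOf_eq_prob, hmarg]
  have hprobmis : ∀ u i, prob P ({σ | gen σ = u} ∩ {σ | σ i (ls u i) = u i}ᶜ) ≤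
      (∏ i, p i (sp u i) (u i)) *
      (τ + if p i (sp u i) (u i) ≤ τ * p i (ls u i) (u i) then 0 else 1) := by
    intro u i
    have hpos : ∀ s : Finset (Fin r), 0 ≤ ∏ j ∈ s, p j (sp u j) (u j) := fun s =>
      Finset.prod_nonneg fun j _ => (hp _ _).1 _
    split_ifs with hle
    -- A mismatch in round `i` only tightens the condition on the `i`-th seed; the other factors
    -- remain and the coupling bounds this one.
    · let Q' : ∀ j, Set (Θ j → U j) := fun j =>
        if j = i then {x | x (sp u j) = u j} \ {x | x (ls u j) = u j} else {x | x (sp u j) = u j}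
      have h1 : {σ | gen σ = u} ∩ {σ | σ i (ls u i) = u i}ᶜ = {σ | ∀ j, σ j ∈ Q' j} := by
        ext σ
        constructor
        · rintro ⟨h1, h2⟩ j
          have h3 := (hgen σ u).1 h1 j
          by_cases hj : j = i
          · subst hj
            simp only [Q', if_true]
            exact ⟨h3, h2⟩
          · simp only [Q', if_neg hj]
            exact h3
        · intro h
          refine ⟨(hgen σ u).2 fun j => ?_, ?_⟩
          · have h3 := h j
            by_cases hj : j = i
            · subst hj
              simp only [Q', if_true] at h3
              exact h3.1
            · simp only [Q', if_neg hj] at h3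
              exact h3
          · have h3 := h i
            simp only [Q', if_true] at h3
            exact h3.2
      rw [h1]
      refine (prob_pi π Q').le.trans ?_
      rw [← Finset.mul_prod_erase _ _ (Finset.mem_univ i),
        ← Finset.mul_prod_erase _ (fun j => p j (sp u j) (u j)) (Finset.mem_univ i)]
      have h2 : ∏ j ∈ Finset.univ.erase i, prob (π j) (Q' j) =
          ∏ j ∈ Finset.univ.erase i, p j (sp u j) (u j) := by
        refine Finset.prod_congr rfl fun j hj => ?_
        simp only [Q', if_neg (Finset.ne_of_mem_erase hj)]
        rw [← lawOf_eq_prob, hmarg]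
      have h4 : prob (π i) (Q' i) ≤ τ * p i (sp u i) (u i) := by
        simp only [Q', if_true]
        exact hmis i _ _ _ hle
      rw [h2]
      refine (mul_le_mul_of_nonneg_right h4 (hpos _)).trans (le_of_eq ?_)
      ring
    · refine (prob_mono hP.1 Set.inter_subset_left).trans ?_
      rw [hprob]
      exact le_mul_of_one_le_right (hpos _) (by linarith)
  calc ∑ σ, P σ * (φ (gen σ) + ∑ i, if σ i (ls (gen σ) i) = gen σ i then 0 else 1)
      = ∑ u, (prob P {σ | gen σ = u} * φ u +
          ∑ i, prob P ({σ | gen σ = u} ∩ {σ | σ i (ls u i) = u i}ᶜ)) := by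
        simp only [prob, Finset.sum_mul]
        simp only [Finset.sum_comm (s := (Finset.univ : Finset (Fin r)))
          (t := (Finset.univ : Finset (∀ i, Θ i → U i))), ← Finset.sum_add_distrib]
        rw [Finset.sum_comm]
        refine Finset.sum_congr rfl fun σ _ => ?_
        rw [Finset.sum_eq_single (gen σ)]
        · rw [mul_add, Finset.mul_sum]
          congr 1
          · rw [if_pos (by exact rfl)]
          · refine Finset.sum_congr rfl fun i _ => ?_
            by_cases h : σ i (ls (gen σ) i) = gen σ i <;> simp [h]
        · intro u _ hu
          have hu' : ¬ (gen σ = u) := fun h => hu h.symm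
          simp [hu']
        · simp
    _ ≤ _ := by
        refine Finset.sum_le_sum fun u _ => ?_
        rw [mul_add, Finset.mul_sum, hprob]
        exact add_le_add le_rfl (Finset.sum_le_sum fun i _ => hprobmis u i)

/-- The samples of a terminal with a given seed. -/
def seedSample {Θ : Fin r → Type*} (σ : ∀ i, Θ i → G i × Fin (M i))
    (θ : ∀ i, View G A₁ A₂ i → Option (Fin (M i)) → Θ i) {B : Type*}
    (f : ∀ i, ((j : Set.Iio i) → G j) × B → View G A₁ A₂ i) (b : B) (i : Fin r)
    (h : (j : Set.Iio i) → G j) (o : Option (Fin (M i))) : G i × Fin (M i) :=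
  σ i (θ i (f i (h, b)) o)

/-- With random shared seeds the protocol is ideal unless some listener errs, and an error costs at
most 1 because `Φ ≤ 1`. The bound concerns one expectation, so it holds for some fixed seed, which
becomes part of the encoders and decoders. -/
lemma exists_protocol_of_coupling [∀ i, Nonempty (G i)] [Fintype A₁] [Fintype A₂] {Θ : Fin r → Type*}
    [∀ i, Fintype (Θ i)] (hM : ∀ i, 0 < M i)
    {K : ∀ i, View G A₁ A₂ i → G i → ℝ} {p : ∀ i, Θ i → G i × Fin (M i) → ℝ}
    (hp : ∀ i t, p i t ∈ stdSimplex ℝ (G i × Fin (M i)))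
    (θ : ∀ i, View G A₁ A₂ i → Option (Fin (M i)) → Θ i)
    (hnone : ∀ i v u, p i (θ i v none) u = K i v u.1 * (1 / (M i : ℝ)))
    (hsome : ∀ i v g m, p i (θ i v (some m)) (g, m) = K i v g)
    {Q : A₁ × A₂ → ℝ} (hQ : ∀ a, 0 ≤ Q a)
    (Φ : (∀ i, G i) → (∀ i, G i) → A₁ × A₂ → ℝ) (hΦ0 : ∀ g g' a, 0 ≤ Φ g g' a)
    (hΦ1 : ∀ g g' a, Φ g g' a ≤ 1) {τ : ℝ} (hτ : 0 ≤ τ) :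
    ∃ (e₁ : ∀ i, ((j : Set.Iio i) → Fin (M j)) → A₁ → Fin (M i))
      (e₂ : ∀ i, ((j : Set.Iio i) → Fin (M j)) → A₂ → Fin (M i))
      (ρ₁ : (∀ i, Fin (M i)) → A₁ → ∀ i, G i) (ρ₂ : (∀ i, Fin (M i)) → A₂ → ∀ i, G i)
      (c : A₁ × A₂ → ∀ i, Fin (M i)),
      (∀ a i, c a i = if IsOdd i then e₁ i (fun j => c a j) a.1 else e₂ i (fun j => c a j) a.2) ∧
      ∑ a, Q a * Φ (ρ₁ (c a) a.1) (ρ₂ (c a) a.2) a ≤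
        ∑ a, Q a * ∑ g : ∀ i, G i, (∏ i, K i (speaker i (fun j => g j) a) (g i)) *
          (Φ g g a + ∑ i, (τ + if K i (speaker i (fun j => g j) a) (g i) ≤
            τ * M i * K i (listener i (fun j => g j) a) (g i) then 0 else 1)) := by
  have hne : ∀ i, Nonempty (G i × Fin (M i)) := fun i =>
    ⟨(Classical.arbitrary _, ⟨0, hM i⟩)⟩
  have hcoup := fun i => exists_coupling (p i) (hp i)
  choose π hπ hmarg hmis using hcoup
  let P : (∀ i, Θ i → G i × Fin (M i)) → ℝ := fun σ => ∏ i, π i (σ i)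
  have hP : P ∈ stdSimplex ℝ (∀ i, Θ i → G i × Fin (M i)) := prod_mem_stdSimplex hπ
  let s₁ := fun (σ : ∀ i, Θ i → G i × Fin (M i)) (a : A₁) =>
    seedSample σ θ (fun _ => Sum.inl) a
  let s₂ := fun (σ : ∀ i, Θ i → G i × Fin (M i)) (a : A₂) =>
    seedSample σ θ (fun _ => Sum.inr) a
  let c := fun σ (a : A₁ × A₂) => transcript (s₁ σ a.1) (s₂ σ a.2) hM
  let J : (∀ i, Θ i → G i × Fin (M i)) → A₁ × A₂ → ℝ := fun σ a =>
    Φ (recon (s₁ σ a.1) IsOdd (c σ a)) (recon (s₂ σ a.2) (fun i => ¬ IsOdd i) (c σ a)) a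
  let B : A₁ × A₂ → ℝ := fun a => ∑ g : ∀ i, G i,
    (∏ i, K i (speaker i (fun j => g j) a) (g i)) *
      (Φ g g a + ∑ i, (τ + if K i (speaker i (fun j => g j) a) (g i) ≤
        τ * M i * K i (listener i (fun j => g j) a) (g i) then 0 else 1))
  have havg : ∀ a, ∑ σ, P σ * J σ a ≤ B a := by
    intro a
    let gen := fun σ => ideal (s₁ σ a.1) (s₂ σ a.2)
    let sp : (∀ i, G i × Fin (M i)) → ∀ i, Θ i := fun u i =>
      θ i (speaker i (fun j => (u j).1) a) none
    let ls : (∀ i, G i × Fin (M i)) → ∀ i, Θ i := fun u i =>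
      θ i (listener i (fun j => (u j).1) a) (some (u i).2)
    have hgen : ∀ σ u, gen σ = u ↔ ∀ i, σ i (sp u i) = u i := by
      intro σ u
      refine (eq_build_iff _ u).trans (forall_congr' fun i => ?_)
      by_cases hi : IsOdd i
      · rw [if_pos hi]
        simp only [sp, speaker, if_pos hi]
        rfl
      · rw [if_neg hi]
        simp only [sp, speaker, if_neg hi]
        rfl
    have hJ : ∀ σ, J σ a ≤ Φ (fun i => (gen σ i).1) (fun i => (gen σ i).1) a +
        ∑ i, if σ i (ls (gen σ) i) = gen σ i then 0 else 1 := by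
      intro σ
      by_cases hall : ∀ i, σ i (ls (gen σ) i) = gen σ i
      · have h1 := recon_eq_ideal (s₁ σ a.1) (s₂ σ a.2) hM fun i => by
          refine Eq.trans ?_ (hall i)
          by_cases hi : IsOdd i
          · rw [if_pos hi]
            simp only [ls, listener, if_pos hi]
            rfl
          · rw [if_neg hi]
            simp only [ls, listener, if_neg hi]
            rfl
        have h3 : J σ a = Φ (fun i => (gen σ i).1) (fun i => (gen σ i).1) a := by
          simp only [J, c]
          rw [h1.1, h1.2]
        rw [h3]
        exact le_add_of_nonneg_right (Finset.sum_nonneg fun i _ => by split_ifs <;> norm_num)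
      · push Not at hall
        obtain ⟨i, hi⟩ := hall
        have h1 := Finset.single_le_sum
          (f := fun i => if σ i (ls (gen σ) i) = gen σ i then (0 : ℝ) else 1)
          (fun i _ => by split_ifs <;> norm_num) (Finset.mem_univ i)
        rw [if_neg hi] at h1
        exact (hΦ1 _ _ _).trans (h1.trans (le_add_of_nonneg_left (hΦ0 _ _ _)))
    refine (Finset.sum_le_sum fun σ _ => mul_le_mul_of_nonneg_left (hJ σ) (hP.1 σ)).trans ?_
    refine Eq.trans_le ?_ ((sum_seed_le hp hπ hmarg hτ (fun i t t' u h => hmis i t t' u τ hτ h)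
      sp ls gen hgen fun u => Φ (fun i => (u i).1) (fun i => (u i).1) a).trans (le_of_eq ?_))
    · refine Finset.sum_congr rfl fun σ _ => ?_
      congr!
    -- No term depends on the messages except through the uniform weights `1 / M i`, which cancel
    -- against the number of message tuples.
    rw [← Equiv.sum_comp (Equiv.arrowProdEquivProdArrow (Fin r) G fun i => Fin (M i)).symm,
      Fintype.sum_prod_type]
    refine Finset.sum_congr rfl fun g _ => ?_
    have hiff : ∀ (i : Fin r) (x y : ℝ), x * (1 / (M i : ℝ)) ≤ τ * y ↔ x ≤ τ * M i * y := by
      intro i x y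
      have hMi : (0 : ℝ) < M i := by exact_mod_cast hM i
      rw [mul_one_div, div_le_iff₀ hMi, mul_right_comm]
    simp only [Equiv.arrowProdEquivProdArrow_symm_apply, sp, ls, hnone, hsome, hiff,
      Finset.prod_mul_distrib]
    rw [Finset.sum_const, Finset.card_univ, Fintype.card_pi, nsmul_eq_mul]
    simp only [Fintype.card_fin, Nat.cast_prod]
    have h1 : (∏ i, (M i : ℝ)) * ∏ i, (1 / (M i : ℝ)) = 1 := by
      rw [← Finset.prod_mul_distrib]
      refine Finset.prod_eq_one fun i _ => ?_
      have : (M i : ℝ) ≠ 0 := by exact_mod_cast (hM i).ne'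
      field_simp
    linear_combination ((∏ i, K i (speaker i (fun j => g j) a) (g i)) *
      (Φ g g a + ∑ i, (τ + if K i (speaker i (fun j => g j) a) (g i) ≤
        τ * M i * K i (listener i (fun j => g j) a) (g i) then 0 else 1))) * h1
  -- Derandomization: not every seed can be worse than the average.
  obtain ⟨σ, hσ⟩ : ∃ σ, ∑ a, Q a * J σ a ≤ ∑ a, Q a * B a := by
    by_contra! hcon
    have h1 : ∑ σ, P σ * ∑ a, Q a * J σ a ≤ ∑ a, Q a * B a := by
      simp only [Finset.mul_sum]
      rw [Finset.sum_comm]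
      refine Finset.sum_le_sum fun a _ => ?_
      calc ∑ σ, P σ * (Q a * J σ a) = Q a * ∑ σ, P σ * J σ a := by
            rw [Finset.mul_sum]
            exact Finset.sum_congr rfl fun σ _ => by ring
        _ ≤ Q a * B a := mul_le_mul_of_nonneg_left (havg a) (hQ a)
    have h2 : ∑ σ, P σ * ∑ a, Q a * B a < ∑ σ, P σ * ∑ a, Q a * J σ a := by
      obtain ⟨σ₀, hσ₀⟩ : ∃ σ, 0 < P σ := by
        by_contra! hle
        have h3 := Finset.sum_nonpos fun σ (_ : σ ∈ Finset.univ) => hle σ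
        rw [hP.2] at h3
        linarith
      exact Finset.sum_lt_sum (fun σ _ => mul_le_mul_of_nonneg_left (hcon σ).le (hP.1 σ))
        ⟨σ₀, Finset.mem_univ _, mul_lt_mul_of_pos_left (hcon σ₀) hσ₀⟩
    rw [← Finset.sum_mul, hP.2, one_mul] at h2
    linarith
  exact ⟨fun i h a => say (s₁ σ a) IsOdd (extend hM i h) i,
    fun i h a => say (s₂ σ a) (fun i => ¬ IsOdd i) (extend hM i h) i,
    fun c a => recon (s₁ σ a) IsOdd c, fun c a => recon (s₂ σ a) (fun i => ¬ IsOdd i) c, c σ,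
    fun a i => build_eq _ i, hσ⟩

/-- One-shot interactive simulation. For any `Φ` with values in `[0, 1]`, there is a deterministic
protocol whose expected `Φ` is at most that of the ideal interaction, up to the probability that
some listener misidentifies a sample of the speaker. -/
theorem exists_protocol [∀ i, Nonempty (G i)] [Fintype A₁] [Fintype A₂] (hM : ∀ i, 0 < M i)
    {K : ∀ i, View G A₁ A₂ i → G i → ℝ}
    (hK : ∀ i v, K i v ∈ stdSimplex ℝ (G i)) {Q : A₁ × A₂ → ℝ} (hQ : ∀ a, 0 ≤ Q a)
    (Φ : (∀ i, G i) → (∀ i, G i) → A₁ × A₂ → ℝ) (hΦ0 : ∀ g g' a, 0 ≤ Φ g g' a)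
    (hΦ1 : ∀ g g' a, Φ g g' a ≤ 1) {τ : ℝ} (hτ : 0 ≤ τ) :
    ∃ (e₁ : ∀ i, ((j : Set.Iio i) → Fin (M j)) → A₁ → Fin (M i))
      (e₂ : ∀ i, ((j : Set.Iio i) → Fin (M j)) → A₂ → Fin (M i))
      (ρ₁ : (∀ i, Fin (M i)) → A₁ → ∀ i, G i) (ρ₂ : (∀ i, Fin (M i)) → A₂ → ∀ i, G i)
      (c : A₁ × A₂ → ∀ i, Fin (M i)),
      (∀ a i, c a i = if IsOdd i then e₁ i (fun j => c a j) a.1 else e₂ i (fun j => c a j) a.2) ∧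
      ∑ a, Q a * Φ (ρ₁ (c a) a.1) (ρ₂ (c a) a.2) a ≤
        ∑ a, Q a * ∑ g : ∀ i, G i, (∏ i, K i (speaker i (fun j => g j) a) (g i)) *
          (Φ g g a + ∑ i, (τ + if K i (speaker i (fun j => g j) a) (g i) ≤
            τ * M i * K i (listener i (fun j => g j) a) (g i) then 0 else 1)) :=
  exists_protocol_of_coupling hM (p := fun i => sampler (M := M) K i) (sampler_mem hM hK)
    (fun _ v o => (v, o)) (fun _ _ _ => rfl) (fun i v g m => by simp [sampler]) hQ Φ hΦ0 hΦ1 hτ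

end OneShot

/-! ### Conditional laws and the chain rule -/

section CondLaw

open scoped Classical

variable {Ω α β γ : Type*} [Fintype Ω] {p : Ω → ℝ}

/-- The conditional law of `A` given `B = b`, which is uniform if `b` has mass zero. -/
def condLaw [Fintype α] (p : Ω → ℝ) (A : Ω → α) (B : Ω → β) (b : β) (a : α) : ℝ :=
  if lawOf p B b = 0 then 1 / (Fintype.card α : ℝ)
  else lawOf p (fun ω => (A ω, B ω)) (a, b) / lawOf p B b

lemma condLaw_mem [Fintype α] [Nonempty α] (hp : ∀ ω, 0 ≤ p ω) (A : Ω → α) (B : Ω → β) (b : β) :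
    condLaw p A B b ∈ stdSimplex ℝ α := by
  by_cases hb : lawOf p B b = 0
  · refine ⟨fun a => ?_, ?_⟩
    · simp [condLaw, hb]
    · simp [condLaw, hb]
  · refine ⟨fun a => ?_, ?_⟩
    · simp only [condLaw, if_neg hb]
      exact div_nonneg (lawOf_nonneg hp _ _) (lawOf_nonneg hp _ _)
    · simp only [condLaw, if_neg hb]
      rw [← Finset.sum_div, sum_lawOf_fst, div_self hb]

lemma lawOf_id (p : Ω → ℝ) : lawOf p (fun ω => ω) = p := by
  funext ω
  simp [lawOf]

lemma lawOf_pair_le (hp : ∀ ω, 0 ≤ p ω) (A : Ω → α) (B : Ω → β) (a : α) (b : β) :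
    lawOf p (fun ω => (A ω, B ω)) (a, b) ≤ lawOf p B b := by
  refine Finset.sum_le_sum fun ω _ => ?_
  by_cases h : B ω = b <;> simp [Prod.ext_iff, h]
  split_ifs <;> simp [hp ω]

lemma lawOf_pair_eq_mul_condLaw [Fintype α] (hp : ∀ ω, 0 ≤ p ω) (A : Ω → α) (B : Ω → β) (a : α)
    (b : β) : lawOf p (fun ω => (A ω, B ω)) (a, b) = lawOf p B b * condLaw p A B b a := by
  by_cases hb : lawOf p B b = 0
  · rw [hb, zero_mul]
    exact le_antisymm (hb ▸ lawOf_pair_le hp A B a b) (lawOf_nonneg hp _ _)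
  · rw [condLaw, if_neg hb, mul_div_cancel₀ _ hb]

lemma MarkovChain.lawOf_eq_mul_condLaw [Fintype α] (hp : ∀ ω, 0 ≤ p ω) {A : Ω → α} {B : Ω → β}
    {C : Ω → γ} (h : MarkovChain p A B C) (a : α) (b : β) (c : γ) :
    lawOf p (fun ω => (A ω, B ω, C ω)) (a, b, c) =
      lawOf p (fun ω => (B ω, C ω)) (b, c) * condLaw p A B b a := by
  by_cases hb : lawOf p B b = 0
  · have h1 : lawOf p (fun ω => (B ω, C ω)) (b, c) = 0 := by
      by_contra hne
      obtain ⟨ω, hω, e⟩ := exists_of_lawOf_ne_zero hne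
      exact (lawOf_pos hp B hω).ne' (by rw [show B ω = b from congrArg Prod.fst e, hb])
    rw [h1, zero_mul]
    by_contra hne
    obtain ⟨ω, hω, e⟩ := exists_of_lawOf_ne_zero hne
    exact (lawOf_pos hp B hω).ne' (by rw [show B ω = b from congrArg (·.2.1) e, hb])
  · rw [condLaw, if_neg hb, ← mul_div_assoc, eq_div_iff hb, h, mul_comm]

lemma condLaw_pos [Fintype α] (hp : ∀ ω, 0 ≤ p ω) (A : Ω → α) (B : Ω → β) {ω : Ω} (hω : p ω ≠ 0) :
    0 < condLaw p A B (B ω) (A ω) := by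
  rw [condLaw, if_neg (lawOf_pos hp B hω).ne']
  exact div_pos (lawOf_pos hp (fun ω => (A ω, B ω)) hω) (lawOf_pos hp B hω)

lemma logLaw_pair_eq_add (hp : ∀ ω, 0 ≤ p ω) {A : Ω → α} {B : Ω → β} {g : β → α → ℝ}
    (hg : ∀ a b, lawOf p (fun ω => (A ω, B ω)) (a, b) = lawOf p B b * g b a) :
    logLaw p (fun ω => (A ω, B ω)) = logLaw p B + ∑ ω, p ω * Real.log (g (B ω) (A ω)) := by
  simp only [logLaw, ← Finset.sum_add_distrib, ← mul_add]
  refine Finset.sum_congr rfl fun ω _ => ?_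
  by_cases hω : p ω = 0
  · simp [hω]
  have h2 := (lawOf_pos hp (fun ω => (A ω, B ω)) hω).ne'
  rw [hg] at h2 ⊢
  rw [Real.log_mul (left_ne_zero_of_mul h2) (right_ne_zero_of_mul h2)]

variable {r : ℕ} {k : Fin r → ℕ}

/-- The chain rule for the law of a family and a further variable. -/
lemma lawOf_chain {F : Ω → ∀ i, Fin (k i)} {B : Ω → β}
    {g : ∀ i, ((j : Set.Iio i) → Fin (k j)) → β → Fin (k i) → ℝ}
    (hg : ∀ i v h b, lawOf p (fun ω => (F ω i, past (F ω) i, B ω)) (v, h, b) =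
      lawOf p (fun ω => (past (F ω) i, B ω)) (h, b) * g i h b v) (f : ∀ i, Fin (k i)) (b : β) :
    lawOf p (fun ω => (F ω, B ω)) (f, b) = lawOf p B b * ∏ i, g i (past f i) b (f i) := by
  suffices H : ∀ m ≤ r, lawOf p (fun ω => (fun j : {j : Fin r // j.val < m} => F ω j, B ω))
      (fun j => f j, b) = lawOf p B b * ∏ i : Fin r with i.val < m, g i (past f i) b (f i) by
    have h1 := H r le_rfl
    rw [Finset.filter_true_of_mem fun i _ => i.2] at h1
    rw [← h1]
    refine lawOf_congr fun ω _ => ?_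
    simp only [Prod.mk.injEq, funext_iff, Subtype.forall]
    exact and_congr_left fun _ => ⟨fun h i _ => h i, fun h i => h i i.2⟩
  intro m
  induction m with
  | zero =>
    intro _
    rw [Finset.filter_false_of_mem fun i _ => by omega, Finset.prod_empty, mul_one]
    refine lawOf_congr fun ω _ => ?_
    simp [funext_iff]
  | succ m ih =>
    intro hm
    let i : Fin r := ⟨m, hm⟩
    have h1 : (Finset.univ.filter fun j : Fin r => j.val < m + 1) =
        insert i (Finset.univ.filter fun j : Fin r => j.val < m) := by
      ext j
      simp only [Finset.mem_filter, Finset.mem_univ, true_and, Finset.mem_insert, Fin.ext_iff, i]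
      omega
    have h2 : lawOf p (fun ω => (fun j : {j : Fin r // j.val < m + 1} => F ω j, B ω))
        (fun j => f j, b) = lawOf p (fun ω => (F ω i, past (F ω) i, B ω)) (f i, past f i, b) := by
      refine lawOf_congr fun ω _ => ?_
      simp only [Prod.mk.injEq, funext_iff, Subtype.forall, past, ← and_assoc]
      refine and_congr_left fun _ => ⟨fun h => ⟨h i (Nat.lt_succ_self m), fun j hj => h j
        (Nat.lt_succ_of_lt hj)⟩, fun h j hj => ?_⟩
      rcases Nat.lt_succ_iff_lt_or_eq.1 hj with hj | hj
      · exact h.2 j hj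
      · obtain rfl : j = i := Fin.ext hj
        exact h.1
    have h3 : lawOf p (fun ω => (fun j : {j : Fin r // j.val < m} => F ω j, B ω))
        (fun j => f j, b) = lawOf p (fun ω => (past (F ω) i, B ω)) (past f i, b) := by
      refine lawOf_congr fun ω _ => ?_
      simp only [Prod.mk.injEq, funext_iff, Subtype.forall, past]
      exact Iff.rfl
    rw [h2, hg, ← h3, ih (by omega), h1, Finset.prod_insert (by simp [i])]
    ring

/-- The chain rule for entropies. -/
lemma logLaw_chain (hp : ∀ ω, 0 ≤ p ω) {F : Ω → ∀ i, Fin (k i)} {B : Ω → β}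
    {g : ∀ i, ((j : Set.Iio i) → Fin (k j)) → β → Fin (k i) → ℝ}
    (hg : ∀ i v h b, lawOf p (fun ω => (F ω i, past (F ω) i, B ω)) (v, h, b) =
      lawOf p (fun ω => (past (F ω) i, B ω)) (h, b) * g i h b v) :
    logLaw p (fun ω => (F ω, B ω)) =
      logLaw p B + ∑ i, ∑ ω, p ω * Real.log (g i (past (F ω) i) (B ω) (F ω i)) := by
  rw [logLaw_pair_eq_add hp (g := fun b f => ∏ i, g i (past f i) b (f i))
    fun f b => lawOf_chain hg f b, Finset.sum_comm]
  simp only [← Finset.mul_sum]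
  refine congrArg _ (Finset.sum_congr rfl fun ω _ => ?_)
  by_cases hω : p ω = 0
  · simp [hω]
  have h2 := (lawOf_pos hp (fun ω => (F ω, B ω)) hω).ne'
  rw [lawOf_chain hg] at h2
  rw [Real.log_prod fun i _ => Finset.prod_ne_zero_iff.1 (right_ne_zero_of_mul h2) i
      (Finset.mem_univ i)]

end CondLaw

/-! ### The kernels of an auxiliary distribution -/

section Kernels

open scoped Classical

variable {X₁ X₂ Y₁ Y₂ : Type*} [Fintype X₁] [Fintype X₂] [Fintype Y₁] [Fintype Y₂] {r : ℕ}
  {k : Fin r → ℕ} {q : X₁ × X₂ → ℝ} {W : X₁ × X₂ → Y₁ × Y₂ → ℝ}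
  {p : AuxOutcome X₁ X₂ Y₁ Y₂ k → ℝ}

/-- The conditional law of `Fᵢ` given the past and the source of one terminal. -/
def auxKernel (p : AuxOutcome X₁ X₂ Y₁ Y₂ k → ℝ) (i : Fin r) :
    View (fun i => Fin (k i)) X₁ X₂ i → Fin (k i) → ℝ :=
  Sum.elim (condLaw p (fun ω => rvF ω i) fun ω => (past (rvF ω) i, rvX₁ ω))
    (condLaw p (fun ω => rvF ω i) fun ω => (past (rvF ω) i, rvX₂ ω))

/-- The probability that the speaker of round `i` gives to `Fᵢ`. -/
def speakerProb (p : AuxOutcome X₁ X₂ Y₁ Y₂ k → ℝ) (i : Fin r) (ω : AuxOutcome X₁ X₂ Y₁ Y₂ k) : ℝ :=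
  auxKernel p i (speaker i (past (rvF ω) i) (rvX₁ ω, rvX₂ ω)) (rvF ω i)

/-- The probability that the listener of round `i` gives to `Fᵢ`. -/
def listenerProb (p : AuxOutcome X₁ X₂ Y₁ Y₂ k → ℝ) (i : Fin r) (ω : AuxOutcome X₁ X₂ Y₁ Y₂ k) :
    ℝ :=
  auxKernel p i (listener i (past (rvF ω) i) (rvX₁ ω, rvX₂ ω)) (rvF ω i)

/-- The expected logarithm of the ratio of the probabilities that speaker and listener give to
`Fᵢ`. -/
def roundInfo (p : AuxOutcome X₁ X₂ Y₁ Y₂ k → ℝ) (i : Fin r) : ℝ :=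
  ∑ ω, p ω * (Real.log (speakerProb p i ω) - Real.log (listenerProb p i ω))

lemma speakerProb_pos (hp : ∀ ω, 0 ≤ p ω) (i : Fin r) {ω : AuxOutcome X₁ X₂ Y₁ Y₂ k}
    (hω : p ω ≠ 0) : 0 < speakerProb p i ω := by
  unfold speakerProb speaker
  split_ifs
  · exact condLaw_pos hp (fun ω => rvF ω i) (fun ω => (past (rvF ω) i, rvX₁ ω)) hω
  · exact condLaw_pos hp (fun ω => rvF ω i) (fun ω => (past (rvF ω) i, rvX₂ ω)) hω

lemma listenerProb_pos (hp : ∀ ω, 0 ≤ p ω) (i : Fin r) {ω : AuxOutcome X₁ X₂ Y₁ Y₂ k}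
    (hω : p ω ≠ 0) : 0 < listenerProb p i ω := by
  unfold listenerProb listener
  split_ifs
  · exact condLaw_pos hp (fun ω => rvF ω i) (fun ω => (past (rvF ω) i, rvX₂ ω)) hω
  · exact condLaw_pos hp (fun ω => rvF ω i) (fun ω => (past (rvF ω) i, rvX₁ ω)) hω

/-- By the Markov condition of the round, the conditional law of `F_i` given the past and both
sources is the kernel of the speaker. -/
lemma MemT.lawOf_round (hp : MemT q W p) (i : Fin r) (v : Fin (k i))
    (h : (j : Set.Iio i) → Fin (k j)) (x : X₁ × X₂) :
    lawOf p (fun ω => (rvF ω i, past (rvF ω) i, (rvX₁ ω, rvX₂ ω))) (v, h, x) =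
      lawOf p (fun ω => (past (rvF ω) i, (rvX₁ ω, rvX₂ ω))) (h, x) *
        auxKernel p i (speaker i h x) v := by
  obtain ⟨x₁, x₂⟩ := x
  unfold speaker
  split_ifs with hi
  · have h1 := (hp.markov_odd i hi).lawOf_eq_mul_condLaw hp.pmf.1 v (h, x₁) x₂
    refine Eq.trans (lawOf_congr fun ω _ => ?_) (h1.trans (congrArg (· * _)
      (lawOf_congr fun ω _ => ?_)))
    · simp only [Prod.mk.injEq, and_assoc]
    · simp only [Prod.mk.injEq, and_assoc]
  · have h1 := (hp.markov_even i (Nat.not_odd_iff_even.1 hi)).lawOf_eq_mul_condLaw hp.pmf.1 v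
      (h, x₂) x₁
    refine Eq.trans (lawOf_congr fun ω _ => ?_) (h1.trans (congrArg (· * _)
      (lawOf_congr fun ω _ => ?_)))
    · simp only [Prod.mk.injEq]; tauto
    · simp only [Prod.mk.injEq]; tauto

lemma MemT.lawOf_source (hp : MemT q W p) (hW : ∀ x, W x ∈ stdSimplex ℝ (Y₁ × Y₂)) :
    lawOf p (fun ω => (rvX₁ ω, rvX₂ ω)) = q := by
  have h1 := lawOf_lawOf p (fun ω => (rvX₁ ω, rvX₂ ω, rvY₁ ω, rvY₂ ω)) fun z => (z.1, z.2.1)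
  rw [hp.law_XY] at h1
  rw [← h1]
  funext x
  have h2 := (hW x).2
  simp only [lawOf, Fintype.sum_prod_type, target] at h2 ⊢
  rw [Finset.sum_eq_single x.1, Finset.sum_eq_single x.2]
  · simp only [if_true, ← Finset.mul_sum]
    rw [show ∑ y₁, ∑ y₂, W (x.1, x.2) (y₁, y₂) = 1 from h2, mul_one]
  · intro b _ hb
    simp [Prod.ext_iff, hb]
  · simp
  · intro b _ hb
    simp [Prod.ext_iff, hb]
  · simp

/-- The conditional law of `Y₁` given what terminal 1 knows. -/
def outKernel₁ (p : AuxOutcome X₁ X₂ Y₁ Y₂ k → ℝ) : (∀ i, Fin (k i)) × X₁ → Y₁ → ℝ :=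
  condLaw p rvY₁ fun ω => (rvF ω, rvX₁ ω)

/-- The conditional law of `Y₂` given what terminal 2 knows. -/
def outKernel₂ (p : AuxOutcome X₁ X₂ Y₁ Y₂ k → ℝ) : (∀ i, Fin (k i)) × X₂ → Y₂ → ℝ :=
  condLaw p rvY₂ fun ω => (rvF ω, rvX₂ ω)

/-- A distribution of `T(r)` is generated by interaction of the terminals. -/
lemma MemT.eq_prod (hp : MemT q W p) (hW : ∀ x, W x ∈ stdSimplex ℝ (Y₁ × Y₂))
    (ω : AuxOutcome X₁ X₂ Y₁ Y₂ k) :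
    p ω = q (rvX₁ ω, rvX₂ ω) * (∏ i, speakerProb p i ω) * (outKernel₁ p (rvF ω, rvX₁ ω) (rvY₁ ω) *
      outKernel₂ p (rvF ω, rvX₂ ω) (rvY₂ ω)) := by
  have h1 := lawOf_chain hp.lawOf_round (rvF ω) (rvX₁ ω, rvX₂ ω)
  rw [hp.lawOf_source hW] at h1
  -- `Y₁` is split off given all the other variables, so that for `Y₂` only independence from `X₁`
  -- is still needed.
  have h2 := (hp.markov_Y₂.map_right Prod.fst).lawOf_eq_mul_condLaw hp.pmf.1 (rvY₂ ω)
    (rvF ω, rvX₂ ω) (rvX₁ ω)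
  have h3 := hp.markov_Y₁.lawOf_eq_mul_condLaw hp.pmf.1 (rvY₁ ω) (rvF ω, rvX₁ ω) (rvX₂ ω, rvY₂ ω)
  have h4 : p ω = lawOf p (fun ω => (rvY₁ ω, (rvF ω, rvX₁ ω), (rvX₂ ω, rvY₂ ω)))
      (rvY₁ ω, (rvF ω, rvX₁ ω), (rvX₂ ω, rvY₂ ω)) := by
    rw [lawOf_congr (B := fun ω => ω) (b := ω)]
    · rw [lawOf_id]
    · intro ω' _
      simp only [Prod.ext_iff, rvY₁, rvF, rvX₁, rvX₂, rvY₂]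
      tauto
  have h5 : lawOf p (fun ω => ((rvF ω, rvX₁ ω), (rvX₂ ω, rvY₂ ω))) ((rvF ω, rvX₁ ω), rvX₂ ω, rvY₂ ω)
      = lawOf p (fun ω => (rvY₂ ω, (rvF ω, rvX₂ ω), rvX₁ ω)) (rvY₂ ω, (rvF ω, rvX₂ ω), rvX₁ ω) :=
    lawOf_congr fun ω' _ => by simp only [Prod.mk.injEq]; tauto
  have h6 : lawOf p (fun ω => ((rvF ω, rvX₂ ω), rvX₁ ω)) ((rvF ω, rvX₂ ω), rvX₁ ω) =
      lawOf p (fun ω => (rvF ω, (rvX₁ ω, rvX₂ ω))) (rvF ω, (rvX₁ ω, rvX₂ ω)) :=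
    lawOf_congr fun ω' _ => by simp only [Prod.mk.injEq]; tauto
  rw [h4, h3, h5]
  refine (congrArg (· * _) (h2.trans (congrArg (· * _) (h6.trans h1)))).trans ?_
  simp only [speakerProb, outKernel₁, outKernel₂]
  ring

/-- The chain rule expands both `p(f | x₁, x₂)` and `p(f | x₂)`. In even rounds the speaker is
terminal 2 and the factors coincide; in odd rounds the mean log-ratio is the information of the
round. -/
lemma MemT.natsInfo_fst (hp : MemT q W p) :
    natsInfo p rvX₁ rvF rvX₂ = ∑ i : Fin r with Odd (i.val + 1), roundInfo p i := by
  have h1 := logLaw_chain hp.pmf.1 hp.lawOf_round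
  have h2 := logLaw_chain hp.pmf.1 (F := rvF) (B := rvX₂) (g := fun i h x => condLaw p
    (fun ω => rvF ω i) (fun ω => (past (rvF ω) i, rvX₂ ω)) (h, x)) fun i v h x =>
      lawOf_pair_eq_mul_condLaw hp.pmf.1 _ _ _ _
  have h3 : logLaw p (fun ω => (rvX₁ ω, rvF ω, rvX₂ ω)) =
      logLaw p fun ω => (rvF ω, (rvX₁ ω, rvX₂ ω)) :=
    logLaw_congr fun ω ω' _ _ => by simp only [Prod.mk.injEq]; tauto
  have h4 : ∑ i, ∑ ω, p ω * Real.log (auxKernel p i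
        (speaker i (past (rvF ω) i) (rvX₁ ω, rvX₂ ω)) (rvF ω i)) -
      ∑ i, ∑ ω, p ω * Real.log (condLaw p (fun ω => rvF ω i) (fun ω => (past (rvF ω) i, rvX₂ ω))
        (past (rvF ω) i, rvX₂ ω) (rvF ω i)) =
      ∑ i : Fin r with Odd (i.val + 1), roundInfo p i := by
    rw [Finset.sum_filter, ← Finset.sum_sub_distrib]
    refine Finset.sum_congr rfl fun i _ => ?_
    split_ifs with hi
    · simp only [roundInfo, mul_sub, Finset.sum_sub_distrib, speakerProb, listenerProb, listener,
        if_pos hi]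
      rfl
    · simp only [speaker, if_neg hi]
      exact sub_self _
  rw [natsInfo, h3, h1, h2, ← h4]
  ring

lemma MemT.natsInfo_snd (hp : MemT q W p) :
    natsInfo p rvX₂ rvF rvX₁ = ∑ i : Fin r with Even (i.val + 1), roundInfo p i := by
  have h1 := logLaw_chain hp.pmf.1 hp.lawOf_round
  have h2 := logLaw_chain hp.pmf.1 (F := rvF) (B := rvX₁) (g := fun i h x => condLaw p
    (fun ω => rvF ω i) (fun ω => (past (rvF ω) i, rvX₁ ω)) (h, x)) fun i v h x =>
      lawOf_pair_eq_mul_condLaw hp.pmf.1 _ _ _ _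
  have h3 : logLaw p (fun ω => (rvX₂ ω, rvF ω, rvX₁ ω)) =
      logLaw p fun ω => (rvF ω, (rvX₁ ω, rvX₂ ω)) :=
    logLaw_congr fun ω ω' _ _ => by simp only [Prod.mk.injEq]; tauto
  have h5 : logLaw p (fun ω => (rvX₂ ω, rvX₁ ω)) = logLaw p fun ω => (rvX₁ ω, rvX₂ ω) :=
    logLaw_congr fun ω ω' _ _ => by simp only [Prod.mk.injEq]; tauto
  have h4 : ∑ i, ∑ ω, p ω * Real.log (auxKernel p i
        (speaker i (past (rvF ω) i) (rvX₁ ω, rvX₂ ω)) (rvF ω i)) -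
      ∑ i, ∑ ω, p ω * Real.log (condLaw p (fun ω => rvF ω i) (fun ω => (past (rvF ω) i, rvX₁ ω))
        (past (rvF ω) i, rvX₁ ω) (rvF ω i)) =
      ∑ i : Fin r with Even (i.val + 1), roundInfo p i := by
    rw [Finset.sum_filter, ← Finset.sum_sub_distrib]
    refine Finset.sum_congr rfl fun i _ => ?_
    split_ifs with hi
    · simp only [roundInfo, mul_sub, Finset.sum_sub_distrib, speakerProb, listenerProb, listener,
        if_neg (Nat.not_odd_iff_even.2 hi)]
      rfl
    · simp only [speaker, if_pos (Nat.not_even_iff_odd.1 hi)]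
      exact sub_self _
  rw [natsInfo, h3, h5, h1, h2, ← h4]
  ring

/-- The quantity is the mutual information of `F_i` and the speaker's source given the past and the
listener's source. Its sign keeps the exponents of the message alphabets nonnegative. -/
lemma MemT.roundInfo_nonneg (hp : MemT q W p) (i : Fin r) : 0 ≤ roundInfo p i := by
  have h1 := logLaw_pair_eq_add hp.pmf.1 (A := fun ω => rvF ω i)
    (B := fun ω => (past (rvF ω) i, (rvX₁ ω, rvX₂ ω)))
    (g := fun b v => auxKernel p i (speaker i b.1 b.2) v) fun v b => hp.lawOf_round i v b.1 b.2
  simp only [roundInfo, mul_sub, Finset.sum_sub_distrib]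
  by_cases hi : IsOdd i
  · have h2 := logLaw_pair_eq_add hp.pmf.1
      (lawOf_pair_eq_mul_condLaw hp.pmf.1 (fun ω => rvF ω i) fun ω => (past (rvF ω) i, rvX₂ ω))
    have h3 := logLaw_submodular hp.pmf (fun ω => rvF ω i) (fun ω => (past (rvF ω) i, rvX₂ ω)) rvX₁
    have h4 : logLaw p (fun ω => (rvF ω i, (past (rvF ω) i, rvX₂ ω), rvX₁ ω)) =
        logLaw p (fun ω => (rvF ω i, past (rvF ω) i, (rvX₁ ω, rvX₂ ω))) :=
      logLaw_congr fun ω ω' _ _ => by simp only [Prod.mk.injEq]; tauto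
    have h5 : logLaw p (fun ω => ((past (rvF ω) i, rvX₂ ω), rvX₁ ω)) =
        logLaw p (fun ω => (past (rvF ω) i, (rvX₁ ω, rvX₂ ω))) :=
      logLaw_congr fun ω ω' _ _ => by simp only [Prod.mk.injEq]; tauto
    have h6 : ∑ ω, p ω * Real.log (listenerProb p i ω) = ∑ ω, p ω * Real.log (condLaw p
        (fun ω => rvF ω i) (fun ω => (past (rvF ω) i, rvX₂ ω)) (past (rvF ω) i, rvX₂ ω)
        (rvF ω i)) := by
      simp only [listenerProb, listener, if_pos hi]
      rfl
    rw [h6]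
    simp only [speakerProb]
    linarith
  · have h2 := logLaw_pair_eq_add hp.pmf.1
      (lawOf_pair_eq_mul_condLaw hp.pmf.1 (fun ω => rvF ω i) fun ω => (past (rvF ω) i, rvX₁ ω))
    have h3 := logLaw_submodular hp.pmf (fun ω => rvF ω i) (fun ω => (past (rvF ω) i, rvX₁ ω)) rvX₂
    have h4 : logLaw p (fun ω => (rvF ω i, (past (rvF ω) i, rvX₁ ω), rvX₂ ω)) =
        logLaw p (fun ω => (rvF ω i, past (rvF ω) i, (rvX₁ ω, rvX₂ ω))) :=
      logLaw_congr fun ω ω' _ _ => by simp only [Prod.mk.injEq]; tauto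
    have h5 : logLaw p (fun ω => ((past (rvF ω) i, rvX₁ ω), rvX₂ ω)) =
        logLaw p (fun ω => (past (rvF ω) i, (rvX₁ ω, rvX₂ ω))) :=
      logLaw_congr fun ω ω' _ _ => by simp only [Prod.mk.injEq]; tauto
    have h6 : ∑ ω, p ω * Real.log (listenerProb p i ω) = ∑ ω, p ω * Real.log (condLaw p
        (fun ω => rvF ω i) (fun ω => (past (rvF ω) i, rvX₁ ω)) (past (rvF ω) i, rvX₁ ω)
        (rvF ω i)) := by
      simp only [listenerProb, listener, if_neg hi]
      rfl
    rw [h6]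
    simp only [speakerProb]
    linarith

end Kernels

/-! ### The law of large numbers -/

section LargeNumbers

open scoped Classical

variable {Z β : Type*} [Fintype Z] {p : Z → ℝ} {n : ℕ}

lemma sum_iid_mul_pair {φ : Z → ℝ} (hφ : ∑ a, p a * φ a = 0) {s t : Fin n} (hst : s ≠ t) :
    ∑ z, iid p n z * (φ (z s) * φ (z t)) = 0 := by
  have h : ∀ z : Fin n → Z, iid p n z * (φ (z s) * φ (z t)) =
      ∏ u, p (z u) * ((if u = s then φ (z u) else 1) * if u = t then φ (z u) else 1) := by
    intro z
    rw [Finset.prod_mul_distrib, Finset.prod_mul_distrib]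
    simp [iid]
  simp only [h]
  rw [sum_prod_apply fun u a => p a * ((if u = s then φ a else 1) * if u = t then φ a else 1)]
  refine Finset.prod_eq_zero (Finset.mem_univ s) ?_
  simpa [hst] using hφ

/-- The variance of a sum of independent centered variables. -/
lemma sum_iid_mul_sq (hp : ∑ a, p a = 1) {φ : Z → ℝ} (hφ : ∑ a, p a * φ a = 0) :
    ∑ z, iid p n z * (∑ t, φ (z t)) ^ 2 = n * ∑ a, p a * φ a ^ 2 := by
  have h0 : ∀ z : Fin n → Z, iid p n z * (∑ t, φ (z t)) ^ 2 =
      ∑ s, ∑ t, iid p n z * (φ (z s) * φ (z t)) := by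
    intro z
    rw [sq, Finset.sum_mul_sum]
    simp only [Finset.mul_sum]
  simp only [h0]
  rw [Finset.sum_comm]
  have h : ∀ s : Fin n, ∑ z : Fin n → Z, ∑ t, iid p n z * (φ (z s) * φ (z t)) =
      ∑ a, p a * (φ a * φ a) := by
    intro s
    rw [Finset.sum_comm, Finset.sum_eq_single s]
    · exact sum_iid_mul_apply hp s fun a => φ a * φ a
    · exact fun t _ hts => sum_iid_mul_pair hφ hts.symm
    · simp
  simp [h, sq]

/-- The variance is of order `n`; the elementary bound `|x| ≤ √n / 2 + x² / (2√n)` turns it into a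
first moment of order `√n`. -/
lemma sum_iid_mul_abs_le (hp : p ∈ stdSimplex ℝ Z) {φ : Z → ℝ} (hφ : ∑ a, p a * φ a = 0)
    (hn : n ≠ 0) : ∑ z, iid p n z * |∑ t, φ (z t)| ≤ √n * ((1 + ∑ a, p a * φ a ^ 2) / 2) := by
  have hs : (0 : ℝ) < √n := Real.sqrt_pos.2 (by exact_mod_cast Nat.pos_of_ne_zero hn)
  have hs2 : √(n : ℝ) * √n = n := Real.mul_self_sqrt (Nat.cast_nonneg n)
  have h : ∀ x : ℝ, |x| ≤ √n / 2 + x ^ 2 / (2 * √n) := by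
    intro x
    rw [div_add_div _ _ two_ne_zero (by positivity), le_div_iff₀ (by positivity), ← sq_abs]
    nlinarith [sq_nonneg (√n - |x|)]
  refine (Finset.sum_le_sum fun z _ => mul_le_mul_of_nonneg_left (h _)
    ((iid_mem hp).1 z)).trans (le_of_eq ?_)
  simp only [mul_add, Finset.sum_add_distrib, ← mul_div_assoc, ← Finset.sum_div, ← Finset.sum_mul]
  rw [(iid_mem hp).2, sum_iid_mul_sq hp.2 hφ]
  field_simp
  rw [show √(n : ℝ) ^ 2 = n by rw [sq, hs2]]
  ring

/-- Chebyshev's inequality in a weak form. -/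
lemma sum_iid_mul_ite_le (hp : p ∈ stdSimplex ℝ Z) {φ : Z → ℝ} (hφ : ∑ a, p a * φ a = 0)
    (hn : n ≠ 0) {δ : ℝ} (hδ : 0 < δ) :
    ∑ z, iid p n z * (if ∑ t, φ (z t) ≤ n * δ then 0 else 1) ≤
      (1 + ∑ a, p a * φ a ^ 2) / (2 * δ) / √n := by
  have hn' : (0 : ℝ) < n := by exact_mod_cast Nat.pos_of_ne_zero hn
  have hs : (0 : ℝ) < √n := Real.sqrt_pos.2 hn'
  have h1 : ∀ z : Fin n → Z, iid p n z * (if ∑ t, φ (z t) ≤ n * δ then 0 else 1) ≤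
      iid p n z * |∑ t, φ (z t)| / (n * δ) := by
    intro z
    rw [mul_div_assoc]
    refine mul_le_mul_of_nonneg_left ?_ ((iid_mem hp).1 z)
    split_ifs with h
    · positivity
    · rw [le_div_iff₀ (by positivity), one_mul]
      exact (not_le.1 h).le.trans (le_abs_self _)
  refine (Finset.sum_le_sum fun z _ => h1 z).trans ?_
  rw [← Finset.sum_div, div_le_iff₀ (by positivity)]
  refine (sum_iid_mul_abs_le hp hφ hn).trans (le_of_eq ?_)
  field_simp
  rw [Real.sq_sqrt hn'.le, mul_comm]

/-- The empirical distribution converges to the law. -/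
lemma sum_iid_mul_tvDist_le [Fintype β] (hp : p ∈ stdSimplex ℝ Z) (A : Z → β) (hn : n ≠ 0) :
    ∑ z, iid p n z * tvDist (empirical fun t => A (z t)) (lawOf p A) ≤
      Fintype.card β / √n := by
  have hn' : (0 : ℝ) < n := by exact_mod_cast Nat.pos_of_ne_zero hn
  have hs : (0 : ℝ) < √n := Real.sqrt_pos.2 hn'
  have key : ∀ b, ∑ z : Fin n → Z, iid p n z * |empirical (fun t => A (z t)) b - lawOf p A b| ≤
      1 / √n := by
    intro b
    let φ : Z → ℝ := fun a => (if A a = b then 1 else 0) - lawOf p A b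
    have hφ : ∑ a, p a * φ a = 0 := by
      simp only [φ, mul_sub, Finset.sum_sub_distrib, ← Finset.sum_mul, hp.2]
      simp [lawOf]
    have hV : ∑ a, p a * φ a ^ 2 ≤ 1 := by
      rw [← hp.2]
      refine Finset.sum_le_sum fun a _ => mul_le_of_le_one_right (hp.1 a) ?_
      have h0 := lawOf_nonneg hp.1 A b
      have h1 := lawOf_le_one hp A b
      simp only [φ]
      split_ifs <;> nlinarith
    have h1 : ∀ z : Fin n → Z, empirical (fun t => A (z t)) b - lawOf p A b =
        (∑ t, φ (z t)) / n := by
      intro z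
      simp only [φ, empirical_eq_sum, Finset.sum_sub_distrib]
      simp only [Finset.sum_const, Finset.card_univ, Fintype.card_fin, nsmul_eq_mul]
      field_simp
    simp only [h1, abs_div, Nat.abs_cast, ← mul_div_assoc, ← Finset.sum_div]
    rw [div_le_iff₀ hn']
    refine (sum_iid_mul_abs_le hp hφ hn).trans ?_
    field_simp
    rw [Real.sq_sqrt hn'.le]
    nlinarith
  simp only [tvDist]
  calc ∑ z : Fin n → Z, iid p n z * (1 / 2 * ∑ b, |empirical (fun t => A (z t)) b - lawOf p A b|)
      = 1 / 2 * ∑ b, ∑ z : Fin n → Z,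
          iid p n z * |empirical (fun t => A (z t)) b - lawOf p A b| := by
        rw [Finset.sum_comm, Finset.mul_sum]
        refine Finset.sum_congr rfl fun z _ => ?_
        rw [← Finset.mul_sum]
        ring
    _ ≤ 1 / 2 * ∑ _b : β, 1 / √n :=
        mul_le_mul_of_nonneg_left (Finset.sum_le_sum fun b _ => key b) (by norm_num)
    _ ≤ Fintype.card β / √n := by
        simp only [Finset.sum_const, Finset.card_univ, nsmul_eq_mul, mul_one_div]
        have : 0 ≤ (Fintype.card β : ℝ) / √n := by positivity
        linarith

lemma tvDist_nonneg [Fintype β] (p q : β → ℝ) : 0 ≤ tvDist p q :=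
  mul_nonneg (by norm_num) (Finset.sum_nonneg fun _ _ => abs_nonneg _)

lemma tvDist_le_one [Fintype β] {p q : β → ℝ} (hp : p ∈ stdSimplex ℝ β) (hq : q ∈ stdSimplex ℝ β) :
    tvDist p q ≤ 1 := by
  have h : ∑ b, |p b - q b| ≤ ∑ b, (p b + q b) := Finset.sum_le_sum fun b _ => by
    rw [abs_le]
    constructor <;> linarith [hp.1 b, hq.1 b]
  rw [Finset.sum_add_distrib, hp.2, hq.2] at h
  unfold tvDist
  linarith

end LargeNumbers

/-! ### Deterministic encoders -/

section DetCode

variable {X₁ X₂ Y₁ Y₂ : Type*} [Fintype X₁] [Fintype X₂] [Fintype Y₁] [Fintype Y₂] {r n : ℕ}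
  {M : Fin r → ℕ}

lemma indicator_mem_stdSimplex {α : Type*} [Fintype α] [DecidableEq α] (a : α) :
    (fun b => if b = a then (1 : ℝ) else 0) ∈ stdSimplex ℝ α :=
  ⟨fun b => by dsimp only; split_ifs <;> norm_num, by simp⟩

/-- The code with given deterministic encoders. -/
def detCode (e₁ : ∀ i, ((j : Set.Iio i) → Fin (M j)) → (Fin n → X₁) → Fin (M i))
    (e₂ : ∀ i, ((j : Set.Iio i) → Fin (M j)) → (Fin n → X₂) → Fin (M i))
    (d₁ : (∀ i, Fin (M i)) → (Fin n → X₁) → (Fin n → Y₁) → ℝ)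
    (d₂ : (∀ i, Fin (M i)) → (Fin n → X₂) → (Fin n → Y₂) → ℝ)
    (hd₁ : ∀ c x, d₁ c x ∈ stdSimplex ℝ (Fin n → Y₁))
    (hd₂ : ∀ c x, d₂ c x ∈ stdSimplex ℝ (Fin n → Y₂)) : Code X₁ X₂ Y₁ Y₂ r n where
  msg := M
  enc₁ i h x v := if v = e₁ i h x then 1 else 0
  enc₂ i h x v := if v = e₂ i h x then 1 else 0
  dec₁ := d₁
  dec₂ := d₂
  enc₁_mem _ _ _ _ := indicator_mem_stdSimplex _
  enc₂_mem _ _ _ _ := indicator_mem_stdSimplex _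
  dec₁_mem := hd₁
  dec₂_mem := hd₂

/-- Given the sources, exactly one transcript is consistent with deterministic encoders in every
round, so the sum over transcripts collapses to it. The decoders may still be random. -/
lemma sum_detCode_law {e₁ : ∀ i, ((j : Set.Iio i) → Fin (M j)) → (Fin n → X₁) → Fin (M i)}
    {e₂ : ∀ i, ((j : Set.Iio i) → Fin (M j)) → (Fin n → X₂) → Fin (M i)}
    {d₁ : (∀ i, Fin (M i)) → (Fin n → X₁) → (Fin n → Y₁) → ℝ}
    {d₂ : (∀ i, Fin (M i)) → (Fin n → X₂) → (Fin n → Y₂) → ℝ}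
    (hd₁ : ∀ c x, d₁ c x ∈ stdSimplex ℝ (Fin n → Y₁))
    (hd₂ : ∀ c x, d₂ c x ∈ stdSimplex ℝ (Fin n → Y₂))
    {c : (Fin n → X₁) × (Fin n → X₂) → ∀ i, Fin (M i)}
    (hc : ∀ a i, c a i = if IsOdd i then e₁ i (fun j => c a j) a.1 else e₂ i (fun j => c a j) a.2)
    (q : X₁ × X₂ → ℝ) (ψ : (Fin n → X₁) → (Fin n → X₂) → (Fin n → Y₁) → (Fin n → Y₂) → ℝ) :
    ∑ ω, (detCode e₁ e₂ d₁ d₂ hd₁ hd₂).law q ω * ψ ω.1 ω.2.1 ω.2.2.2.1 ω.2.2.2.2 =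
      ∑ a : (Fin n → X₁) × (Fin n → X₂), (∏ t, q (a.1 t, a.2 t)) * ∑ y₁, ∑ y₂,
        d₁ (c a) a.1 y₁ * d₂ (c a) a.2 y₂ * ψ a.1 a.2 y₁ y₂ := by
  have hturn : ∀ x₁ x₂ (c' : ∀ i, Fin (M i)),
      (∏ i : Fin r, if IsOdd i then (if c' i = e₁ i (fun j => c' j) x₁ then (1 : ℝ) else 0)
        else if c' i = e₂ i (fun j => c' j) x₂ then 1 else 0) =
        if c' = c (x₁, x₂) then 1 else 0 := by
    intro x₁ x₂ c'
    have hiff : c' = c (x₁, x₂) ↔ ∀ i, c' i =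
        if IsOdd i then e₁ i (fun j => c' j) x₁ else e₂ i (fun j => c' j) x₂ := by
      let step : ∀ i, ((j : Set.Iio i) → Fin (M j)) → Fin (M i) := fun i h =>
        if IsOdd i then e₁ i h x₁ else e₂ i h x₂
      have h1 : build (G := fun i => Fin (M i)) step = c (x₁, x₂) :=
        (eq_build_iff (G := fun i => Fin (M i)) step _).2 fun i => (hc (x₁, x₂) i).symm
      rw [← h1, eq_comm, eq_build_iff]
      exact forall_congr' fun i => eq_comm
    have h2 : ∀ i : Fin r, (if IsOdd i then (if c' i = e₁ i (fun j => c' j) x₁ then (1 : ℝ) else 0)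
        else if c' i = e₂ i (fun j => c' j) x₂ then 1 else 0) =
        if c' i = (if IsOdd i then e₁ i (fun j => c' j) x₁ else e₂ i (fun j => c' j) x₂)
          then 1 else 0 := by
      intro i
      by_cases hi : IsOdd i
      · simp only [if_pos hi]
      · simp only [if_neg hi]
    simp only [h2]
    by_cases h : c' = c (x₁, x₂)
    · rw [if_pos h]
      exact Finset.prod_eq_one fun i _ => if_pos (hiff.1 h i)
    · rw [if_neg h]
      have h3 := mt hiff.2 h
      push Not at h3
      obtain ⟨i, hi⟩ := h3
      exact Finset.prod_eq_zero (Finset.mem_univ i) (if_neg hi)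
  have hlaw : ∀ x₁ x₂ (c' : ∀ i, Fin (M i)) y₁ y₂,
      (detCode e₁ e₂ d₁ d₂ hd₁ hd₂).law q (x₁, x₂, c', y₁, y₂) = (∏ t, q (x₁ t, x₂ t)) *
        (if c' = c (x₁, x₂) then 1 else 0) * d₁ c' x₁ y₁ * d₂ c' x₂ y₂ := by
    intro x₁ x₂ c' y₁ y₂
    rw [← hturn]
    rfl
  simp only [Fintype.sum_prod_type]
  refine Finset.sum_congr rfl fun x₁ _ => Finset.sum_congr rfl fun x₂ _ => ?_
  refine (Finset.sum_eq_single (c (x₁, x₂)) (fun c' _ hc' => ?_) fun h =>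
    absurd (Finset.mem_univ _) h).trans ?_
  · refine Finset.sum_eq_zero fun y₁ _ => Finset.sum_eq_zero fun y₂ _ => ?_
    refine (congrArg (· * _) (hlaw x₁ x₂ c' y₁ y₂)).trans ?_
    rw [if_neg hc']
    ring
  · simp only [Finset.mul_sum]
    refine Finset.sum_congr rfl fun y₁ _ => Finset.sum_congr rfl fun y₂ _ => ?_
    refine (congrArg (· * _) (hlaw x₁ x₂ _ y₁ y₂)).trans ?_
    rw [if_pos rfl]
    ring

end DetCode

/-! ### Achievability -/

section Block

variable {X₁ X₂ Y₁ Y₂ : Type*} [Fintype X₁] [Fintype X₂] [Fintype Y₁] [Fintype Y₂] {r n : ℕ}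
  {k : Fin r → ℕ} {q : X₁ × X₂ → ℝ} {W : X₁ × X₂ → Y₁ × Y₂ → ℝ}
  {p : AuxOutcome X₁ X₂ Y₁ Y₂ k → ℝ}

/-- The view at time `t`. -/
def letterView (t : Fin n) {i : Fin r} :
    View (fun i => Fin n → Fin (k i)) (Fin n → X₁) (Fin n → X₂) i →
      View (fun i => Fin (k i)) X₁ X₂ i :=
  Sum.map (fun v => (fun j => v.1 j t, v.2 t)) fun v => (fun j => v.1 j t, v.2 t)

/-- The product of the kernels of an auxiliary distribution. -/
def blockKernel (p : AuxOutcome X₁ X₂ Y₁ Y₂ k → ℝ) (n : ℕ) (i : Fin r)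
    (v : View (fun i => Fin n → Fin (k i)) (Fin n → X₁) (Fin n → X₂) i) (u : Fin n → Fin (k i)) :
    ℝ :=
  ∏ t, auxKernel p i (letterView t v) (u t)

lemma auxKernel_mem (hp : ∀ ω, 0 ≤ p ω) [∀ i, Nonempty (Fin (k i))] (i : Fin r)
    (v : View (fun i => Fin (k i)) X₁ X₂ i) : auxKernel p i v ∈ stdSimplex ℝ (Fin (k i)) := by
  cases v
  · exact condLaw_mem hp _ _ _
  · exact condLaw_mem hp _ _ _

lemma blockKernel_mem (hp : ∀ ω, 0 ≤ p ω) [∀ i, Nonempty (Fin (k i))] (i : Fin r)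
    (v : View (fun i => Fin n → Fin (k i)) (Fin n → X₁) (Fin n → X₂) i) :
    blockKernel p n i v ∈ stdSimplex ℝ (Fin n → Fin (k i)) :=
  prod_mem_stdSimplex fun t => auxKernel_mem hp i (letterView t v)

/-- Blocks of letters and letters of blocks. -/
def blockEquiv (X₁ X₂ Y₁ Y₂ : Type*) (k : Fin r → ℕ) (n : ℕ) :
    (Fin n → AuxOutcome X₁ X₂ Y₁ Y₂ k) ≃
      (∀ i, Fin n → Fin (k i)) × (Fin n → X₁) × (Fin n → X₂) × (Fin n → Y₁) × (Fin n → Y₂) where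
  toFun z := (fun i t => rvF (z t) i, fun t => rvX₁ (z t), fun t => rvX₂ (z t),
    fun t => rvY₁ (z t), fun t => rvY₂ (z t))
  invFun w t := (fun i => w.1 i t, w.2.1 t, w.2.2.1 t, w.2.2.2.1 t, w.2.2.2.2 t)
  left_inv _ := rfl
  right_inv _ := rfl

lemma blockKernel_speaker (z : Fin n → AuxOutcome X₁ X₂ Y₁ Y₂ k) (i : Fin r) :
    blockKernel p n i (speaker i (fun j t => rvF (z t) j)
      (fun t => rvX₁ (z t), fun t => rvX₂ (z t))) (fun t => rvF (z t) i) =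
      ∏ t, speakerProb p i (z t) := by
  refine Finset.prod_congr rfl fun t _ => ?_
  by_cases hi : IsOdd i
  · simp only [speakerProb, speaker, if_pos hi]
    rfl
  · simp only [speakerProb, speaker, if_neg hi]
    rfl

lemma blockKernel_listener (z : Fin n → AuxOutcome X₁ X₂ Y₁ Y₂ k) (i : Fin r) :
    blockKernel p n i (listener i (fun j t => rvF (z t) j)
      (fun t => rvX₁ (z t), fun t => rvX₂ (z t))) (fun t => rvF (z t) i) =
      ∏ t, listenerProb p i (z t) := by
  refine Finset.prod_congr rfl fun t _ => ?_
  by_cases hi : IsOdd i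
  · simp only [listenerProb, listener, if_pos hi]
    rfl
  · simp only [listenerProb, listener, if_neg hi]
    rfl

/-- The product of the output kernels of terminal 1. -/
def blockOut₁ (p : AuxOutcome X₁ X₂ Y₁ Y₂ k → ℝ) (n : ℕ) (g : ∀ i, Fin n → Fin (k i))
    (x : Fin n → X₁) (y : Fin n → Y₁) : ℝ :=
  ∏ t, outKernel₁ p (fun i => g i t, x t) (y t)

/-- The product of the output kernels of terminal 2. -/
def blockOut₂ (p : AuxOutcome X₁ X₂ Y₁ Y₂ k → ℝ) (n : ℕ) (g : ∀ i, Fin n → Fin (k i))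
    (x : Fin n → X₂) (y : Fin n → Y₂) : ℝ :=
  ∏ t, outKernel₂ p (fun i => g i t, x t) (y t)

lemma blockOut₁_mem (hp : ∀ ω, 0 ≤ p ω) [Nonempty Y₁] (g : ∀ i, Fin n → Fin (k i))
    (x : Fin n → X₁) : blockOut₁ p n g x ∈ stdSimplex ℝ (Fin n → Y₁) :=
  prod_mem_stdSimplex fun _ => condLaw_mem hp _ _ _

lemma blockOut₂_mem (hp : ∀ ω, 0 ≤ p ω) [Nonempty Y₂] (g : ∀ i, Fin n → Fin (k i))
    (x : Fin n → X₂) : blockOut₂ p n g x ∈ stdSimplex ℝ (Fin n → Y₂) :=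
  prod_mem_stdSimplex fun _ => condLaw_mem hp _ _ _

/-- Independent samples of a distribution of `T(r)` are generated by interaction. -/
lemma MemT.iid_eq (hp : MemT q W p) (hW : ∀ x, W x ∈ stdSimplex ℝ (Y₁ × Y₂))
    (g : ∀ i, Fin n → Fin (k i)) (x₁ : Fin n → X₁) (x₂ : Fin n → X₂) (y₁ : Fin n → Y₁)
    (y₂ : Fin n → Y₂) :
    iid p n ((blockEquiv X₁ X₂ Y₁ Y₂ k n).symm (g, x₁, x₂, y₁, y₂)) =
      (∏ t, q (x₁ t, x₂ t)) * (∏ i, blockKernel p n i (speaker i (fun j => g j) (x₁, x₂)) (g i)) *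
        (blockOut₁ p n g x₁ y₁ * blockOut₂ p n g x₂ y₂) := by
  have h1 := fun i => blockKernel_speaker (p := p)
    ((blockEquiv X₁ X₂ Y₁ Y₂ k n).symm (g, x₁, x₂, y₁, y₂)) i
  have h2 : ∀ i, blockKernel p n i (speaker i (fun j => g j) (x₁, x₂)) (g i) = _ := h1
  simp only [h2, iid, hp.eq_prod hW, Finset.prod_mul_distrib]
  rw [Finset.prod_comm]
  rfl

/-- Expectations over independent copies take the form of the ideal interaction on blocks, in which
the one-shot bound is stated. -/
lemma MemT.sum_iid_eq (hp : MemT q W p) (hW : ∀ x, W x ∈ stdSimplex ℝ (Y₁ × Y₂))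
    (φ : (∀ i, Fin n → Fin (k i)) × (Fin n → X₁) × (Fin n → X₂) × (Fin n → Y₁) × (Fin n → Y₂) → ℝ) :
    ∑ z, iid p n z * φ (blockEquiv X₁ X₂ Y₁ Y₂ k n z) =
      ∑ a : (Fin n → X₁) × (Fin n → X₂), (∏ t, q (a.1 t, a.2 t)) * ∑ g : ∀ i, Fin n → Fin (k i),
        (∏ i, blockKernel p n i (speaker i (fun j => g j) a) (g i)) * ∑ y₁, ∑ y₂,
          blockOut₁ p n g a.1 y₁ * blockOut₂ p n g a.2 y₂ * φ (g, a.1, a.2, y₁, y₂) := by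
  rw [← Equiv.sum_comp (blockEquiv X₁ X₂ Y₁ Y₂ k n).symm]
  simp only [Equiv.apply_symm_apply, Finset.mul_sum]
  rw [Fintype.sum_prod_type, Finset.sum_comm (s := Finset.univ (α := (Fin n → X₁) × (Fin n → X₂)))]
  refine Finset.sum_congr rfl fun g _ => ?_
  simp only [Fintype.sum_prod_type, hp.iid_eq hW]
  refine Finset.sum_congr rfl fun x₁ _ => Finset.sum_congr rfl fun x₂ _ =>
    Finset.sum_congr rfl fun y₁ _ => Finset.sum_congr rfl fun y₂ _ => ?_
  ring

lemma Code.msgEntropy_le (κ : Code X₁ X₂ Y₁ Y₂ r n) (hq : q ∈ stdSimplex ℝ (X₁ × X₂)) (i : Fin r)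
    (hi : 0 < κ.msg i) : κ.msgEntropy q i ≤ Real.log (κ.msg i) / Real.log 2 := by
  have : Nonempty (Fin (κ.msg i)) := ⟨⟨0, hi⟩⟩
  have h := neg_log_card_le_logLaw (κ.law_mem hq) (fun ω => ω.2.2.1 i)
  rw [Fintype.card_fin] at h
  rw [Code.msgEntropy, entropy_eq]
  exact div_le_div_of_nonneg_right (by linarith) (Real.log_nonneg (by norm_num))

/-- Rounding up at most doubles a number that is at least 1. -/
lemma log_natCeil_exp_le {x : ℝ} (hx : 0 ≤ x) :
    Real.log (⌈Real.exp x⌉₊ : ℝ) ≤ x + Real.log 2 := by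
  have h1 := Real.one_le_exp hx
  have h2 := (Nat.ceil_lt_add_one (Real.exp_pos x).le).le
  have h3 : (0 : ℝ) < ⌈Real.exp x⌉₊ := by exact_mod_cast Nat.ceil_pos.2 (Real.exp_pos x)
  rw [← Real.log_exp x, ← Real.log_mul (Real.exp_pos _).ne' two_ne_zero, Real.log_exp]
  exact Real.log_le_log h3 (by linarith)

/-- The log-ratio of the probabilities of speaker and listener, centered. -/
def centeredInfo (p : AuxOutcome X₁ X₂ Y₁ Y₂ k → ℝ) (i : Fin r) (ω : AuxOutcome X₁ X₂ Y₁ Y₂ k) : ℝ :=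
  Real.log (speakerProb p i ω) - Real.log (listenerProb p i ω) - roundInfo p i

lemma sum_mul_centeredInfo (hp : ∑ ω, p ω = 1) (i : Fin r) :
    ∑ ω, p ω * centeredInfo p i ω = 0 := by
  simp only [centeredInfo, mul_sub _ _ (roundInfo p i), Finset.sum_sub_distrib, ← Finset.sum_mul,
    hp]
  simp [roundInfo]

/-- The ratio of the probabilities of speaker and listener is small for typical sequences. -/
lemma prod_speakerProb_le (hp : ∀ ω, 0 ≤ p ω) (i : Fin r) {z : Fin n → AuxOutcome X₁ X₂ Y₁ Y₂ k}
    (hz : iid p n z ≠ 0) {δ : ℝ} (h : ∑ t, centeredInfo p i (z t) ≤ n * δ) :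
    ∏ t, speakerProb p i (z t) ≤
      Real.exp (n * (roundInfo p i + δ)) * ∏ t, listenerProb p i (z t) := by
  have hz' : ∀ t, p (z t) ≠ 0 := fun t => Finset.prod_ne_zero_iff.1 hz t (Finset.mem_univ t)
  have h1 : 0 < ∏ t, speakerProb p i (z t) :=
    Finset.prod_pos fun t _ => speakerProb_pos hp i (hz' t)
  have h2 : 0 < ∏ t, listenerProb p i (z t) :=
    Finset.prod_pos fun t _ => listenerProb_pos hp i (hz' t)
  rw [← Real.log_le_log_iff h1 (by positivity), Real.log_mul (Real.exp_pos _).ne' h2.ne',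
    Real.log_exp, Real.log_prod fun t _ => (speakerProb_pos hp i (hz' t)).ne',
    Real.log_prod fun t _ => (listenerProb_pos hp i (hz' t)).ne']
  simp only [centeredInfo, Finset.sum_sub_distrib] at h
  simp only [Finset.sum_const, Finset.card_univ, Fintype.card_fin, nsmul_eq_mul] at h
  linarith

/-- The expected cost of the ideal interaction. -/
lemma MemT.sum_iid_cost_le (hp : MemT q W p) (hn : n ≠ 0) {δ : ℝ} (hδ : 0 < δ) {M : Fin r → ℕ}
    (hM : ∀ i, Real.exp (n * (roundInfo p i + 2 * δ)) ≤ M i) :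
    ∑ z : Fin n → AuxOutcome X₁ X₂ Y₁ Y₂ k, iid p n z *
      (tvDist (empirical fun t => (rvX₁ (z t), rvX₂ (z t), rvY₁ (z t), rvY₂ (z t))) (target q W) +
        ∑ i, (Real.exp (-(n * δ)) + if ∏ t, speakerProb p i (z t) ≤
          Real.exp (-(n * δ)) * M i * ∏ t, listenerProb p i (z t) then 0 else 1)) ≤
      (Fintype.card (X₁ × X₂ × Y₁ × Y₂) +
        ∑ i, (1 + ∑ ω, p ω * centeredInfo p i ω ^ 2) / (2 * δ)) / √n +
        r * Real.exp (-(n * δ)) := by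
  have h1 := sum_iid_mul_tvDist_le hp.pmf
    (fun ω => (rvX₁ ω, rvX₂ ω, rvY₁ ω, rvY₂ ω)) hn
  rw [hp.law_XY] at h1
  have h2 : ∀ i, ∑ z : Fin n → AuxOutcome X₁ X₂ Y₁ Y₂ k, iid p n z *
      (Real.exp (-(n * δ)) + if ∏ t, speakerProb p i (z t) ≤
          Real.exp (-(n * δ)) * M i * ∏ t, listenerProb p i (z t) then 0 else 1) ≤
      Real.exp (-(n * δ)) + (1 + ∑ ω, p ω * centeredInfo p i ω ^ 2) / (2 * δ) / √n := by
    intro i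
    simp only [mul_add, Finset.sum_add_distrib, ← Finset.sum_mul]
    rw [(iid_mem hp.pmf).2, one_mul]
    refine add_le_add le_rfl (le_trans (Finset.sum_le_sum fun z _ => ?_)
      (sum_iid_mul_ite_le hp.pmf (sum_mul_centeredInfo hp.pmf.2 i) hn hδ))
    by_cases hz : iid p n z = 0
    · simp [hz]
    refine mul_le_mul_of_nonneg_left ?_ ((iid_mem hp.pmf).1 z)
    by_cases h : ∑ t, centeredInfo p i (z t) ≤ n * δ
    · have h3 := prod_speakerProb_le hp.pmf.1 i hz h
      -- One `δ` of the rate excess covers the fluctuation of the log-ratio; the other pays for the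
      -- mismatch parameter `exp (-(n δ))`.
      have h4 : Real.exp (n * (roundInfo p i + δ)) ≤ Real.exp (-(n * δ)) * M i := by
        refine le_trans (le_of_eq ?_) (mul_le_mul_of_nonneg_left (hM i) (Real.exp_pos _).le)
        rw [← Real.exp_add]
        congr 1
        ring
      have h5 : 0 ≤ ∏ t, listenerProb p i (z t) := Finset.prod_nonneg fun t _ =>
        (listenerProb_pos hp.pmf.1 i
          (Finset.prod_ne_zero_iff.1 hz t (Finset.mem_univ t))).le
      rw [if_pos (h3.trans (mul_le_mul_of_nonneg_right h4 h5)), if_pos h]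
    · rw [if_neg h]
      split_ifs <;> norm_num
  have h3 : ∀ z : Fin n → AuxOutcome X₁ X₂ Y₁ Y₂ k, iid p n z *
      (tvDist (empirical fun t => (rvX₁ (z t), rvX₂ (z t), rvY₁ (z t), rvY₂ (z t))) (target q W) +
        ∑ i, (Real.exp (-(n * δ)) + if ∏ t, speakerProb p i (z t) ≤
          Real.exp (-(n * δ)) * M i * ∏ t, listenerProb p i (z t) then 0 else 1)) =
      iid p n z * tvDist (empirical fun t => (rvX₁ (z t), rvX₂ (z t), rvY₁ (z t), rvY₂ (z t)))
        (target q W) + ∑ i, iid p n z *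
        (Real.exp (-(n * δ)) + if ∏ t, speakerProb p i (z t) ≤
          Real.exp (-(n * δ)) * M i * ∏ t, listenerProb p i (z t) then 0 else 1) := fun z => by
    rw [mul_add, Finset.mul_sum]
  simp only [h3]
  rw [Finset.sum_add_distrib, Finset.sum_comm]
  refine (add_le_add h1 (Finset.sum_le_sum fun i _ => h2 i)).trans (le_of_eq ?_)
  rw [Finset.sum_add_distrib, ← Finset.sum_div, add_div]
  simp only [Finset.sum_const, Finset.card_univ, Fintype.card_fin, nsmul_eq_mul]
  ring

lemma sum_mul_mul_eq_one {α β : Type*} [Fintype α] [Fintype β] {b₁ : α → ℝ} {b₂ : β → ℝ}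
    (h₁ : b₁ ∈ stdSimplex ℝ α) (h₂ : b₂ ∈ stdSimplex ℝ β) : ∑ a, ∑ b, b₁ a * b₂ b = 1 := by
  rw [← Finset.sum_mul_sum, h₁.2, h₂.2, one_mul]

lemma sum_mul_mul_add_const {α β : Type*} [Fintype α] [Fintype β] {b₁ : α → ℝ} {b₂ : β → ℝ}
    (h₁ : b₁ ∈ stdSimplex ℝ α) (h₂ : b₂ ∈ stdSimplex ℝ β) (φ : α → β → ℝ) (s : ℝ) :
    ∑ a, ∑ b, b₁ a * b₂ b * (φ a b + s) = ∑ a, ∑ b, b₁ a * b₂ b * φ a b + s := by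
  simp only [mul_add, Finset.sum_add_distrib, ← Finset.sum_mul]
  rw [sum_mul_mul_eq_one h₁ h₂, one_mul]

/-- Codes that simulate independent samples of a distribution of `T(r)`. -/
lemma MemT.exists_code (hp : MemT q W p) (hq : q ∈ stdSimplex ℝ (X₁ × X₂))
    (hW : ∀ x, W x ∈ stdSimplex ℝ (Y₁ × Y₂)) {δ : ℝ} (hδ : 0 < δ) (hn : n ≠ 0) :
    ∃ κ : Code X₁ X₂ Y₁ Y₂ r n,
      (∀ i, κ.msgEntropy q i ≤ (n * (roundInfo p i + 2 * δ) + Real.log 2) / Real.log 2) ∧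
      ∑ ω, κ.law q ω * tvDist
          (empirical fun t => (ω.1 t, ω.2.1 t, ω.2.2.2.1 t, ω.2.2.2.2 t)) (target q W) ≤
        (Fintype.card (X₁ × X₂ × Y₁ × Y₂) +
          ∑ i, (1 + ∑ ω, p ω * centeredInfo p i ω ^ 2) / (2 * δ)) / √n +
          r * Real.exp (-(n * δ)) := by
  obtain ⟨ω₀, -⟩ : ∃ ω, p ω ≠ 0 := by
    by_contra! h
    have := hp.pmf.2
    simp [h] at this
  have : ∀ i, Nonempty (Fin (k i)) := fun i => ⟨rvF ω₀ i⟩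
  have : Nonempty Y₁ := ⟨rvY₁ ω₀⟩
  have : Nonempty Y₂ := ⟨rvY₂ ω₀⟩
  have hT := target_mem hq hW
  let M : Fin r → ℕ := fun i => ⌈Real.exp (n * (roundInfo p i + 2 * δ))⌉₊
  have hM : ∀ i, 0 < M i := fun i => Nat.ceil_pos.2 (Real.exp_pos _)
  let ψ : (Fin n → X₁) → (Fin n → X₂) → (Fin n → Y₁) → (Fin n → Y₂) → ℝ := fun x₁ x₂ y₁ y₂ =>
    tvDist (empirical fun t => (x₁ t, x₂ t, y₁ t, y₂ t)) (target q W)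
  -- Mean distance to the target when the outputs are drawn from possibly different reconstructions
  -- `g` and `g'` of the two terminals.
  let Φ : (∀ i, Fin n → Fin (k i)) → (∀ i, Fin n → Fin (k i)) → (Fin n → X₁) × (Fin n → X₂) → ℝ :=
    fun g g' a => ∑ y₁, ∑ y₂, blockOut₁ p n g a.1 y₁ * blockOut₂ p n g' a.2 y₂ * ψ a.1 a.2 y₁ y₂
  have hnn : ∀ g g' (a : (Fin n → X₁) × (Fin n → X₂)) y₁ y₂,
      0 ≤ blockOut₁ p n g a.1 y₁ * blockOut₂ p n g' a.2 y₂ := fun g g' a y₁ y₂ =>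
    mul_nonneg ((blockOut₁_mem hp.pmf.1 g a.1).1 _) ((blockOut₂_mem hp.pmf.1 g' a.2).1 _)
  have hone : ∀ g g' (a : (Fin n → X₁) × (Fin n → X₂)),
      ∑ y₁, ∑ y₂, blockOut₁ p n g a.1 y₁ * blockOut₂ p n g' a.2 y₂ = 1 := fun g g' a =>
    sum_mul_mul_eq_one (blockOut₁_mem hp.pmf.1 g a.1) (blockOut₂_mem hp.pmf.1 g' a.2)
  have hΦ0 : ∀ g g' a, 0 ≤ Φ g g' a := fun g g' a => Finset.sum_nonneg fun y₁ _ =>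
    Finset.sum_nonneg fun y₂ _ => mul_nonneg (hnn g g' a y₁ y₂) (tvDist_nonneg _ _)
  have hΦ1 : ∀ g g' a, Φ g g' a ≤ 1 := fun g g' a => by
    rw [← hone g g' a]
    exact Finset.sum_le_sum fun y₁ _ => Finset.sum_le_sum fun y₂ _ =>
      mul_le_of_le_one_right (hnn g g' a y₁ y₂) (tvDist_le_one (empirical_mem hn _) hT)
  obtain ⟨e₁, e₂, ρ₁, ρ₂, c, hc, hle⟩ := exists_protocol hM
    (K := blockKernel p n) (fun i v => blockKernel_mem hp.pmf.1 i v)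
    (Q := fun a => ∏ t, q (a.1 t, a.2 t)) (fun a => Finset.prod_nonneg fun t _ => hq.1 _)
    Φ hΦ0 hΦ1 (τ := Real.exp (-(n * δ))) (Real.exp_pos _).le
  refine ⟨detCode e₁ e₂ (fun c x => blockOut₁ p n (ρ₁ c x) x) (fun c x => blockOut₂ p n (ρ₂ c x) x)
    (fun c x => blockOut₁_mem hp.pmf.1 _ _) (fun c x => blockOut₂_mem hp.pmf.1 _ _), fun i => ?_, ?_⟩
  · refine (Code.msgEntropy_le _ hq i (hM i)).trans
      (div_le_div_of_nonneg_right ?_ (Real.log_nonneg (by norm_num)))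
    exact log_natCeil_exp_le (mul_nonneg (Nat.cast_nonneg n)
      (by linarith [hp.roundInfo_nonneg i]))
  · refine (sum_detCode_law (fun c x => blockOut₁_mem hp.pmf.1 _ _)
      (fun c x => blockOut₂_mem hp.pmf.1 _ _) hc q ψ).trans_le (hle.trans ?_)
    refine Eq.trans_le ?_ (hp.sum_iid_cost_le hn hδ (M := M) fun i => Nat.le_ceil _)
    simp only [← blockKernel_speaker, ← blockKernel_listener]
    refine Eq.trans ?_ (hp.sum_iid_eq hW fun w => ψ w.2.1 w.2.2.1 w.2.2.2.1 w.2.2.2.2 +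
      ∑ i, (Real.exp (-(n * δ)) + if blockKernel p n i (speaker i (fun j => w.1 j)
        (w.2.1, w.2.2.1)) (w.1 i) ≤ Real.exp (-(n * δ)) * M i * blockKernel p n i
        (listener i (fun j => w.1 j) (w.2.1, w.2.2.1)) (w.1 i) then 0 else 1)).symm
    refine Finset.sum_congr rfl fun a _ => congrArg _ (Finset.sum_congr rfl fun g _ =>
      congrArg _ ?_)
    exact (sum_mul_mul_add_const (blockOut₁_mem hp.pmf.1 g a.1) (blockOut₂_mem hp.pmf.1 g a.2)
      (ψ a.1 a.2) _).symm

/-- The rate constraint is imposed at every block length, so the short ones are filled with codes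
that say nothing. -/
lemma exists_code_msgEntropy_nonpos [Nonempty Y₁] [Nonempty Y₂]
    (hq : q ∈ stdSimplex ℝ (X₁ × X₂)) (r n : ℕ) :
    ∃ κ : Code X₁ X₂ Y₁ Y₂ r n, ∀ i, κ.msgEntropy q i ≤ 0 := by
  classical
  refine ⟨detCode (M := fun _ => 1) (fun _ _ _ => 0) (fun _ _ _ => 0)
    (fun _ _ y => if y = fun _ => Classical.arbitrary Y₁ then 1 else 0)
    (fun _ _ y => if y = fun _ => Classical.arbitrary Y₂ then 1 else 0)
    (fun _ _ => indicator_mem_stdSimplex _) (fun _ _ => indicator_mem_stdSimplex _), fun i => ?_⟩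
  refine (Code.msgEntropy_le _ hq i Nat.one_pos).trans (le_of_eq ?_)
  simp [detCode]

/-- Markov's inequality for the bad event. -/
lemma Code.prob_badEvent_le (κ : Code X₁ X₂ Y₁ Y₂ r n) (hq : q ∈ stdSimplex ℝ (X₁ × X₂)) {ε : ℝ}
    (hε : 0 < ε) : prob (κ.law q) (κ.badEvent q W ε) ≤ (∑ ω, κ.law q ω * tvDist
      (empirical fun t => (ω.1 t, ω.2.1 t, ω.2.2.2.1 t, ω.2.2.2.2 t)) (target q W)) / ε := by
  rw [le_div_iff₀ hε, prob, Finset.sum_mul]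
  refine Finset.sum_le_sum fun ω _ => ?_
  split_ifs with h
  · exact mul_le_mul_of_nonneg_left (le_of_lt h) (κ.law_nonneg hq ω)
  · rw [zero_mul]
    exact mul_nonneg (κ.law_nonneg hq ω) (tvDist_nonneg _ _)

/-- The excess `2δ` with `δ = η log 2 / (4 (r + 1))` costs `η / (2 (r + 1))` bits per letter and
round, at most `η / 2` in all. Rounding costs `1 / n` per round, at most `η / 2` in all once `n ≥ 2
r / η`. -/
lemma rate_le_of_msgEntropy_le {H I : Fin r → ℝ} {η : ℝ} (hη : 0 < η) (hn : n ≠ 0)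
    (hn' : 2 * r / η ≤ n)
    (hH : ∀ i, H i ≤ (n * (I i + 2 * (η * Real.log 2 / (4 * (r + 1)))) + Real.log 2) / Real.log 2)
    (s : Finset (Fin r)) :
    1 / (n : ℝ) * ∑ i ∈ s, H i ≤ (∑ i ∈ s, I i) / Real.log 2 + η := by
  have hl : 0 < Real.log 2 := Real.log_pos (by norm_num)
  have hn0 : (0 : ℝ) < n := by exact_mod_cast Nat.pos_of_ne_zero hn
  have hr0 : (0 : ℝ) ≤ r := Nat.cast_nonneg r
  have hs : (s.card : ℝ) ≤ r := by
    exact_mod_cast (Finset.card_le_univ s).trans_eq (Fintype.card_fin r)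
  have h1 : ∀ i, 1 / (n : ℝ) * H i ≤ I i / Real.log 2 + (η / (2 * (r + 1)) + 1 / n) := by
    intro i
    refine (mul_le_mul_of_nonneg_left (hH i) (by positivity)).trans (le_of_eq ?_)
    field_simp
    ring
  rw [Finset.mul_sum, Finset.sum_div]
  refine (Finset.sum_le_sum fun i _ => h1 i).trans ?_
  rw [Finset.sum_add_distrib, Finset.sum_const, nsmul_eq_mul]
  have h2 : (r : ℝ) * (η / (2 * (r + 1))) ≤ η / 2 := by
    rw [mul_div_assoc', div_le_div_iff₀ (by positivity) two_pos]
    nlinarith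
  have h3 : (r : ℝ) * (1 / n) ≤ η / 2 := by
    rw [div_le_iff₀ hη] at hn'
    rw [mul_one_div, div_le_iff₀ hn0]
    linarith
  have h4 : (s.card : ℝ) * (η / (2 * (r + 1)) + 1 / n) ≤ r * (η / (2 * (r + 1)) + 1 / n) :=
    mul_le_mul_of_nonneg_right hs (by positivity)
  linarith

lemma tendsto_cost (C : ℝ) (r : ℕ) {δ : ℝ} (hδ : 0 < δ) :
    Tendsto (fun n : ℕ => C / √n + r * Real.exp (-(n * δ))) atTop (𝓝 0) := by
  have h1 : Tendsto (fun n : ℕ => C / √(n : ℝ)) atTop (𝓝 0) :=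
    tendsto_const_nhds.div_atTop (Real.tendsto_sqrt_atTop.comp tendsto_natCast_atTop_atTop)
  have h2 : Tendsto (fun n : ℕ => Real.exp (-(n * δ))) atTop (𝓝 0) :=
    Real.tendsto_exp_neg_atTop_nhds_zero.comp
      (tendsto_natCast_atTop_atTop.atTop_mul_const hδ)
  simpa using h1.add (h2.const_mul (r : ℝ))

/-- The margin `η` leaves a fixed exponent `δ`, for which the mean distance, and with it the
probability of the bad event, tends to zero. Blocks shorter than `2 r / η` do not affect the limit.
-/
lemma MemT.achievable (hp : MemT q W p) (hq : q ∈ stdSimplex ℝ (X₁ × X₂))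
    (hW : ∀ x, W x ∈ stdSimplex ℝ (Y₁ × Y₂)) {R₁ R₂ : ℝ} (hR₁ : 0 ≤ R₁) (hR₂ : 0 ≤ R₂)
    (h₁ : condMutualInfo p rvX₁ rvF rvX₂ ≤ R₁) (h₂ : condMutualInfo p rvX₂ rvF rvX₁ ≤ R₂) {η : ℝ}
    (hη : 0 < η) : Achievable r q W (R₁ + η) (R₂ + η) := by
  obtain ⟨ω₀, -⟩ : ∃ ω, p ω ≠ 0 := by
    by_contra! h
    have := hp.pmf.2
    simp [h] at this
  have : Nonempty Y₁ := ⟨rvY₁ ω₀⟩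
  have : Nonempty Y₂ := ⟨rvY₂ ω₀⟩
  let δ : ℝ := η * Real.log 2 / (4 * (r + 1))
  have hδ : 0 < δ := by
    have : 0 < Real.log 2 := Real.log_pos (by norm_num)
    positivity
  let C : ℝ := Fintype.card (X₁ × X₂ × Y₁ × Y₂) +
    ∑ i, (1 + ∑ ω, p ω * centeredInfo p i ω ^ 2) / (2 * δ)
  have hcode : ∀ n : ℕ, ∃ κ : Code X₁ X₂ Y₁ Y₂ r n,
      (1 ≤ n → κ.HasRate q (R₁ + η) (R₂ + η)) ∧ (n ≠ 0 → 2 * r / η ≤ n →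
        ∑ ω, κ.law q ω * tvDist (empirical fun t => (ω.1 t, ω.2.1 t, ω.2.2.2.1 t, ω.2.2.2.2 t))
          (target q W) ≤ C / √n + r * Real.exp (-(n * δ))) := by
    intro n
    by_cases hn : n ≠ 0 ∧ 2 * r / η ≤ n
    · obtain ⟨κ, hκ, hcost⟩ := hp.exists_code hq hW hδ hn.1
      refine ⟨κ, fun _ => ⟨?_, ?_⟩, fun _ _ => hcost⟩
      · have h := rate_le_of_msgEntropy_le hη hn.1 hn.2 hκ
          (Finset.univ.filter fun i : Fin r => Odd (i.val + 1))
        rw [← hp.natsInfo_fst, ← condMutualInfo_eq_natsInfo] at h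
        exact h.trans (by linarith)
      · have h := rate_le_of_msgEntropy_le hη hn.1 hn.2 hκ
          (Finset.univ.filter fun i : Fin r => Even (i.val + 1))
        rw [← hp.natsInfo_snd, ← condMutualInfo_eq_natsInfo] at h
        exact h.trans (by linarith)
    · obtain ⟨κ, hκ⟩ := exists_code_msgEntropy_nonpos (Y₁ := Y₁) (Y₂ := Y₂) hq r n
      refine ⟨κ, fun _ => ⟨?_, ?_⟩, fun h h' => absurd ⟨h, h'⟩ hn⟩
      · exact (mul_nonpos_of_nonneg_of_nonpos (by positivity)
          (Finset.sum_nonpos fun i _ => hκ i)).trans (by linarith)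
      · exact (mul_nonpos_of_nonneg_of_nonpos (by positivity)
          (Finset.sum_nonpos fun i _ => hκ i)).trans (by linarith)
  choose κ hrate hcost using hcode
  refine ⟨κ, hrate, fun ε hε => ?_⟩
  refine squeeze_zero' (Eventually.of_forall fun n => prob_nonneg ((κ n).law_nonneg hq) _) ?_
    (by simpa using (tendsto_cost C r hδ).div_const ε)
  filter_upwards [eventually_ne_atTop 0,
    tendsto_natCast_atTop_atTop.eventually_ge_atTop (2 * r / η)] with n hn hn'
  exact ((κ n).prob_badEvent_le hq hε).trans (div_le_div_of_nonneg_right (hcost n hn hn') hε.le)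

/-- Achievability. -/
theorem MemT.mem_rateRegion (hp : MemT q W p) (hq : q ∈ stdSimplex ℝ (X₁ × X₂))
    (hW : ∀ x, W x ∈ stdSimplex ℝ (Y₁ × Y₂)) {R : ℝ × ℝ} (hR₁ : 0 ≤ R.1) (hR₂ : 0 ≤ R.2)
    (h₁ : condMutualInfo p rvX₁ rvF rvX₂ ≤ R.1) (h₂ : condMutualInfo p rvX₂ rvF rvX₁ ≤ R.2) :
    R ∈ rateRegion r q W := by
  have ht : Tendsto (fun η : ℝ => (R.1 + η, R.2 + η)) (𝓝[>] 0) (𝓝 R) := by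
    have : Continuous fun η : ℝ => (R.1 + η, R.2 + η) := by fun_prop
    simpa using (this.tendsto 0).mono_left nhdsWithin_le_nhds
  exact mem_closure_of_tendsto ht (eventually_nhdsWithin_of_forall fun η hη =>
    hp.achievable hq hW hR₁ hR₂ h₁ h₂ hη)

end Block

end Coordination

end

theorem theorem2 {X₁ X₂ Y₁ Y₂ : Type*} [Fintype X₁] [Fintype X₂] [Fintype Y₁] [Fintype Y₂]
    (q : X₁ × X₂ → ℝ) (hq : q ∈ stdSimplex ℝ (X₁ × X₂))
    (W : X₁ × X₂ → Y₁ × Y₂ → ℝ) (hW : ∀ x, W x ∈ stdSimplex ℝ (Y₁ × Y₂))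
    (r : ℕ) (hr : 1 ≤ r) :
    Coordination.rateRegion r q W =
      {R : ℝ × ℝ | 0 ≤ R.1 ∧ 0 ≤ R.2 ∧
        ∃ (k : Fin r → ℕ) (p : Coordination.AuxOutcome X₁ X₂ Y₁ Y₂ k → ℝ),
          Coordination.MemT q W p ∧
          Coordination.condMutualInfo p Coordination.rvX₁ Coordination.rvF Coordination.rvX₂
            ≤ R.1 ∧
          Coordination.condMutualInfo p Coordination.rvX₂ Coordination.rvF Coordination.rvX₁
            ≤ R.2} := by
  refine Set.Subset.antisymm (fun R hR => Coordination.exists_memT_of_mem_rateRegion hq hW hr hR) ?_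
  rintro R ⟨hR₁, hR₂, k, p, hp, h₁, h₂⟩
  exact hp.mem_rateRegion hq hW hR₁ hR₂ h₁ h₂
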